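/- Let $k$ be a commutative ring, $A$ a ($\mathbb Z$-graded, cohomological) dg $k$-algebra, $n\ge 0$, $R_n=k[t]/(t^{n+1})$, and let $A_n$ be a cdg deformation of $A$ of order $n$: a cdg algebra structure (a graded $R_n$-algebra structure, a degree $1$ derivation $d$, and a curvature $c\in A_n^2$ with $d(c)=0$ and $d^2=[c,-]$) on the graded $R_n$-module $A\otimes_k R_n$ which reduces modulo $t$ to the dg algebra $A$ (in particular $c\in tA_n$). Let $Z^0A_n\text{-Mod}$ be the category of left cdg $A_n$-modules (graded left $A_n$-modules $M$ with a degree $1$ derivation $d_M$ such that $d_M^2=c$) with morphisms the $A_n$-linear maps of degree $0$ commuting with the predifferentials. A cdg module $M$ is $n$-acyclic if the complexes $t^iM/t^{i+1}M$, $0\le i\le n$, are acyclic; a morphism is an $n$-quasi-isomorphism if its cone is $n$-acyclic. Let $A_i=A_n/t^{i+1}A_n$ and $A_{-1}=0$, let $\pi\colon A_i\to A_{i-1}$ be the projection, and choose $\frac ct\in A_n^2$ with $t\frac ct=c$. For $0\le i\le n$ let $\Gamma_i$ be the cdg $A_n$-module $A_i\oplus A_{i-1}[1]$ with predifferential $(\alpha,a)\mapsto(d\alpha+ta,\,-da+\pi(\alpha\tfrac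 ct))$. A cdg module $P$ is $n$-semifree if it has a filtration by cdg submodules $0=F_0P\subseteq F_1P\subseteq\cdots$ with $P=\bigcup_iF_iP$, whose inclusions $F_iP\hookrightarrow F_{i+1}P$ split as morphisms of graded $A_n$-modules and whose quotients $F_{i+1}P/F_iP$ are isomorphic to direct sums of shifts of the modules $\Gamma_0,\dots,\Gamma_n$. Then $Z^0A_n\text{-Mod}$ carries a cofibrantly generated model structure such that: 1. the weak equivalences are exactly the $n$-quasi-isomorphisms; 2. the fibrations are exactly the morphisms $f\colon M\to N$ such that the induced map $\operatorname{Ker}t^i_M\to\operatorname{Ker}t^i_N$ is surjective for all $i=1,\dots,n+1$, where $t^i_M\colon M\to M$ is the action of $t^i$; 3. the cofibrant objects are exactly the retracts of $n$-semifree modules; 4. the cofibrations are exactly the graded split injections with cofibrant cokernel, i.e. the morphisms $f\colon M\to N$ that have a retraction as morphisms of graded $A_n$-modules and for which $N/f(M)$ is cofibrant. -/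

import Mathlib

open CategoryTheory
open scoped TensorProduct DirectSum

universe v u

noncomputable section

namespace Curved

/-! ### Curved dg algebras and their deformations -/

/-- A cdg algebra over a commutative ring `R`: a `ℤ`-graded associative unital `R`-algebra with a
derivation `d` of degree `1` (the predifferential) and a closed element `c` of degree `2`
(the curvature) such that `d² = [c, -]`. -/
structure CDGAlgebra (R : Type v) [CommRing R] where
  /-- the underlying set -/
  carrier : Type u
  [ring : Ring carrier]
  [algebra : Algebra R carrier]
  /-- the homogeneous components -/
  grading : ℤ → Submodule R carrier
  [gradedAlgebra : GradedAlgebra grading]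
  /-- the predifferential -/
  d : carrier →ₗ[R] carrier
  d_mem : ∀ {i : ℤ} {a : carrier}, a ∈ grading i → d a ∈ grading (i + 1)
  d_mul : ∀ {i : ℤ} {a : carrier} (b : carrier), a ∈ grading i →
    d (a * b) = d a * b + i.negOnePow • (a * d b)
  /-- the curvature -/
  c : carrier
  c_mem : c ∈ grading 2
  d_c : d c = 0
  d_d : ∀ a : carrier, d (d a) = c * a - a * c

attribute [instance] CDGAlgebra.ring CDGAlgebra.algebra CDGAlgebra.gradedAlgebra

/-- A dg algebra is a cdg algebra with zero curvature. -/
structure DGAlgebra (R : Type v) [CommRing R] extends CDGAlgebra.{v, u} R where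
  c_eq_zero : c = 0

/-- `R_n = k[t]/(t^(n+1))`. -/
abbrev TruncPoly (k : Type v) [CommRing k] (n : ℕ) : Type v :=
  AdjoinRoot (Polynomial.X ^ (n + 1) : Polynomial k)

/-- The augmentation `R_n → k` sending `t` to `0`. -/
def TruncPoly.aug (k : Type v) [CommRing k] (n : ℕ) : TruncPoly k n →ₐ[k] k :=
  AdjoinRoot.liftAlgHom _ (Algebra.ofId k k) 0 (by simp)

/-- Reduction modulo `t`, as a map `R_n ⊗ V → k ⊗ V ≅ V`. -/
def TruncPoly.reduce (k : Type v) [CommRing k] (n : ℕ) (V : Type u) [AddCommGroup V] [Module k V] :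
    (TruncPoly k n ⊗[k] V) →ₗ[k] V :=
  (TensorProduct.lid k V).toLinearMap ∘ₗ LinearMap.rTensor V (TruncPoly.aug k n).toLinearMap

/-- A cdg deformation of order `n` of the dg `k`-algebra `A`: a cdg algebra over
`R_n = k[t]/(t^(n+1))` whose underlying graded `R_n`-module is (identified, through `equiv`, with)
`R_n ⊗ A`, and which reduces modulo `t` to the dg algebra `A` (unit, product, differential, and
curvature zero). -/
structure CDGDeformation {k : Type v} [CommRing k] (A : DGAlgebra.{v, u} k) (n : ℕ) extends
    CDGAlgebra.{v, u} (TruncPoly k n) where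
  /-- the identification of the underlying `R_n`-module with `R_n ⊗ A` -/
  equiv : carrier ≃ₗ[TruncPoly k n] (TruncPoly k n ⊗[k] A.carrier)
  mem_grading_iff : ∀ (i : ℤ) (b : carrier),
    b ∈ grading i ↔ equiv b ∈ (A.grading i).baseChange (TruncPoly k n)
  reduce_one : TruncPoly.reduce k n A.carrier (equiv 1) = 1
  reduce_mul : ∀ b b' : carrier, TruncPoly.reduce k n A.carrier (equiv (b * b')) =
    TruncPoly.reduce k n A.carrier (equiv b) * TruncPoly.reduce k n A.carrier (equiv b')
  reduce_d : ∀ b : carrier, TruncPoly.reduce k n A.carrier (equiv (d b)) =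
    A.d (TruncPoly.reduce k n A.carrier (equiv b))
  reduce_c : TruncPoly.reduce k n A.carrier (equiv c) = 0

/-! ### A criterion for gradings -/

/-- A family of subgroups which generates the group and admits a compatible family of projections
is a grading. -/
@[reducible]
def decompositionOfProj {M : Type u} [AddCommGroup M] (ℳ : ℤ → AddSubgroup M)
    (p : ℤ → M →+ M) (h₁ : ∀ i m, m ∈ ℳ i → p i m = m)
    (h₂ : ∀ i j m, i ≠ j → m ∈ ℳ j → p i m = 0) (h₃ : ⨆ i, ℳ i = ⊤) :
    DirectSum.Decomposition ℳ :=
  DirectSum.IsInternal.chooseDecomposition ℳ <| by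
    have key : ∀ (i : ℤ) (x : ⨁ i, ℳ i), p i (DirectSum.coeAddMonoidHom ℳ x) = x i := by
      intro i x
      induction x using DirectSum.induction_on with
      | zero => simp
      | of j y =>
        rw [DirectSum.coeAddMonoidHom_of]
        by_cases h : i = j
        · subst h
          rw [h₁ i y y.2, DirectSum.of_eq_same]
        · rw [h₂ i j y h y.2, DirectSum.of_eq_of_ne _ _ _ h]
          rfl
      | add x y hx hy => simp [map_add, hx, hy]
    constructor
    · intro x y hxy
      refine DFinsupp.ext fun i => Subtype.ext ?_
      rw [← key i x, ← key i y, hxy]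
    · rw [← AddMonoidHom.range_eq_top, eq_top_iff, ← h₃, iSup_le_iff]
      intro i m hm
      exact ⟨DirectSum.of (fun i => ℳ i) i ⟨m, hm⟩, DirectSum.coeAddMonoidHom_of _ _ _⟩

section Algebra

variable {R : Type v} [CommRing R] (B : CDGAlgebra.{v, u} R)

/-- The sign automorphism `a ↦ (-1)^(l|a|) a` of the graded algebra underlying `B`, additively. -/
def CDGAlgebra.signAdd (l : ℤ) : B.carrier →+ B.carrier :=
  (DirectSum.toAddMonoid fun i => (l * i).negOnePow • (B.grading i).subtype.toAddMonoidHom).comp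
    (DirectSum.decomposeAddEquiv B.grading).toAddMonoidHom

lemma CDGAlgebra.signAdd_of_mem (l : ℤ) {i : ℤ} {a : B.carrier} (ha : a ∈ B.grading i) :
    B.signAdd l a = (l * i).negOnePow • a := by
  simp only [signAdd, AddMonoidHom.comp_apply]
  change (DirectSum.toAddMonoid _) (DirectSum.decompose B.grading a) = _
  rw [DirectSum.decompose_of_mem _ ha, DirectSum.toAddMonoid_of]
  rfl

lemma CDGAlgebra.signAdd_mul (l : ℤ) (a b : B.carrier) :
    B.signAdd l (a * b) = B.signAdd l a * B.signAdd l b := by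
  induction a using DirectSum.Decomposition.inductionOn B.grading with
  | zero => simp
  | add x y hx hy => simp [add_mul, hx, hy]
  | @homogeneous i x =>
    induction b using DirectSum.Decomposition.inductionOn B.grading with
    | zero => simp
    | add x y hx hy => simp [mul_add, hx, hy]
    | @homogeneous j y =>
      rw [B.signAdd_of_mem l x.2, B.signAdd_of_mem l y.2,
        B.signAdd_of_mem l (SetLike.mul_mem_graded x.2 y.2), mul_add, Int.negOnePow_add,
        smul_mul_smul_comm]

/-- The sign automorphism `a ↦ (-1)^(l|a|) a` of the graded algebra underlying `B`. -/
def CDGAlgebra.sign (l : ℤ) : B.carrier →+* B.carrier :=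
  { B.signAdd l with
    map_one' := by
      change B.signAdd l 1 = 1
      rw [B.signAdd_of_mem l (SetLike.one_mem_graded B.grading)]
      simp
    map_mul' := B.signAdd_mul l }

lemma CDGAlgebra.sign_of_mem (l : ℤ) {i : ℤ} {a : B.carrier} (ha : a ∈ B.grading i) :
    B.sign l a = (l * i).negOnePow • a :=
  B.signAdd_of_mem l ha

lemma CDGAlgebra.sign_mem (l : ℤ) {i : ℤ} {a : B.carrier} (ha : a ∈ B.grading i) :
    B.sign l a ∈ B.grading i := by
  rw [B.sign_of_mem l ha, Units.smul_def]
  exact zsmul_mem ha _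

lemma CDGAlgebra.sign_c (l : ℤ) : B.sign l B.c = B.c := by
  rw [B.sign_of_mem l B.c_mem, Int.negOnePow_even _ (by simp), one_smul]

lemma CDGAlgebra.d_one : B.d 1 = 0 := by
  have h := B.d_mul 1 (SetLike.one_mem_graded B.grading)
  simpa using h

lemma CDGAlgebra.d_algebraMap (r : R) : B.d (algebraMap R B.carrier r) = 0 := by
  rw [Algebra.algebraMap_eq_smul_one, map_smul, B.d_one, smul_zero]

/-! ### Graded modules with a predifferential, and cdg modules -/

/-- A left qdg module over `B`: a graded left module with a derivation of degree `1`. -/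
structure QDGModule where
  /-- the underlying set -/
  carrier : Type u
  [addCommGroup : AddCommGroup carrier]
  [module : Module B.carrier carrier]
  /-- the homogeneous components -/
  grading : ℤ → AddSubgroup carrier
  [decomposition : DirectSum.Decomposition grading]
  smul_mem : ∀ {i j : ℤ} {a : B.carrier} {m : carrier}, a ∈ B.grading i → m ∈ grading j →
    a • m ∈ grading (i + j)
  /-- the predifferential -/
  d : carrier →+ carrier
  d_mem : ∀ {i : ℤ} {m : carrier}, m ∈ grading i → d m ∈ grading (i + 1)
  d_smul : ∀ {i : ℤ} {a : B.carrier} (m : carrier), a ∈ B.grading i →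
    d (a • m) = B.d a • m + i.negOnePow • (a • d m)

attribute [instance] QDGModule.addCommGroup QDGModule.module QDGModule.decomposition

/-- A left cdg module over `B`: a qdg module whose predifferential squares to the action of the
curvature. -/
structure CDGModule extends QDGModule B where
  d_d : ∀ m : carrier, d (d m) = B.c • m

variable {B}

namespace QDGModule

variable (M : QDGModule B)

lemma iSup_grading : ⨆ i, M.grading i = ⊤ := by
  classical
  rw [eq_top_iff]
  intro m _
  rw [← DirectSum.sum_support_decompose M.grading m]
  exact sum_mem fun i _ => le_iSup M.grading i (SetLike.coe_mem _)

/-- The projection of `M` to its component of degree `i`. -/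
def proj (i : ℤ) : M.carrier →+ M.carrier :=
  ((M.grading i).subtype.comp (DFinsupp.evalAddMonoidHom i)).comp
    (DirectSum.decomposeAddEquiv M.grading).toAddMonoidHom

lemma proj_apply (i : ℤ) (m : M.carrier) :
    M.proj i m = (DirectSum.decompose M.grading m i : M.carrier) := rfl

lemma proj_mem (i : ℤ) (m : M.carrier) : M.proj i m ∈ M.grading i := SetLike.coe_mem _

lemma proj_of_mem {i : ℤ} {m : M.carrier} (hm : m ∈ M.grading i) : M.proj i m = m :=
  DirectSum.decompose_of_mem_same _ hm

lemma proj_of_mem_ne {i j : ℤ} {m : M.carrier} (hij : i ≠ j) (hm : m ∈ M.grading j) :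
    M.proj i m = 0 :=
  DirectSum.decompose_of_mem_ne _ hm hij.symm

lemma proj_of_mem_eq_ite {i j : ℤ} {m : M.carrier} (hm : m ∈ M.grading j) :
    M.proj i m = if i = j then m else 0 := by
  split_ifs with h
  · subst h; exact M.proj_of_mem hm
  · exact M.proj_of_mem_ne h hm

lemma induction {motive : M.carrier → Prop} (m : M.carrier) (zero : motive 0)
    (homogeneous : ∀ (i : ℤ) (m : M.carrier), m ∈ M.grading i → motive m)
    (add : ∀ m m', motive m → motive m' → motive (m + m')) : motive m :=
  DirectSum.Decomposition.inductionOn M.grading zero (fun {i} m => homogeneous i m m.2) add m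

/-- An additive map that has degree `e` commutes with projections. -/
lemma proj_map {M N : QDGModule B} (e : ℤ) (f : M.carrier →+ N.carrier)
    (hf : ∀ {i : ℤ} {m : M.carrier}, m ∈ M.grading i → f m ∈ N.grading (i + e))
    (i : ℤ) (m : M.carrier) : N.proj (i + e) (f m) = f (M.proj i m) := by
  induction m using M.induction with
  | zero => simp
  | add m m' h h' => simp [h, h']
  | homogeneous j m hm =>
    rw [N.proj_of_mem_eq_ite (hf hm), M.proj_of_mem_eq_ite hm]
    by_cases h : i = j <;> simp [h]

/-- The underlying set of the shift `M[l]`; it carries a twisted module structure. -/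
def ShiftCarrier (_ : ℤ) : Type u := M.carrier

instance (l : ℤ) : AddCommGroup (M.ShiftCarrier l) := inferInstanceAs (AddCommGroup M.carrier)

/-- The action on `M[l]`: a homogeneous element `a` acts as `(-1)^(l|a|) a`. -/
instance (l : ℤ) : Module B.carrier (M.ShiftCarrier l) := Module.compHom M.carrier (B.sign l)

/-- The shift `M[l]`: `M[l]^i = M^(i+l)`, with predifferential `(-1)^l d` and with the usual sign
`(-1)^(l|a|)` in the left action. -/
def shift (l : ℤ) : QDGModule B where
  carrier := M.ShiftCarrier l
  grading i := M.grading (i + l)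
  decomposition := decompositionOfProj (M := M.carrier) _ (fun i => M.proj (i + l))
    (fun _ _ hm => M.proj_of_mem hm)
    (fun _ _ _ hij hm => M.proj_of_mem_ne (by simpa using hij) hm)
    ((Equiv.addRight l).iSup_comp (g := M.grading) |>.trans M.iSup_grading)
  smul_mem {i j a m} ha hm := by
    have := M.smul_mem (B.sign_mem l ha) hm
    rwa [← add_assoc] at this
  d := l.negOnePow • M.d
  d_mem {i m} hm := by
    have := M.d_mem hm
    rw [add_right_comm] at this
    change ((l.negOnePow : ℤˣ) : ℤ) • M.d m ∈ M.grading (i + 1 + l)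
    exact zsmul_mem this _
  d_smul {i a} m ha := by
    change l.negOnePow • M.d (B.sign l a • (show M.carrier from m)) =
      (show M.carrier from B.sign l (B.d a) • (show M.carrier from m)) +
        i.negOnePow • (B.sign l a • (l.negOnePow • M.d m))
    have h1 : B.sign l (B.d a) = l.negOnePow • B.d (B.sign l a) := by
      rw [B.sign_of_mem l (B.d_mem ha), B.sign_of_mem l ha, mul_add, mul_one, Int.negOnePow_add,
        Units.smul_def (l * i).negOnePow, map_zsmul, ← Units.smul_def, smul_smul, mul_comm]
    rw [M.d_smul _ (B.sign_mem l ha), h1, smul_add, smul_assoc]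
    congr 1
    rw [smul_comm (B.sign l a) l.negOnePow, smul_comm]

/-- The direct sum of two qdg modules. -/
def prod (N : QDGModule B) : QDGModule B where
  carrier := M.carrier × N.carrier
  grading i := (M.grading i).prod (N.grading i)
  decomposition := decompositionOfProj _ (fun i => (M.proj i).prodMap (N.proj i))
    (fun _ _ hm => Prod.ext (M.proj_of_mem hm.1) (N.proj_of_mem hm.2))
    (fun _ _ _ hij hm => Prod.ext (M.proj_of_mem_ne hij hm.1) (N.proj_of_mem_ne hij hm.2))
    (by
      rw [eq_top_iff]
      rintro ⟨m, n⟩ -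
      rw [show ((m, n) : M.carrier × N.carrier) = (m, 0) + (0, n) by simp]
      refine add_mem ?_ ?_
      · induction m using M.induction with
        | zero => exact zero_mem _
        | add m m' h h' => simpa using add_mem h h'
        | homogeneous i m hm =>
          exact AddSubgroup.mem_iSup_of_mem i ⟨hm, zero_mem _⟩
      · induction n using N.induction with
        | zero => exact zero_mem _
        | add m m' h h' => simpa using add_mem h h'
        | homogeneous i n hn =>
          exact AddSubgroup.mem_iSup_of_mem i ⟨zero_mem _, hn⟩)
  smul_mem ha hm := ⟨M.smul_mem ha hm.1, N.smul_mem ha hm.2⟩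
  d := M.d.prodMap N.d
  d_mem hm := ⟨M.d_mem hm.1, N.d_mem hm.2⟩
  d_smul m ha := Prod.ext (M.d_smul _ ha) (N.d_smul _ ha)

/-- The twist of `M` by a `B`-linear endomorphism `F` of degree `1` (with the Koszul sign
`F (a m) = (-1)^|a| a F m`): the predifferential becomes `d + F`. -/
def twist (F : M.carrier →+ M.carrier)
    (hF : ∀ {i : ℤ} {m : M.carrier}, m ∈ M.grading i → F m ∈ M.grading (i + 1))
    (hF' : ∀ {i : ℤ} {a : B.carrier} (m : M.carrier), a ∈ B.grading i →
      F (a • m) = i.negOnePow • (a • F m)) : QDGModule B where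
  carrier := M.carrier
  grading := M.grading
  smul_mem := M.smul_mem
  d := M.d + F
  d_mem hm := add_mem (M.d_mem hm) (hF hm)
  d_smul m ha := by
    simp only [AddMonoidHom.add_apply, M.d_smul m ha, hF' m ha, smul_add, add_assoc]

/-- The free module `B`, as a qdg module. -/
def self (B : CDGAlgebra.{v, u} R) : QDGModule B where
  carrier := B.carrier
  grading i := (B.grading i).toAddSubgroup
  decomposition :=
    { decompose' := DirectSum.decompose B.grading
      left_inv := (DirectSum.decompose B.grading).left_inv
      right_inv := (DirectSum.decompose B.grading).right_inv }
  smul_mem ha hm := SetLike.mul_mem_graded ha hm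
  d := B.d.toAddMonoidHom
  d_mem := B.d_mem
  d_smul m ha := B.d_mul m ha

end QDGModule

/-- A sub-qdg-module of `M`: a homogeneous `B`-submodule stable under the predifferential. -/
structure QDGSubmodule (M : QDGModule B) where
  /-- the underlying submodule -/
  toSubmodule : Submodule B.carrier M.carrier
  proj_mem : ∀ (i : ℤ) {m : M.carrier}, m ∈ toSubmodule → M.proj i m ∈ toSubmodule
  d_mem : ∀ {m : M.carrier}, m ∈ toSubmodule → M.d m ∈ toSubmodule

namespace QDGSubmodule

variable {M : QDGModule B} (S : QDGSubmodule M)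

/-- A sub-qdg-module, as a qdg module. -/
def toModule : QDGModule B where
  carrier := S.toSubmodule
  grading i := (M.grading i).comap S.toSubmodule.subtype.toAddMonoidHom
  decomposition := decompositionOfProj _
    (fun i => ((M.proj i).comp S.toSubmodule.subtype.toAddMonoidHom).codRestrict S.toSubmodule
      fun m => S.proj_mem i m.2)
    (fun i m hm => Subtype.ext (M.proj_of_mem hm))
    (fun i j m hij hm => Subtype.ext (M.proj_of_mem_ne hij hm))
    (by
      classical
      rw [eq_top_iff]
      intro m _
      have h : m = ∑ i ∈ (DirectSum.decompose M.grading (m : M.carrier)).support,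
          (⟨M.proj i m, S.proj_mem i m.2⟩ : S.toSubmodule) := by
        apply Subtype.ext
        rw [AddSubmonoidClass.coe_finsetSum]
        exact (DirectSum.sum_support_decompose M.grading (m : M.carrier)).symm
      rw [h]
      exact sum_mem fun i _ => AddSubgroup.mem_iSup_of_mem i (M.proj_mem i m))
  smul_mem ha hm := M.smul_mem ha hm
  d := (M.d.comp S.toSubmodule.subtype.toAddMonoidHom).codRestrict S.toSubmodule
      fun m => S.d_mem m.2
  d_mem hm := M.d_mem hm
  d_smul m ha := Subtype.ext (M.d_smul _ ha)

/-- The quotient `M / S`. -/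
def quotient : QDGModule B where
  carrier := M.carrier ⧸ S.toSubmodule
  grading i := (M.grading i).map S.toSubmodule.mkQ.toAddMonoidHom
  decomposition := decompositionOfProj _
    (fun i => QuotientAddGroup.map S.toSubmodule.toAddSubgroup S.toSubmodule.toAddSubgroup
      (M.proj i) (fun _ hm => S.proj_mem i hm))
    (by
      rintro i _ ⟨m, hm, rfl⟩
      exact congrArg S.toSubmodule.mkQ (M.proj_of_mem hm))
    (by
      rintro i j _ hij ⟨m, hm, rfl⟩
      exact (congrArg S.toSubmodule.mkQ (M.proj_of_mem_ne hij hm)).trans (map_zero _))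
    (by
      rw [← AddSubgroup.map_iSup, M.iSup_grading, ← AddMonoidHom.range_eq_map,
        AddMonoidHom.range_eq_top]
      exact S.toSubmodule.mkQ_surjective)
  smul_mem := by
    rintro i j a _ ha ⟨m, hm, rfl⟩
    exact ⟨a • m, M.smul_mem ha hm, rfl⟩
  d := QuotientAddGroup.map S.toSubmodule.toAddSubgroup S.toSubmodule.toAddSubgroup
      M.d (fun _ hm => S.d_mem hm)
  d_mem := by
    rintro i _ ⟨m, hm, rfl⟩
    exact ⟨M.d m, M.d_mem hm, rfl⟩
  d_smul := by
    intro i a m ha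
    obtain ⟨m, rfl⟩ := S.toSubmodule.mkQ_surjective m
    refine (congrArg S.toSubmodule.mkQ (M.d_smul m ha)).trans ?_
    rw [map_add, Units.smul_def, map_zsmul, map_smul, map_smul]
    rfl

/-- The sub-qdg-module `S ∩ T` of `T`. -/
def restrict (S T : QDGSubmodule M) : QDGSubmodule T.toModule where
  toSubmodule := S.toSubmodule.comap T.toSubmodule.subtype
  proj_mem i m hm := by
    have h : M.proj i (T.toSubmodule.subtype m) = T.toSubmodule.subtype (T.toModule.proj i m) := by
      have h' := QDGModule.proj_map (M := T.toModule) (N := M) 0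
        T.toSubmodule.subtype.toAddMonoidHom (fun {i m} hm => by rw [add_zero]; exact hm) i m
      rw [add_zero] at h'
      exact h'
    change T.toSubmodule.subtype (T.toModule.proj i m) ∈ S.toSubmodule
    rw [← h]
    exact S.proj_mem i hm
  d_mem hm := S.d_mem hm

end QDGSubmodule

/-! ### The category `Z⁰(B-Mod)` -/

namespace CDGModule

/-- A closed morphism of degree `0`: a `B`-linear map which preserves degrees and commutes with
the predifferentials. -/
@[ext]
structure Hom (M N : CDGModule B) where
  /-- the underlying linear map -/
  toLinearMap : M.carrier →ₗ[B.carrier] N.carrier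
  map_mem : ∀ {i : ℤ} {m : M.carrier}, m ∈ M.grading i → toLinearMap m ∈ N.grading i
  map_d : ∀ m : M.carrier, toLinearMap (M.d m) = N.d (toLinearMap m)

/-- The category `Z⁰(B-Mod)` of cdg modules over `B` and closed morphisms of degree `0`. -/
instance : Category.{u} (CDGModule B) where
  Hom := Hom
  id M := ⟨LinearMap.id, fun h => h, fun _ => rfl⟩
  comp f g := ⟨g.toLinearMap ∘ₗ f.toLinearMap, fun h => g.map_mem (f.map_mem h), fun m => by
    simp [f.map_d, g.map_d]⟩

/-- The underlying linear map of a morphism. -/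
abbrev linearMap {M N : CDGModule B} (f : M ⟶ N) : M.carrier →ₗ[B.carrier] N.carrier :=
  Hom.toLinearMap f

/-- The shift `M[l]`. -/
def shift (M : CDGModule B) (l : ℤ) : CDGModule B where
  toQDGModule := M.toQDGModule.shift l
  d_d m := by
    have h : ∀ m : M.carrier, l.negOnePow • M.d (l.negOnePow • M.d m) = B.sign l B.c • m := by
      intro m
      rw [B.sign_c, Units.smul_def l.negOnePow (M.d m), map_zsmul, M.d_d, ← Units.smul_def,
        smul_smul, ← Int.negOnePow_add, Int.negOnePow_even _ (Even.add_self l), one_smul]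
    exact h m

/-- A sub-qdg-module of a cdg module, as a cdg module. -/
def sub {M : CDGModule B} (S : QDGSubmodule M.toQDGModule) : CDGModule B where
  toQDGModule := S.toModule
  d_d _ := Subtype.ext (M.d_d _)

/-- The quotient of a cdg module by a sub-qdg-module. -/
def quotient {M : CDGModule B} (S : QDGSubmodule M.toQDGModule) : CDGModule B where
  toQDGModule := S.quotient
  d_d := by
    intro x
    obtain ⟨m, rfl⟩ := S.toSubmodule.mkQ_surjective x
    exact congrArg S.toSubmodule.mkQ (M.d_d m)

/-- The quotient `T / S` for `S ⊆ T ⊆ M` (and `T / (S ∩ T)` in general). -/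
def subquotient {M : CDGModule B} (T S : QDGSubmodule M.toQDGModule) : CDGModule B :=
  quotient (M := sub T) (S.restrict T)

/-- The image of a closed morphism. -/
def range {M N : CDGModule B} (f : M ⟶ N) : QDGSubmodule N.toQDGModule where
  toSubmodule := LinearMap.range (linearMap f)
  proj_mem := by
    rintro i _ ⟨m, rfl⟩
    have h := QDGModule.proj_map (M := M.toQDGModule) (N := N.toQDGModule) 0
      (linearMap f).toAddMonoidHom (fun {i m} hm => by rw [add_zero]; exact f.map_mem hm) i m
    rw [add_zero] at h
    exact ⟨M.proj i m, h.symm⟩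
  d_mem := by
    rintro _ ⟨m, rfl⟩
    exact ⟨M.d m, f.map_d m⟩

/-- The cokernel `N / f(M)` of a closed morphism `f : M ⟶ N`. -/
def coker {M N : CDGModule B} (f : M ⟶ N) : CDGModule B := quotient (range f)

/-- The cone of a closed morphism `f : M ⟶ N`: the direct sum `N ⊕ M[1]` with predifferential
`(y, x) ↦ (d y + f x, - d x)`. -/
def cone {M N : CDGModule B} (f : M ⟶ N) : CDGModule B where
  toQDGModule := (N.toQDGModule.prod (M.toQDGModule.shift 1)).twist
    ((AddMonoidHom.inl N.carrier (M.toQDGModule.shift 1).carrier).comp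
      (AddMonoidHom.comp (linearMap f).toAddMonoidHom
        (AddMonoidHom.snd N.carrier (M.toQDGModule.shift 1).carrier)))
    (fun hm => ⟨f.map_mem hm.2, zero_mem _⟩)
    (fun {i a} m ha => by
      refine Prod.ext ?_ ?_
      · change linearMap f (B.sign 1 a • (show M.carrier from m.2)) =
          i.negOnePow • (a • linearMap f (show M.carrier from m.2))
        rw [map_smul, B.sign_of_mem 1 ha, one_mul, smul_assoc]
      · change (0 : (M.toQDGModule.shift 1).carrier) = i.negOnePow • (a • 0)
        simp)
  d_d := by
    rintro ⟨y, x⟩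
    have hy : ∀ (y : N.carrier) (x : M.carrier), N.d (N.d y + linearMap f x) +
        linearMap f (((1 : ℤ).negOnePow • M.d x) + 0) = B.c • y := by
      intro y x
      rw [map_add, N.d_d, ← Hom.map_d f, Int.negOnePow_one, add_zero, Units.smul_def]
      simp
    have hx : ∀ x : (M.shift 1).carrier, (M.shift 1).d ((M.shift 1).d x + 0) + 0 = B.c • x := by
      intro x
      rw [add_zero, add_zero, (M.shift 1).d_d]
    exact Prod.ext (hy y x) (hx x)

/-- The direct sum of a family of cdg modules. -/
def directSum {ι : Type u} (N : ι → CDGModule B) : CDGModule B where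
  carrier := Π₀ j, (N j).carrier
  grading i :=
    { carrier := {x | ∀ j, x j ∈ (N j).grading i}
      zero_mem' := fun j => zero_mem _
      add_mem' := fun hx hy j => add_mem (hx j) (hy j)
      neg_mem' := fun hx j => neg_mem (hx j) }
  decomposition := decompositionOfProj _
    (fun i => DFinsupp.mapRange.addMonoidHom fun j => (N j).proj i)
    (fun i m hm => DFinsupp.ext fun j => (N j).proj_of_mem (hm j))
    (fun i j m hij hm => DFinsupp.ext fun s => (N s).proj_of_mem_ne hij (hm s))
    (by
      classical
      rw [eq_top_iff]
      intro x _
      induction x using DFinsupp.induction with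
      | h0 => exact zero_mem _
      | ha s b f _ _ ih =>
        refine add_mem ?_ (ih (by simp))
        clear * -
        induction b using (N s).induction with
        | zero => simp
        | add m m' h h' =>
          rw [DFinsupp.single_add]
          exact add_mem h h'
        | homogeneous i m hm =>
          refine AddSubgroup.mem_iSup_of_mem i fun j => ?_
          by_cases h : s = j
          · subst h; simpa using hm
          · rw [DFinsupp.single_eq_of_ne (Ne.symm h)]; exact zero_mem _)
  smul_mem ha hm j := (N j).smul_mem ha (hm j)
  d := DFinsupp.mapRange.addMonoidHom fun j => (N j).d
  d_mem hm j := (N j).d_mem (hm j)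
  d_smul m ha := DFinsupp.ext fun j => (N j).d_smul (m j) ha
  d_d m := DFinsupp.ext fun j => (N j).d_d (m j)

/-- A closed morphism is a graded split injection if it has a retraction in the category of graded
`B`-modules (the retraction need not commute with the predifferentials). -/
def IsGradedSplitInjection {M N : CDGModule B} (f : M ⟶ N) : Prop :=
  ∃ r : N.carrier →ₗ[B.carrier] M.carrier,
    (∀ (i : ℤ) (y : N.carrier), y ∈ N.grading i → r y ∈ M.grading i) ∧
    ∀ x : M.carrier, r (linearMap f x) = x

/-- The inclusion `S ⊆ T` of sub-qdg-modules splits as a morphism of graded modules. -/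
def InclusionGradedSplits {M : CDGModule B} (S T : QDGSubmodule M.toQDGModule) : Prop :=
  ∃ h : S.toSubmodule ≤ T.toSubmodule, IsGradedSplitInjection (M := sub S) (N := sub T)
    ⟨Submodule.inclusion h, fun hm => hm, fun _ => rfl⟩

/-- Let `X` be a family of cdg modules. A cdg module `P` is `X`-semifree if it has an exhaustive
filtration `0 = F 0 ⊆ F 1 ⊆ ⋯` whose inclusions split as morphisms of graded modules and whose
successive quotients are isomorphic to direct sums of shifts of members of `X`. -/
def IsSemifree {J : Type} (X : J → CDGModule B) (P : CDGModule B) : Prop :=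
  ∃ F : ℕ → QDGSubmodule P.toQDGModule,
    (F 0).toSubmodule = ⊥ ∧
    (∀ x : P.carrier, ∃ i, x ∈ (F i).toSubmodule) ∧
    ∀ i, InclusionGradedSplits (F i) (F (i + 1)) ∧
      ∃ (ι : Type u) (s : ι → J) (l : ι → ℤ),
        Nonempty (subquotient (F (i + 1)) (F i) ≅ directSum fun j => (X (s j)).shift (l j))

end CDGModule

end Algebra

/-! ### The modules `Γ_i` -/

open Polynomial in
/-- Division by `t` in `R_n`: it is used to divide the curvature by `t` and to compute the
annihilator of `t`. -/
lemma TruncPoly.exists_divT (k : Type v) [CommRing k] (n : ℕ) :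
    ∃ δ s : TruncPoly k n →ₗ[k] TruncPoly k n,
      (∀ r, r = algebraMap k _ (TruncPoly.aug k n r) + AdjoinRoot.root _ * δ r) ∧
      (∀ r, r = δ (AdjoinRoot.root _ * r) + AdjoinRoot.root _ ^ n * s r) := by
  rcases subsingleton_or_nontrivial k with hk | hk
  · have : Subsingleton (TruncPoly k n) := Module.subsingleton k _
    exact ⟨0, 0, fun r => Subsingleton.elim _ _, fun r => Subsingleton.elim _ _⟩
  have hm : (X ^ (n + 1) : k[X]).Monic := monic_X_pow _
  have hlt : ∀ j, j ≤ n → (X ^ j : k[X]) %ₘ X ^ (n + 1) = X ^ j := fun j hj => by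
    rw [modByMonic_eq_self_iff hm, degree_X_pow, degree_X_pow]
    exact_mod_cast Nat.lt_succ_of_le hj
  have hge : ∀ j, n < j → (X ^ j : k[X]) %ₘ X ^ (n + 1) = 0 := fun j hj =>
    (modByMonic_eq_zero_iff_dvd hm).2 (pow_dvd_pow _ hj)
  let mkL : k[X] →ₗ[k] TruncPoly k n := (AdjoinRoot.mkₐ (X ^ (n + 1) : k[X])).toLinearMap
  let dX : k[X] →ₗ[k] k[X] :=
    { divX_hom with
      map_smul' := fun a p => by
        ext j
        simp [divX_hom] }
  let δ : TruncPoly k n →ₗ[k] TruncPoly k n := mkL ∘ₗ dX ∘ₗ AdjoinRoot.modByMonicHom hm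
  let s : TruncPoly k n →ₗ[k] TruncPoly k n :=
    mkL ∘ₗ monomial 0 ∘ₗ lcoeff k n ∘ₗ AdjoinRoot.modByMonicHom hm
  have hδ : ∀ p : k[X], δ (AdjoinRoot.mk _ p) = AdjoinRoot.mk _ (divX (p %ₘ X ^ (n + 1))) :=
    fun p => rfl
  have hs : ∀ p : k[X], s (AdjoinRoot.mk _ p) =
      AdjoinRoot.mk _ (monomial 0 ((p %ₘ X ^ (n + 1)).coeff n)) := fun p => rfl
  have hz : ∀ j, n < j → (AdjoinRoot.root (X ^ (n + 1) : k[X])) ^ j = 0 := fun j hj => by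
    rw [← AdjoinRoot.mk_X, ← map_pow, AdjoinRoot.mk_eq_zero]
    exact pow_dvd_pow _ hj
  have key : ∀ f g : TruncPoly k n →ₗ[k] TruncPoly k n,
      (∀ j : ℕ, f (AdjoinRoot.root _ ^ j) = g (AdjoinRoot.root _ ^ j)) → ∀ r, f r = g r := by
    intro f g h r
    have : f ∘ₗ mkL = g ∘ₗ mkL := by
      refine Polynomial.lhom_ext' fun j => LinearMap.ext_ring ?_
      have := h j
      rw [← AdjoinRoot.mk_X, ← map_pow] at this
      simpa [mkL, monomial_one_right_eq_X_pow] using this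
    obtain ⟨p, rfl⟩ := AdjoinRoot.mk_surjective r
    exact congrArg (fun F => F p) this
  refine ⟨δ, s, ?_, ?_⟩
  · refine key (LinearMap.id : TruncPoly k n →ₗ[k] TruncPoly k n) (Algebra.linearMap k _ ∘ₗ (TruncPoly.aug k n).toLinearMap +
      LinearMap.mulLeft k (AdjoinRoot.root (X ^ (n + 1) : k[X])) ∘ₗ δ) fun j => ?_
    have ha : TruncPoly.aug k n (AdjoinRoot.root _ ^ j) = 0 ^ j := by
      simp [TruncPoly.aug]
    have hd : AdjoinRoot.root _ * δ (AdjoinRoot.root _ ^ j) =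
        if j = 0 then 0 else AdjoinRoot.root _ ^ j := by
      conv_lhs => rw [← AdjoinRoot.mk_X, ← map_pow, hδ]
      rcases j with _ | j
      · rw [hlt 0 (Nat.zero_le _)]
        simp
      · by_cases h : j + 1 ≤ n
        · rw [hlt _ h, divX_X_pow]
          simp [pow_succ']
        · rw [hge _ (not_le.1 h), hz _ (not_le.1 h)]
          simp
    simp only [LinearMap.id_apply, LinearMap.add_apply, LinearMap.comp_apply,
      LinearMap.mulLeft_apply, AlgHom.toLinearMap_apply, hd, ha]
    rcases j with _ | j <;> simp
  · refine key (LinearMap.id : TruncPoly k n →ₗ[k] TruncPoly k n) (δ ∘ₗ LinearMap.mulLeft k (AdjoinRoot.root (X ^ (n + 1) : k[X])) +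
      LinearMap.mulLeft k (AdjoinRoot.root (X ^ (n + 1) : k[X]) ^ n) ∘ₗ s) fun j => ?_
    have hd : δ (AdjoinRoot.root _ * AdjoinRoot.root _ ^ j) =
        if j < n then AdjoinRoot.root _ ^ j else 0 := by
      conv_lhs => rw [← pow_succ', ← AdjoinRoot.mk_X, ← map_pow, hδ]
      by_cases h : j + 1 ≤ n
      · rw [hlt _ h, if_pos (by omega), divX_X_pow]
        simp
      · rw [hge _ (not_le.1 h), if_neg (by omega)]
        simp
    have hs' : s (AdjoinRoot.root _ ^ j) = if j = n then 1 else 0 := by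
      conv_lhs => rw [← AdjoinRoot.mk_X, ← map_pow, hs]
      by_cases h : j ≤ n
      · rw [hlt _ h, coeff_X_pow]
        by_cases h' : n = j
        · simp [h']
        · simp [h', Ne.symm h']
      · rw [hge _ (not_le.1 h), if_neg (by omega)]
        simp
    simp only [LinearMap.id_apply, LinearMap.add_apply, LinearMap.comp_apply,
      LinearMap.mulLeft_apply, hd, hs']
    rcases lt_trichotomy j n with h | h | h
    · simp [h, h.ne]
    · simp [h]
    · simp [h.not_gt, h.ne', hz _ h]

namespace CDGDeformation

variable {k : Type v} [CommRing k] {A : DGAlgebra.{v, u} k} {n : ℕ} (An : CDGDeformation A n)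

/-- The element `t`. -/
def t : An.carrier := algebraMap (TruncPoly k n) An.carrier (AdjoinRoot.root _)

lemma t_mem : An.t ∈ An.grading 0 :=
  (algebraMap (TruncPoly k n) (An.grading 0) (AdjoinRoot.root _)).2

lemma t_pow_mem (i : ℕ) : An.t ^ i ∈ An.grading 0 := by
  simpa using SetLike.pow_mem_graded i An.t_mem

lemma t_pow_comm (i : ℕ) (a : An.carrier) : An.t ^ i * a = a * An.t ^ i := by
  rw [t, ← map_pow]
  exact Algebra.commutes _ _

lemma t_comm (a : An.carrier) : An.t * a = a * An.t := by
  simpa using An.t_pow_comm 1 a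

lemma d_t_pow (i : ℕ) : An.d (An.t ^ i) = 0 := by
  rw [t, ← map_pow]
  exact An.d_algebraMap _

lemma d_t_pow_mul (i : ℕ) (a : An.carrier) : An.d (An.t ^ i * a) = An.t ^ i * An.d a := by
  rw [An.d_mul a (An.t_pow_mem i), An.d_t_pow]
  simp

lemma exists_t_mul (a : An.carrier) (ha : TruncPoly.reduce k n A.carrier (An.equiv a) = 0) :
    ∃ b, An.t * b = a := by
  obtain ⟨δ, s, h, -⟩ := TruncPoly.exists_divT k n
  have key : ∀ y : TruncPoly k n ⊗[k] A.carrier,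
      y = (1 : TruncPoly k n) ⊗ₜ[k] (TruncPoly.reduce k n A.carrier y) +
        (AdjoinRoot.root _ : TruncPoly k n) • (LinearMap.rTensor A.carrier δ y) := by
    intro y
    induction y with
    | zero => simp
    | add y z hy hz =>
      rw [map_add, map_add, TensorProduct.tmul_add, smul_add, add_add_add_comm, ← hy, ← hz]
    | tmul r a =>
      have h1 : TruncPoly.reduce k n A.carrier (r ⊗ₜ a) = TruncPoly.aug k n r • a := rfl
      rw [h1, LinearMap.rTensor_tmul, TensorProduct.smul_tmul', ← TensorProduct.smul_tmul,
        ← Algebra.algebraMap_eq_smul_one, ← TensorProduct.add_tmul, smul_eq_mul, ← h r]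
  refine ⟨An.equiv.symm (LinearMap.rTensor A.carrier δ (An.equiv a)), An.equiv.injective ?_⟩
  conv_rhs => rw [key (An.equiv a), ha]
  rw [t, ← Algebra.smul_def, map_smul, LinearEquiv.apply_symm_apply]
  simp

lemma exists_t_pow_mul (a : An.carrier) (ha : An.t * a = 0) : ∃ b, An.t ^ n * b = a := by
  obtain ⟨δ, s, -, h⟩ := TruncPoly.exists_divT k n
  have key : ∀ y : TruncPoly k n ⊗[k] A.carrier,
      y = LinearMap.rTensor A.carrier δ ((AdjoinRoot.root _ : TruncPoly k n) • y) +
        (AdjoinRoot.root _ ^ n : TruncPoly k n) • (LinearMap.rTensor A.carrier s y) := by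
    intro y
    induction y with
    | zero => simp
    | add y z hy hz =>
      rw [map_add, smul_add, smul_add, map_add, add_add_add_comm, ← hy, ← hz]
    | tmul r a =>
      rw [TensorProduct.smul_tmul', LinearMap.rTensor_tmul, LinearMap.rTensor_tmul,
        TensorProduct.smul_tmul', ← TensorProduct.add_tmul, smul_eq_mul, smul_eq_mul, ← h r]
  refine ⟨An.equiv.symm (LinearMap.rTensor A.carrier s (An.equiv a)), An.equiv.injective ?_⟩
  have h0 : (AdjoinRoot.root _ : TruncPoly k n) • An.equiv a = 0 := by
    rw [← map_smul, Algebra.smul_def]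
    exact (congrArg An.equiv ha).trans (map_zero _)
  conv_rhs => rw [key (An.equiv a), h0]
  rw [t, ← map_pow, ← Algebra.smul_def, map_smul, LinearEquiv.apply_symm_apply]
  simp

lemma exists_c_div_t : ∃ x ∈ An.grading 2, An.t * x = An.c := by
  obtain ⟨b, hb⟩ := An.exists_t_mul An.c An.reduce_c
  refine ⟨DirectSum.decompose An.grading b 2, SetLike.coe_mem _, ?_⟩
  have h := DirectSum.coe_decompose_mul_of_left_mem_zero An.grading (j := 2) (b := b) An.t_mem
  rw [← h, hb, DirectSum.decompose_of_mem_same _ An.c_mem]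

/-- An element `c/t` of degree `2` with `t (c/t) = c`. It is determined up to `t^n A_n`, which does
not affect the modules `Γ i` below. -/
def cDivT : An.carrier := An.exists_c_div_t.choose

lemma cDivT_mem : An.cDivT ∈ An.grading 2 := An.exists_c_div_t.choose_spec.1

lemma t_mul_cDivT : An.t * An.cDivT = An.c := An.exists_c_div_t.choose_spec.2

/-- The left ideal `t^m A_n` as a sub-qdg-module of the free module `A_n`. -/
def tIdeal (m : ℕ) : QDGSubmodule (QDGModule.self An.toCDGAlgebra) where
  toSubmodule := LinearMap.range (LinearMap.toSpanSingleton An.carrier An.carrier (An.t ^ m))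
  proj_mem := by
    rintro i _ ⟨b, rfl⟩
    have h := QDGModule.proj_map (M := QDGModule.self An.toCDGAlgebra)
      (N := QDGModule.self An.toCDGAlgebra) 0
      (LinearMap.toSpanSingleton An.carrier An.carrier (An.t ^ m)).toAddMonoidHom
      (fun {i b} hb => SetLike.mul_mem_graded (A := An.grading) hb (An.t_pow_mem m)) i b
    rw [add_zero] at h
    exact ⟨_, h.symm⟩
  d_mem := by
    rintro _ ⟨b, rfl⟩
    refine ⟨An.d b, ?_⟩
    change An.d b * An.t ^ m = An.d (b * An.t ^ m)
    rw [← An.t_pow_comm, ← An.t_pow_comm, An.d_t_pow_mul]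

lemma mem_tIdeal {m : ℕ} {a : An.carrier} (b : An.carrier) (h : b * An.t ^ m = a) :
    a ∈ (An.tIdeal m).toSubmodule := ⟨b, h⟩

/-- The qdg `A_n`-module `A_n / t^m A_n`; it is `A_(m-1)` (and zero if `m = 0`). -/
def truncation (m : ℕ) : QDGModule An.toCDGAlgebra := (An.tIdeal m).quotient

/-- The projection `A_n → A_n / t^m A_n`. -/
def toTrunc (m : ℕ) : An.carrier →ₗ[An.carrier] (An.truncation m).carrier := (An.tIdeal m).toSubmodule.mkQ

lemma toTrunc_surjective (m : ℕ) (x : (An.truncation m).carrier) : ∃ a, An.toTrunc m a = x :=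
  (An.tIdeal m).toSubmodule.mkQ_surjective x

lemma toTrunc_mem (m : ℕ) {i : ℤ} {a : An.carrier} (ha : a ∈ An.grading i) :
    An.toTrunc m a ∈ (An.truncation m).grading i := ⟨a, ha, rfl⟩

lemma d_toTrunc (m : ℕ) (a : An.carrier) : (An.truncation m).d (An.toTrunc m a) = An.toTrunc m (An.d a) := rfl

lemma toTrunc_eq_zero (m : ℕ) {a : An.carrier} (b : An.carrier) (h : b * An.t ^ m = a) :
    An.toTrunc m a = 0 :=
  (Submodule.Quotient.mk_eq_zero _).2 (An.mem_tIdeal b h)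

/-- Multiplication by `t`, `A_(i-1) → A_i`. -/
def mulT (i : ℕ) : (An.truncation i).carrier →ₗ[An.carrier] (An.truncation (i + 1)).carrier :=
  Submodule.mapQ _ _ (LinearMap.toSpanSingleton An.carrier An.carrier An.t) <| by
    rintro _ ⟨b, rfl⟩
    refine An.mem_tIdeal b ?_
    change b * An.t ^ (i + 1) = b * An.t ^ i * An.t
    rw [pow_succ An.t, mul_assoc]

lemma mulT_toTrunc (i : ℕ) (a : An.carrier) : An.mulT i (An.toTrunc i a) = An.toTrunc (i + 1) (a * An.t) := rfl

/-- The map `α ↦ π (α (c/t))`, `A_i → A_(i-1)`, with `π` the projection. -/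
def mulCDivT (i : ℕ) : (An.truncation (i + 1)).carrier →ₗ[An.carrier] (An.truncation i).carrier :=
  Submodule.mapQ _ _ (LinearMap.toSpanSingleton An.carrier An.carrier An.cDivT) <| by
    rintro _ ⟨b, rfl⟩
    refine An.mem_tIdeal (b * An.t * An.cDivT) ?_
    change b * An.t * An.cDivT * An.t ^ i = b * An.t ^ (i + 1) * An.cDivT
    rw [mul_assoc, ← An.t_pow_comm, ← mul_assoc, mul_assoc b, ← pow_succ' An.t]

lemma mulCDivT_toTrunc (i : ℕ) (a : An.carrier) :
    An.mulCDivT i (An.toTrunc (i + 1) a) = An.toTrunc i (a * An.cDivT) := rfl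

/-- The `A_n`-linear endomorphism `(α, a) ↦ (t a, π (α (c/t)))` of `A_i ⊕ A_(i-1)[1]`, of
degree `1`. -/
def gammaTwist (i : ℕ) : ((An.truncation (i + 1)).prod ((An.truncation i).shift 1)).carrier →+
    ((An.truncation (i + 1)).prod ((An.truncation i).shift 1)).carrier :=
  AddMonoidHom.prod
    ((An.mulT i).toAddMonoidHom.comp (AddMonoidHom.snd (An.truncation (i + 1)).carrier
      (An.truncation i).carrier))
    ((An.mulCDivT i).toAddMonoidHom.comp (AddMonoidHom.fst (An.truncation (i + 1)).carrier
      (An.truncation i).carrier))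

/-- The qdg module `A_i ⊕ A_(i-1)[1]` twisted by the matrix with entries `t : A_(i-1)[1] → A_i` and
`π ∘ (c/t) : A_i → A_(i-1)[1]`. -/
def gammaQDG (i : ℕ) : QDGModule An.toCDGAlgebra :=
  ((An.truncation (i + 1)).prod ((An.truncation i).shift 1)).twist (An.gammaTwist i)
    (by
      rintro j ⟨_, _⟩ ⟨⟨(a : An.carrier), ha, rfl⟩, ⟨(b : An.carrier), hb, rfl⟩⟩
      refine ⟨?_, ?_⟩
      · have h : An.toTrunc (i + 1) (b * An.t) ∈ (An.truncation (i + 1)).grading (j + 1 + 0) :=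
          An.toTrunc_mem _ (SetLike.mul_mem_graded (A := An.grading) hb An.t_mem)
        rw [add_zero] at h
        exact h
      · have h : An.toTrunc i (a * An.cDivT) ∈ (An.truncation i).grading (j + 2) :=
          An.toTrunc_mem _ (SetLike.mul_mem_graded (A := An.grading) ha An.cDivT_mem)
        rw [show j + 2 = j + 1 + 1 by ring] at h
        exact h)
    (by
      rintro j a ⟨x, y⟩ ha
      have hs : An.sign 1 a = j.negOnePow • a := by rw [An.sign_of_mem 1 ha, one_mul]
      refine Prod.ext ?_ ?_
      · have h : ∀ y : (An.truncation i).carrier,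
            An.mulT i (An.sign 1 a • y) = j.negOnePow • (a • An.mulT i y) := fun y => by
          rw [map_smul, hs, smul_assoc]
        exact h y
      · have h : ∀ x : (An.truncation (i + 1)).carrier,
            An.mulCDivT i (a • x) = j.negOnePow • (An.sign 1 a • An.mulCDivT i x) := fun x => by
          rw [map_smul, hs, smul_assoc, smul_smul, Int.units_mul_self, one_smul]
        exact h x)

lemma d_cDivT : ∃ b, b * An.t ^ n = An.d An.cDivT := by
  have h : An.t * An.d An.cDivT = 0 := by
    have := An.d_t_pow_mul 1 An.cDivT
    rw [pow_one, An.t_mul_cDivT, An.d_c] at this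
    exact this.symm
  obtain ⟨b, hb⟩ := An.exists_t_pow_mul _ h
  exact ⟨b, by rw [← An.t_pow_comm, hb]⟩

lemma toTrunc_d_mul_cDivT {i : ℕ} (hi : i ≤ n) (a : An.carrier) :
    An.toTrunc i (An.d (a * An.cDivT)) = An.toTrunc i (An.d a * An.cDivT) := by
  obtain ⟨b, hb⟩ := An.d_cDivT
  have h0 : ∀ a, An.toTrunc i (a * An.d An.cDivT) = 0 := fun a => by
    refine An.toTrunc_eq_zero i (a * b * An.t ^ (n - i)) ?_
    rw [mul_assoc, ← pow_add An.t, Nat.sub_add_cancel hi, mul_assoc, hb]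
  induction a using DirectSum.Decomposition.inductionOn An.grading with
  | zero => simp
  | add x y hx hy => simp only [add_mul, map_add, hx, hy]
  | @homogeneous j x =>
    rw [An.d_mul _ x.2, map_add, Units.smul_def, map_zsmul, h0, smul_zero, add_zero]

/-- The cdg `A_n`-module `Γ_i = A_i ⊕ A_(i-1)[1]`, `0 ≤ i ≤ n`, with predifferential
`(α, a) ↦ (d α + t a, - d a + π (α (c/t)))`. -/
def gamma (i : Fin (n + 1)) : CDGModule An.toCDGAlgebra where
  toQDGModule := An.gammaQDG i
  d_d := by
    have h₁ : ∀ (x : (An.truncation (i + 1)).carrier) (y : (An.truncation i).carrier),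
        (An.truncation (i + 1)).d ((An.truncation (i + 1)).d x + An.mulT i y) +
          An.mulT i ((1 : ℤ).negOnePow • (An.truncation i).d y + An.mulCDivT i x) =
        An.c • x := by
      intro x y
      obtain ⟨a, rfl⟩ := An.toTrunc_surjective _ x
      obtain ⟨b, rfl⟩ := An.toTrunc_surjective _ y
      rw [Int.negOnePow_one, Units.neg_smul, one_smul]
      simp only [map_add, map_neg, d_toTrunc, mulT_toTrunc, mulCDivT_toTrunc]
      rw [← map_smul, An.d_d, ← An.t_comm b, ← pow_one An.t, An.d_t_pow_mul, pow_one, mul_assoc a,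
        ← An.t_comm An.cDivT, An.t_mul_cDivT, An.t_comm (An.d b), smul_eq_mul, map_sub]
      abel
    have h₂ : ∀ (x : (An.truncation (i + 1)).carrier) (y : (An.truncation i).carrier),
        (1 : ℤ).negOnePow • (An.truncation i).d
            ((1 : ℤ).negOnePow • (An.truncation i).d y + An.mulCDivT i x) +
          An.mulCDivT i ((An.truncation (i + 1)).d x + An.mulT i y) =
        An.sign 1 An.c • y := by
      intro x y
      obtain ⟨a, rfl⟩ := An.toTrunc_surjective _ x
      obtain ⟨b, rfl⟩ := An.toTrunc_surjective _ y
      rw [Int.negOnePow_one, An.sign_c]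
      simp only [Units.neg_smul, one_smul, map_add, map_neg, d_toTrunc, mulT_toTrunc,
        mulCDivT_toTrunc]
      rw [An.toTrunc_d_mul_cDivT (Nat.lt_succ_iff.1 i.2), ← map_smul, An.d_d, mul_assoc b,
        An.t_mul_cDivT, smul_eq_mul, map_sub]
      abel
    rintro ⟨x, y⟩
    exact Prod.ext (h₁ x y) (h₂ x y)

/-! ### Acyclicity, semifree modules, cofibrant generation -/

/-- The submodule `t^i M` of a cdg `A_n`-module `M`. -/
def tPow (M : CDGModule An.toCDGAlgebra) (i : ℕ) : QDGSubmodule M.toQDGModule where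
  toSubmodule :=
    { carrier := {m | ∃ x : M.carrier, An.t ^ i • x = m}
      zero_mem' := ⟨0, smul_zero _⟩
      add_mem' := by
        rintro _ _ ⟨x, rfl⟩ ⟨y, rfl⟩
        exact ⟨x + y, smul_add _ _ _⟩
      smul_mem' := by
        rintro a _ ⟨x, rfl⟩
        exact ⟨a • x, by rw [smul_smul, smul_smul, An.t_pow_comm]⟩ }
  proj_mem := by
    rintro j _ ⟨x, rfl⟩
    have h := QDGModule.proj_map (M := M.toQDGModule) (N := M.toQDGModule) 0
      (DistribSMul.toAddMonoidHom M.carrier (An.t ^ i))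
      (fun {j m} hm => by
        have h := M.smul_mem (An.t_pow_mem i) hm
        rw [add_comm (0 : ℤ) j] at h
        exact h) j x
    rw [add_zero] at h
    exact ⟨_, h.symm⟩
  d_mem := by
    rintro _ ⟨x, rfl⟩
    refine ⟨M.d x, ?_⟩
    rw [M.d_smul x (An.t_pow_mem i), An.d_t_pow]
    simp

/-- The graded piece `Gr_t^i(M) = t^i M / t^(i+1) M` of the `t`-adic filtration, as a cdg
`A_n`-module. It is annihilated by `t`, hence by the curvature, so it is a complex. -/
def gr (M : CDGModule An.toCDGAlgebra) (i : ℕ) : CDGModule An.toCDGAlgebra :=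
  CDGModule.subquotient (An.tPow M i) (An.tPow M (i + 1))

/-- `M` is `n`-acyclic: the complexes `t^i M / t^(i+1) M`, `0 ≤ i ≤ n`, are acyclic. -/
def IsNAcyclic (M : CDGModule An.toCDGAlgebra) : Prop :=
  ∀ i ≤ n, Function.Exact (An.gr M i).d (An.gr M i).d

/-- A closed morphism is an `n`-quasi-isomorphism if its cone is `n`-acyclic. -/
def IsNQuasiIso {M N : CDGModule An.toCDGAlgebra} (f : M ⟶ N) : Prop :=
  An.IsNAcyclic (CDGModule.cone f)

/-- The kernel `Ker t^i_M` of the action of `t^i` on `M`. -/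
def kerTPow (M : CDGModule An.toCDGAlgebra) (i : ℕ) : Set M.carrier :=
  {m | An.t ^ i • m = 0}

/-- `P` is `n`-semifree: it is `{Γ_0, …, Γ_n}`-semifree. -/
def IsNSemifree (P : CDGModule An.toCDGAlgebra) : Prop :=
  CDGModule.IsSemifree An.gamma P

end CDGDeformation

/-- A model category is cofibrantly generated if there are sets `I` and `J` of morphisms which
permit the small object argument, such that the trivial fibrations are the maps with the right
lifting property with respect to `I`, and the fibrations are those with the right lifting property
with respect to `J`. -/
def IsCofibrantlyGenerated (C : Type (u + 1)) [Category.{u} C]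
    [HomotopicalAlgebra.ModelCategory C] : Prop :=
  ∃ I J : MorphismProperty C,
    MorphismProperty.HasSmallObjectArgument.{u} I ∧
    MorphismProperty.HasSmallObjectArgument.{u} J ∧
    HomotopicalAlgebra.trivialFibrations C = I.rlp ∧
    HomotopicalAlgebra.fibrations C = J.rlp

end Curved

end

/-!
The complex of morphisms of graded modules from `Γ_i` to `M` is `Ker t^(i+1) ⊕ Ker t^i` with
differential `(x, y) ↦ (d x - (c/t) y, t x - d y)`. Its quotient by the complex for `Γ_(i-1)` is the
cone of the inclusion of `t^i M ∩ Ker t` in `t^(i-1) M ∩ Ker t`, so these complexes are acyclic for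
all `i` if and only if the complexes `t^i M ∩ Ker t` are; by descending induction on `i` the latter
are acyclic if and only if the complexes `t^i M / t^(i+1) M` are, that is, if `M` is `n`-acyclic.
Hence the morphisms `0 ⟶ cone (𝟙 Γ_i[l])` detect the fibrations and the inclusions
`Γ_i[l] ⟶ cone (𝟙 Γ_i[l])` detect the trivial fibrations, and the small object argument gives the
factorizations. Cell attachments are graded split with a sum of shifts of the `Γ_i` as cokernel, so
the cofibrant objects are the retracts of the semifree modules.

A commutative square from a graded split injection `f` to `p : X ⟶ Y` has a lift as soon as every
morphism from the cokernel of `f` to `cone p` factors through `cone (𝟙 X)`: the differential of a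
graded extension of the top arrow is the obstruction.
-/

noncomputable section

namespace Curved

open CategoryTheory.Limits HomotopicalAlgebra

variable {R : Type v} [CommRing R] {B : CDGAlgebra.{v, u} R}
  {k : Type v} [CommRing k] {A : DGAlgebra.{v, u} k} {n : ℕ} {An : CDGDeformation A n}

namespace CDGModule

variable {M N P Q : CDGModule B}

/-! ### The preadditive category of cdg modules -/

lemma hom_ext {f g : M ⟶ N} (h : ∀ x, linearMap f x = linearMap g x) : f = g :=
  Hom.ext (LinearMap.ext h)

lemma linearMap_comp (f : M ⟶ N) (g : N ⟶ P) (x : M.carrier) :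
    linearMap (f ≫ g) x = linearMap g (linearMap f x) := rfl

lemma linearMap_id (x : M.carrier) : linearMap (𝟙 M) x = x := rfl

lemma linearMap_d (f : M ⟶ N) (x : M.carrier) :
    linearMap f (M.d x) = N.d (linearMap f x) := Hom.map_d f x

lemma linearMap_mem (f : M ⟶ N) {i : ℤ} {x : M.carrier} (hx : x ∈ M.grading i) :
    linearMap f x ∈ N.grading i := Hom.map_mem f hx

lemma linearMap_proj (f : M ⟶ N) (i : ℤ) (x : M.carrier) :
    linearMap f (M.proj i x) = N.proj i (linearMap f x) := by
  have h := QDGModule.proj_map (M := M.toQDGModule) (N := N.toQDGModule) 0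
    (linearMap f).toAddMonoidHom (fun {i x} hx => by rw [add_zero]; exact linearMap_mem f hx) i x
  rw [add_zero] at h
  exact h.symm

lemma congr_linearMap {f g : M ⟶ N} (h : f = g) (x : M.carrier) :
    linearMap f x = linearMap g x := h ▸ rfl

lemma fac_apply {f : M ⟶ N} {g : N ⟶ P} {h : M ⟶ P} (w : f ≫ g = h) (x : M.carrier) :
    linearMap g (linearMap f x) = linearMap h x := congr_linearMap w x

lemma commSq_apply {f : M ⟶ N} {g : M ⟶ P} {h : N ⟶ Q} {k : P ⟶ Q} (w : CommSq f g h k)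
    (x : M.carrier) : linearMap h (linearMap f x) = linearMap k (linearMap g x) :=
  congr_linearMap w.w x

instance : Zero (M ⟶ N) :=
  ⟨{ toLinearMap := 0
     map_mem := fun _ => zero_mem _
     map_d := fun _ => by simp }⟩

instance : Add (M ⟶ N) :=
  ⟨fun f g =>
    { toLinearMap := linearMap f + linearMap g
      map_mem := fun h => add_mem (linearMap_mem f h) (linearMap_mem g h)
      map_d := fun _ => by simp [linearMap_d] }⟩

instance : Neg (M ⟶ N) :=
  ⟨fun f =>
    { toLinearMap := -linearMap f
      map_mem := fun h => neg_mem (linearMap_mem f h)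
      map_d := fun _ => by simp [linearMap_d] }⟩

lemma linearMap_zero (x : M.carrier) : linearMap (0 : M ⟶ N) x = 0 := rfl

lemma linearMap_add (f g : M ⟶ N) (x : M.carrier) :
    linearMap (f + g) x = linearMap f x + linearMap g x := rfl

lemma linearMap_neg (f : M ⟶ N) (x : M.carrier) : linearMap (-f) x = -linearMap f x := rfl

instance : AddCommGroup (M ⟶ N) :=
  { AddGroup.ofLeftAxioms
      (fun f g h => hom_ext fun x => by simp only [linearMap_add, add_assoc])
      (fun f => hom_ext fun x => by simp only [linearMap_add, linearMap_zero, zero_add])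
      (fun f => hom_ext fun x => by
        simp only [linearMap_add, linearMap_zero, linearMap_neg, neg_add_cancel]) with
    add_comm := fun f g => hom_ext fun x => by simp only [linearMap_add, add_comm] }

instance : Preadditive (CDGModule B) where
  add_comp _ _ _ _ _ _ := hom_ext fun _ => by simp only [linearMap_add, linearMap_comp, map_add]
  comp_add _ _ _ _ _ _ := hom_ext fun _ => by simp only [linearMap_add, linearMap_comp]

lemma linearMap_sub (f g : M ⟶ N) (x : M.carrier) :
    linearMap (f - g) x = linearMap f x - linearMap g x := by
  rw [sub_eq_add_neg, sub_eq_add_neg, linearMap_add, linearMap_neg]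

lemma eq_zero_of_isInitial (hM : IsInitial M) (x : M.carrier) : x = 0 :=
  congr_linearMap (hM.hom_ext (𝟙 M) 0) x

lemma epi_of_surjective (f : M ⟶ N) (hf : Function.Surjective (linearMap f)) : Epi f where
  left_cancellation _ _ h := hom_ext <| hf.forall.2 <| congr_linearMap h

lemma mono_of_injective (f : M ⟶ N) (hf : Function.Injective (linearMap f)) : Mono f where
  right_cancellation _ _ h := hom_ext fun x => hf (congr_linearMap h x)

/-! ### Submodules and quotients -/

/-- The inclusion of a sub-qdg-module, as a closed morphism. -/
def subι (S : QDGSubmodule M.toQDGModule) : sub S ⟶ M :=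
  Hom.mk (M := sub S) S.toSubmodule.subtype id fun _ => rfl

/-- The inclusion of a sub-qdg-module in a larger one, as a closed morphism. -/
def subMap {S T : QDGSubmodule M.toQDGModule} (h : S.toSubmodule ≤ T.toSubmodule) :
    sub S ⟶ sub T :=
  Hom.mk (M := sub S) (N := sub T) (Submodule.inclusion h) id fun _ => rfl

/-- The corestriction of a closed morphism to a sub-qdg-module containing its image. -/
def subLift (S : QDGSubmodule M.toQDGModule) (f : N ⟶ M)
    (h : ∀ x, linearMap f x ∈ S.toSubmodule) : N ⟶ sub S :=
  Hom.mk (N := sub S) ((linearMap f).codRestrict S.toSubmodule h) (linearMap_mem f)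
    fun x => Subtype.ext (linearMap_d f x)

/-- The kernel of a closed morphism. -/
def ker (f : M ⟶ N) : QDGSubmodule M.toQDGModule where
  toSubmodule := LinearMap.ker (linearMap f)
  proj_mem i {x} hx := by
    rw [LinearMap.mem_ker] at hx ⊢
    rw [linearMap_proj, hx, map_zero]
  d_mem {x} hx := by
    rw [LinearMap.mem_ker] at hx ⊢
    rw [linearMap_d, hx, map_zero]

/-- The projection to the quotient by a sub-qdg-module, as a closed morphism. -/
def quotientπ (S : QDGSubmodule M.toQDGModule) : M ⟶ quotient S :=
  Hom.mk (N := quotient S) S.toSubmodule.mkQ (fun {_ x} h => ⟨x, h, rfl⟩) fun _ => rfl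

lemma quotientπ_surjective (S : QDGSubmodule M.toQDGModule) :
    Function.Surjective (linearMap (quotientπ S)) := S.toSubmodule.mkQ_surjective

lemma quotientπ_eq_zero_iff (S : QDGSubmodule M.toQDGModule) (x : M.carrier) :
    linearMap (quotientπ S) x = 0 ↔ x ∈ S.toSubmodule :=
  Submodule.Quotient.mk_eq_zero _

lemma exact_quotientπ_range (f : M ⟶ N) :
    Function.Exact (linearMap f) (linearMap (quotientπ (range f))) :=
  quotientπ_eq_zero_iff (range f)

lemma comp_quotientπ_range (f : M ⟶ N) : f ≫ quotientπ (range f) = 0 :=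
  hom_ext (exact_quotientπ_range f).apply_apply_eq_zero

/-- A linear map of degree zero, that is, a morphism of graded modules; it need not commute with
the predifferentials. -/
def IsGradedMap (g : M.carrier →ₗ[B.carrier] N.carrier) : Prop :=
  ∀ i, ∀ x ∈ M.grading i, g x ∈ N.grading i

lemma exists_isGradedMap_desc (π : M ⟶ Q) (hπ : Function.Surjective (linearMap π))
    {f : M.carrier →ₗ[B.carrier] N.carrier} (hf : IsGradedMap f)
    (hker : LinearMap.ker (linearMap π) ≤ LinearMap.ker f) :
    ∃ g : Q.carrier →ₗ[B.carrier] N.carrier, IsGradedMap g ∧ g ∘ₗ linearMap π = f := by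
  let e := (linearMap π).quotKerEquivOfSurjective hπ
  have he (x : M.carrier) : e.symm (linearMap π x) = (LinearMap.ker (linearMap π)).mkQ x :=
    e.symm_apply_eq.2 rfl
  let g : Q.carrier →ₗ[B.carrier] N.carrier := Submodule.liftQ _ f hker ∘ₗ e.symm.toLinearMap
  have hg (x : M.carrier) : g (linearMap π x) = f x := by simp [g, he]
  refine ⟨g, fun i => hπ.forall.2 fun x hx => ?_, LinearMap.ext hg⟩
  rw [← Q.proj_of_mem hx, ← linearMap_proj, hg]
  exact hf i _ (M.proj_mem i x)

lemma exists_desc (π : M ⟶ Q) (hπ : Function.Surjective (linearMap π)) (f : M ⟶ N)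
    (hker : LinearMap.ker (linearMap π) ≤ LinearMap.ker (linearMap f)) :
    ∃ g : Q ⟶ N, π ≫ g = f := by
  obtain ⟨g, hg, hgπ⟩ := exists_isGradedMap_desc π hπ (fun _ _ => linearMap_mem f) hker
  have hgπ (x : M.carrier) : g (linearMap π x) = linearMap f x := LinearMap.congr_fun hgπ x
  refine ⟨⟨g, hg _ _, hπ.forall.2 fun x => ?_⟩, hom_ext hgπ⟩
  rw [← linearMap_d, hgπ, hgπ, linearMap_d]

lemma exists_desc_of_comp_eq_zero {f : M ⟶ N} {π : N ⟶ Q} (hπ : Function.Surjective (linearMap π))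
    (hfπ : Function.Exact (linearMap f) (linearMap π)) (g : N ⟶ P) (hfg : f ≫ g = 0) :
    ∃ g' : Q ⟶ P, π ≫ g' = g :=
  exists_desc π hπ g fun x hx => by
    obtain ⟨y, rfl⟩ := (hfπ x).1 hx
    exact congr_linearMap hfg y

scoped instance : HasCokernels (CDGModule B) where
  has_colimit f := by
    have : Epi (quotientπ (range f)) := epi_of_surjective _ (quotientπ_surjective _)
    refine ⟨⟨⟨_, CokernelCofork.IsColimit.ofπ' _ (comp_quotientπ_range f) fun g hg => ?_⟩⟩⟩
    have h := exists_desc_of_comp_eq_zero (quotientπ_surjective _) (exact_quotientπ_range f) g hg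
    exact ⟨h.choose, h.choose_spec⟩

scoped instance : HasKernels (CDGModule B) where
  has_limit f := by
    have : Mono (subι (ker f)) := mono_of_injective _ Subtype.val_injective
    exact ⟨⟨⟨_, KernelFork.IsLimit.ofι' (subι (ker f)) (hom_ext Subtype.prop)
      fun g hg => ⟨subLift (ker f) g (congr_linearMap hg), rfl⟩⟩⟩⟩

/-! ### Direct sums -/

section DirectSum

variable {ι : Type u} (X : ι → CDGModule B)

open Classical in
/-- The inclusion of a summand in a direct sum, as a closed morphism. -/
def directSumι (j : ι) : X j ⟶ directSum X :=
  Hom.mk (N := directSum X) (DFinsupp.lsingle (M := fun j => (X j).carrier) j)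
    (fun {i x} hx s => by
      change (DFinsupp.single j x : Π₀ j, (X j).carrier) s ∈ (X s).grading i
      by_cases h : j = s
      · subst h; simpa using hx
      · rw [DFinsupp.single_eq_of_ne (Ne.symm h)]; exact zero_mem _)
    (fun _ => (DFinsupp.mapRange_single (f := fun j => (X j).d)
      (hf := fun j => map_zero (X j).d)).symm)

variable {X}

lemma directSum_induction {motive : (directSum X).carrier → Prop} (x : (directSum X).carrier)
    (zero : motive 0) (ι : ∀ j x, motive (linearMap (directSumι X j) x))
    (add : ∀ x y, motive x → motive y → motive (x + y)) : motive x := by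
  classical
  exact DFinsupp.induction (p := motive) x zero fun j b f _ _ hf => add _ _ (ι j b) hf

lemma directSum_hom_ext {f g : directSum X ⟶ N}
    (h : ∀ j, directSumι X j ≫ f = directSumι X j ≫ g) : f = g := by
  refine hom_ext fun x => ?_
  induction x using directSum_induction with
  | zero => simp only [map_zero]
  | ι j x => exact congr_linearMap (h j) x
  | add x y hx hy => rw [map_add, map_add, hx, hy]

open Classical in
/-- The linear map from a direct sum induced by a family of linear maps. -/
def directSumLift (f : ∀ j, (X j).carrier →ₗ[B.carrier] N.carrier) :
    (directSum X).carrier →ₗ[B.carrier] N.carrier :=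
  (DFinsupp.lsum ℕ f : (Π₀ j, (X j).carrier) →ₗ[B.carrier] N.carrier)

lemma directSumLift_ι (f : ∀ j, (X j).carrier →ₗ[B.carrier] N.carrier) (j : ι)
    (x : (X j).carrier) : directSumLift f (linearMap (directSumι X j) x) = f j x := by
  classical
  exact DFinsupp.lsum_single ℕ f j x

/-- The closed morphism from a direct sum induced by a family of closed morphisms. -/
def directSumDesc (f : ∀ j, X j ⟶ N) : directSum X ⟶ N where
  toLinearMap := directSumLift fun j => linearMap (f j)
  map_mem {i x} hx := by
    classical
    exact dfinsuppSumAddHom_mem (N.grading i) (x : Π₀ j, (X j).carrier) _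
      fun j _ => linearMap_mem (f j) (hx j)
  map_d x := by
    induction x using directSum_induction with
    | zero => simp only [map_zero]
    | ι j x => rw [← linearMap_d, directSumLift_ι, directSumLift_ι, linearMap_d]
    | add x y hx hy => rw [map_add, map_add, map_add, map_add, hx, hy]

lemma directSumι_desc (f : ∀ j, X j ⟶ N) (j : ι) : directSumι X j ≫ directSumDesc f = f j :=
  hom_ext (directSumLift_ι (fun j => linearMap (f j)) j)

lemma directSumDesc_ι_apply (f : ∀ j, X j ⟶ N) (j : ι) (x : (X j).carrier) :
    linearMap (directSumDesc f) (linearMap (directSumι X j) x) = linearMap (f j) x :=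
  fac_apply (directSumι_desc f j) x

end DirectSum

scoped instance : HasCoproducts.{u} (CDGModule B) :=
  hasCoproducts_of_colimit_cofans (fun X => Cofan.mk (directSum X) (directSumι X)) fun _ =>
    Cofan.IsColimit.mk _ (fun s => directSumDesc s.inj) (fun _ j => directSumι_desc _ j)
      (fun _ _ hm => directSum_hom_ext fun j => (hm j).trans (directSumι_desc _ j).symm)

scoped instance : HasColimitsOfSize.{u, u} (CDGModule B) :=
  have : HasCoequalizers (CDGModule B) := Preadditive.hasCoequalizers_of_hasCokernels
  has_colimits_of_hasCoequalizers_and_coproducts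

scoped instance : HasFiniteColimits (CDGModule B) := by
  have : HasColimitsOfSize.{0, 0} (CDGModule B) := hasColimitsOfSizeShrink.{0, 0, u, u} _
  infer_instance

scoped instance : HasFiniteLimits (CDGModule B) :=
  have : HasEqualizers (CDGModule B) := Preadditive.hasEqualizers_of_hasKernels
  have : HasFiniteBiproducts (CDGModule B) := HasFiniteBiproducts.of_hasFiniteCoproducts
  hasFiniteLimits_of_hasEqualizers_and_finite_products

/-! ### Directed colimits -/

section DirectedColimit

variable {J : Type*} [Preorder J] {F : J ⥤ CDGModule B}

lemma cocone_map_apply (c : Cocone F) {i j : J} (h : i ≤ j) (x : (F.obj i).carrier) :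
    linearMap (c.ι.app j) (linearMap (F.map (homOfLE h)) x) = linearMap (c.ι.app i) x :=
  fac_apply (c.w (homOfLE h)) x

lemma map_map_apply {i j l : J} (h : i ≤ j) (h' : j ≤ l) (x : (F.obj i).carrier) :
    linearMap (F.map (homOfLE h')) (linearMap (F.map (homOfLE h)) x) =
      linearMap (F.map (homOfLE (h.trans h'))) x :=
  fac_apply (F.map_comp (homOfLE h) (homOfLE h')).symm x

variable [IsDirectedOrder J] [Nonempty J]

/-- The union of the images of the legs of a directed cocone. -/
def coconeRange (c : Cocone F) : QDGSubmodule c.pt.toQDGModule where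
  toSubmodule :=
    { carrier := {x | ∃ j y, linearMap (c.ι.app j) y = x}
      zero_mem' := ⟨Classical.arbitrary J, 0, map_zero _⟩
      add_mem' := by
        rintro _ _ ⟨i, x, rfl⟩ ⟨j, y, rfl⟩
        obtain ⟨l, hi, hj⟩ := exists_ge_ge i j
        exact ⟨l, linearMap (F.map (homOfLE hi)) x + linearMap (F.map (homOfLE hj)) y, by
          rw [map_add, cocone_map_apply, cocone_map_apply]⟩
      smul_mem' := by
        rintro a _ ⟨j, y, rfl⟩
        exact ⟨j, a • y, map_smul _ _ _⟩ }
  proj_mem := by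
    rintro i _ ⟨j, y, rfl⟩
    exact ⟨j, _, linearMap_proj _ _ _⟩
  d_mem := by
    rintro _ ⟨j, y, rfl⟩
    exact ⟨j, _, linearMap_d _ _⟩

lemma exists_app_eq_of_isColimit {c : Cocone F} (hc : IsColimit c)
    (x : c.pt.carrier) : ∃ j y, linearMap (c.ι.app j) y = x := by
  have h : quotientπ (coconeRange c) = 0 := hc.hom_ext fun j => hom_ext fun y =>
    (quotientπ_eq_zero_iff (coconeRange c) _).2 ⟨j, y, rfl⟩
  exact (quotientπ_eq_zero_iff (coconeRange c) x).1 (congr_linearMap h x)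

lemma exists_homogeneous_app_eq_of_isColimit {c : Cocone F} (hc : IsColimit c) {i : ℤ}
    {x : c.pt.carrier} (hx : x ∈ c.pt.grading i) :
    ∃ j, ∃ y ∈ (F.obj j).grading i, linearMap (c.ι.app j) y = x := by
  obtain ⟨j, y, rfl⟩ := exists_app_eq_of_isColimit hc x
  exact ⟨j, _, (F.obj j).proj_mem i y, by rw [linearMap_proj]; exact c.pt.proj_of_mem hx⟩

end DirectedColimit

section DirectedColimit

variable {J : Type u} [Preorder J] (F : J ⥤ CDGModule B)

open Classical in
/-- The morphism `⨁ i, F i ⟶ F j` given by the transition maps on the summands with `i ≤ j` and by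
zero on the others. -/
def evalStage (j : J) : directSum F.obj ⟶ F.obj j :=
  directSumDesc fun i => if h : i ≤ j then F.map (homOfLE h) else 0

lemma evalStage_ι {i j : J} (h : i ≤ j) (x : (F.obj i).carrier) :
    linearMap (evalStage F j) (linearMap (directSumι F.obj i) x) =
      linearMap (F.map (homOfLE h)) x := by
  rw [evalStage, directSumDesc_ι_apply, dif_pos h]

variable [IsDirectedOrder J]

/-- The elements of `⨁ j, F j` whose value at all sufficiently late stages is zero: the kernel of
the projection to the colimit. -/
def colimitRel [Nonempty J] : QDGSubmodule (directSum F.obj).toQDGModule where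
  toSubmodule :=
    { carrier := {x | ∃ j₀, ∀ j, j₀ ≤ j → linearMap (evalStage F j) x = 0}
      zero_mem' := ⟨Classical.arbitrary J, fun _ _ => map_zero _⟩
      add_mem' := by
        rintro x y ⟨i, hi⟩ ⟨j, hj⟩
        obtain ⟨l, hil, hjl⟩ := exists_ge_ge i j
        refine ⟨l, fun m hm => ?_⟩
        rw [map_add, hi m (hil.trans hm), hj m (hjl.trans hm), add_zero]
      smul_mem' := by
        rintro a x ⟨i, hi⟩
        exact ⟨i, fun l hl => by rw [map_smul, hi l hl, smul_zero]⟩ }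
  proj_mem := by
    rintro i x ⟨j, hj⟩
    exact ⟨j, fun l hl => by rw [linearMap_proj, hj l hl, map_zero]⟩
  d_mem := by
    rintro x ⟨j, hj⟩
    exact ⟨j, fun l hl => by rw [linearMap_d, hj l hl, map_zero]⟩

/-- The cocone with point `⨁ j, F j` modulo `colimitRel F`. An element of `F i` killed by its leg
is killed by a transition map. -/
def quotientCocone [Nonempty J] : Cocone F where
  pt := quotient (colimitRel F)
  ι :=
    { app := fun j => directSumι F.obj j ≫ quotientπ (colimitRel F)
      naturality := fun i i' f => hom_ext fun x => by
        change linearMap (quotientπ (colimitRel F))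
            (linearMap (directSumι F.obj i') (linearMap (F.map f) x)) =
          linearMap (quotientπ (colimitRel F)) (linearMap (directSumι F.obj i) x)
        rw [← sub_eq_zero, ← map_sub, quotientπ_eq_zero_iff]
        refine ⟨i', fun j hj => ?_⟩
        rw [map_sub, evalStage_ι F hj, evalStage_ι F ((leOfHom f).trans hj),
          fac_apply (F.map_comp f (homOfLE hj)).symm, sub_eq_zero]
        rfl }

variable {F}

lemma exists_map_eq_zero_of_isColimit {c : Cocone F} (hc : IsColimit c) {i : J}
    {x : (F.obj i).carrier} (hx : linearMap (c.ι.app i) x = 0) :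
    ∃ (j : J) (h : i ≤ j), linearMap (F.map (homOfLE h)) x = 0 := by
  have : Nonempty J := ⟨i⟩
  have h : linearMap ((quotientCocone F).ι.app i) x = 0 := by
    rw [← fac_apply (hc.fac (quotientCocone F) i), hx, map_zero]
  obtain ⟨j, hj⟩ := (quotientπ_eq_zero_iff (colimitRel F) _).1 h
  obtain ⟨l, hil, hjl⟩ := exists_ge_ge i j
  exact ⟨l, hil, by rw [← evalStage_ι F hil, hj l hjl]⟩

end DirectedColimit

end CDGModule

open scoped CDGModule

/-! ### Signs and shifts -/

namespace CDGAlgebra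

lemma induction {motive : B.carrier → Prop} (a : B.carrier) (zero : motive 0)
    (homogeneous : ∀ i, ∀ a ∈ B.grading i, motive a)
    (add : ∀ a b, motive a → motive b → motive (a + b)) : motive a :=
  DirectSum.Decomposition.inductionOn B.grading zero (fun {i} m => homogeneous i m m.2) add a

lemma sign_sign (l m : ℤ) (a : B.carrier) : B.sign l (B.sign m a) = B.sign (l + m) a := by
  induction a using B.induction with
  | zero => simp
  | add a b ha hb => simp only [map_add, ha, hb]
  | homogeneous i a ha =>
    rw [B.sign_of_mem l (B.sign_mem m ha), B.sign_of_mem m ha, B.sign_of_mem _ ha, smul_smul,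
      add_mul, Int.negOnePow_add]

lemma sign_of_even {l : ℤ} (hl : Even l) (a : B.carrier) : B.sign l a = a := by
  induction a using B.induction with
  | zero => simp
  | add a b ha hb => simp only [map_add, ha, hb]
  | homogeneous i a ha => rw [B.sign_of_mem l ha, Int.negOnePow_even _ (hl.mul_right i), one_smul]

lemma sign_self_sign (l : ℤ) (a : B.carrier) : B.sign l (B.sign l a) = a := by
  rw [sign_sign, sign_of_even (Even.add_self l)]

lemma sign_of_mem_even (l : ℤ) {i : ℤ} (hi : Even i) {a : B.carrier} (ha : a ∈ B.grading i) :
    B.sign l a = a := by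
  rw [B.sign_of_mem l ha, Int.negOnePow_even _ (hi.mul_left l), one_smul]

lemma d_sign_one (a : B.carrier) : B.d (B.sign 1 a) = -B.sign 1 (B.d a) := by
  induction a using B.induction with
  | zero => simp
  | add a b ha hb => simp only [map_add, ha, hb, neg_add]
  | homogeneous i a ha =>
    rw [B.sign_of_mem 1 ha, B.sign_of_mem 1 (B.d_mem ha), Units.smul_def, map_zsmul,
      ← Units.smul_def, one_mul, one_mul, Int.negOnePow_succ, Units.neg_smul, neg_neg]

end CDGAlgebra

lemma QDGModule.d_smul_eq (M : QDGModule B) (a : B.carrier) (x : M.carrier) :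
    M.d (a • x) = B.d a • x + B.sign 1 a • M.d x := by
  induction a using B.induction with
  | zero => simp
  | add a b ha hb => simp only [map_add, add_smul, ha, hb]; abel
  | homogeneous i a ha => rw [M.d_smul x ha, B.sign_of_mem 1 ha, one_mul, smul_assoc]

namespace CDGModule

variable {M N X Y X' Y' : CDGModule B}

lemma isIso_of_bijective (f : M ⟶ N) (hf : Function.Bijective (linearMap f)) : IsIso f := by
  have : Epi f := epi_of_surjective f hf.2
  obtain ⟨g, hg⟩ := exists_desc f hf.2 (𝟙 M) ((LinearMap.ker_eq_bot.2 hf.1).trans_le bot_le)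
  exact ⟨g, hg, by rw [← cancel_epi f, ← Category.assoc, hg, Category.id_comp, Category.comp_id]⟩

/-- The identity map from `M` to its shift `M[l]`, as an additive bijection. -/
def toShift (M : CDGModule B) (l : ℤ) : M.carrier ≃+ (M.shift l).carrier :=
  AddEquiv.refl M.carrier

lemma toShift_mem_iff {l i : ℤ} {x : M.carrier} :
    M.toShift l x ∈ (M.shift l).grading i ↔ x ∈ M.grading (i + l) := Iff.rfl

lemma smul_toShift (l : ℤ) (a : B.carrier) (x : M.carrier) :
    a • M.toShift l x = M.toShift l (B.sign l a • x) := rfl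

lemma smul_toShift_of_mem_even (l : ℤ) {i : ℤ} (hi : Even i) {a : B.carrier}
    (ha : a ∈ B.grading i) (x : M.carrier) : a • M.toShift l x = M.toShift l (a • x) := by
  rw [smul_toShift, CDGAlgebra.sign_of_mem_even l hi ha]

lemma d_toShift (l : ℤ) (x : M.carrier) :
    (M.shift l).d (M.toShift l x) = l.negOnePow • M.toShift l (M.d x) := rfl

lemma d_toShift_one (x : M.carrier) :
    (M.shift 1).d (M.toShift 1 x) = -M.toShift 1 (M.d x) := by
  rw [d_toShift, Int.negOnePow_one, Units.neg_smul, one_smul]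

/-- The identification `M[l][m] ≅ M[j]` for `l + m = j`. -/
def shiftShiftIso (M : CDGModule B) {l m j : ℤ} (h : l + m = j) :
    (M.shift l).shift m ≅ M.shift j :=
  let f : (M.shift l).shift m ⟶ M.shift j := Hom.mk (M := (M.shift l).shift m) (N := M.shift j)
    { ((M.shift l).toShift m).symm.trans ((M.toShift l).symm.trans (M.toShift j)) with
      map_smul' := fun a x => by
        change (B.sign l (B.sign m a) • (show M.carrier from x) : M.carrier) =
          B.sign j a • (show M.carrier from x)
        rw [CDGAlgebra.sign_sign, h] }
    (fun {i x} hx => by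
      have hx : (show M.carrier from x) ∈ M.grading (i + m + l) := hx
      change (show M.carrier from x) ∈ M.grading (i + j)
      rwa [← h, add_comm l, ← add_assoc])
    (fun x => by
      change (m.negOnePow • l.negOnePow • M.d (show M.carrier from x) : M.carrier) =
        j.negOnePow • M.d (show M.carrier from x)
      rw [smul_smul, ← Int.negOnePow_add, add_comm m, h])
  have : IsIso f := isIso_of_bijective f Function.bijective_id
  asIso f

lemma shiftShiftIso_hom_apply {l m j : ℤ} (h : l + m = j) (x : M.carrier) :
    linearMap (M.shiftShiftIso h).hom ((M.shift l).toShift m (M.toShift l x)) = M.toShift j x :=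
  rfl

lemma shiftShiftIso_inv_apply {l m j : ℤ} (h : l + m = j) (x : M.carrier) :
    linearMap (M.shiftShiftIso h).inv (M.toShift j x) = (M.shift l).toShift m (M.toShift l x) := by
  rw [← shiftShiftIso_hom_apply h, ← linearMap_comp, Iso.hom_inv_id, linearMap_id]

/-- The identification `M[0] ≅ M`. -/
def shiftZeroIso (M : CDGModule B) : M.shift 0 ≅ M :=
  let f : M.shift 0 ⟶ M := Hom.mk (M := M.shift 0)
    { (M.toShift 0).symm with
      map_smul' := fun a x => by
        change (B.sign 0 a • (show M.carrier from x) : M.carrier) = a • (show M.carrier from x)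
        rw [CDGAlgebra.sign_of_even Even.zero] }
    (fun {i x} hx => by
      have hx : (show M.carrier from x) ∈ M.grading (i + 0) := hx
      rwa [add_zero] at hx)
    (fun x => by
      change ((0 : ℤ).negOnePow • M.d (show M.carrier from x) : M.carrier) =
        M.d (show M.carrier from x)
      rw [Int.negOnePow_zero, one_smul])
  have : IsIso f := isIso_of_bijective f Function.bijective_id
  asIso f

/-! ### Cones -/

section Cone

variable (f : X ⟶ Y)

/-- The element `(y, x)` of the cone of `f : X ⟶ Y`. -/
def coneMk (y : Y.carrier) (x : X.carrier) : (cone f).carrier :=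
  ((y, x) : Y.carrier × X.ShiftCarrier 1)

/-- The first component of an element of the cone of `f : X ⟶ Y`, as a linear map; it is not
closed unless `f = 0`. -/
def coneFst : (cone f).carrier →ₗ[B.carrier] Y.carrier :=
  LinearMap.fst B.carrier Y.carrier (X.shift 1).carrier

/-- The second component of an element of the cone of `f : X ⟶ Y`. -/
def coneSnd : (cone f).carrier →+ X.carrier :=
  AddMonoidHom.snd Y.carrier X.carrier

variable {f} in
lemma cone_ext {p q : (cone f).carrier} (h₁ : coneFst f p = coneFst f q)
    (h₂ : coneSnd f p = coneSnd f q) : p = q :=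
  Prod.ext h₁ h₂

lemma coneFst_mk (y : Y.carrier) (x : X.carrier) : coneFst f (coneMk f y x) = y := rfl

lemma coneSnd_mk (y : Y.carrier) (x : X.carrier) : coneSnd f (coneMk f y x) = x := rfl

lemma exists_coneMk (p : (cone f).carrier) : ∃ y x, coneMk f y x = p := ⟨p.1, p.2, rfl⟩

lemma coneMk_zero : coneMk f 0 0 = 0 := rfl

lemma coneMk_add (y y' : Y.carrier) (x x' : X.carrier) :
    coneMk f (y + y') (x + x') = coneMk f y x + coneMk f y' x' := rfl

lemma coneMk_sub (y y' : Y.carrier) (x x' : X.carrier) :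
    coneMk f (y - y') (x - x') = coneMk f y x - coneMk f y' x' := rfl

lemma smul_coneMk (a : B.carrier) (y : Y.carrier) (x : X.carrier) :
    a • coneMk f y x = coneMk f (a • y) (B.sign 1 a • x) := rfl

lemma d_coneMk (y : Y.carrier) (x : X.carrier) :
    (cone f).d (coneMk f y x) = coneMk f (Y.d y + linearMap f x) (-X.d x) := by
  refine Prod.ext rfl ?_
  change (1 : ℤ).negOnePow • X.d x + 0 = -X.d x
  rw [Int.negOnePow_one, add_zero, Units.neg_smul, one_smul]

lemma isGradedMap_coneFst : IsGradedMap (M := cone f) (coneFst f) := fun _ _ h => h.1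

lemma coneFst_d (p : (cone f).carrier) :
    coneFst f ((cone f).d p) = Y.d (coneFst f p) + linearMap f (coneSnd f p) := rfl

/-- The inclusion `Y ⟶ cone f`. -/
def coneInl : Y ⟶ cone f :=
  Hom.mk (N := cone f) (LinearMap.inl B.carrier Y.carrier (X.shift 1).carrier)
    (fun h => ⟨h, zero_mem _⟩)
    (fun y => by
      change coneMk f (Y.d y) 0 = (cone f).d (coneMk f y 0)
      rw [d_coneMk, map_zero, map_zero, add_zero, neg_zero])

/-- The inclusion of `X[1]` into the cone of `f : X ⟶ Y`, as a linear map; it is not closed unless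
`f = 0`. -/
def coneInr : (X.shift 1).carrier →ₗ[B.carrier] (cone f).carrier :=
  LinearMap.inr B.carrier Y.carrier (X.shift 1).carrier

lemma coneInr_toShift (x : X.carrier) : coneInr f (X.toShift 1 x) = coneMk f 0 x := rfl

/-- The projection `cone f ⟶ X[1]`. -/
def coneπ : cone f ⟶ X.shift 1 :=
  Hom.mk (M := cone f) (N := X.shift 1) (LinearMap.snd B.carrier Y.carrier (X.shift 1).carrier)
    (fun h => h.2)
    (fun p => by
      obtain ⟨y, x, rfl⟩ := exists_coneMk f p
      change X.toShift 1 (coneSnd f ((cone f).d (coneMk f y x))) = (X.shift 1).d (X.toShift 1 x)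
      rw [d_coneMk, coneSnd_mk, map_neg, d_toShift_one])

lemma coneπ_mk (y : Y.carrier) (x : X.carrier) :
    linearMap (coneπ f) (coneMk f y x) = X.toShift 1 x := rfl

variable {f} {f' : X' ⟶ Y'}

/-- The morphism between the cones of the vertical sides of a commutative square. -/
def coneMap {a : X ⟶ X'} {b : Y ⟶ Y'} (sq : CommSq a f f' b) : cone f ⟶ cone f' :=
  Hom.mk (M := cone f) (N := cone f')
    { toFun := fun p => coneMk f' (linearMap b (coneFst f p)) (linearMap a (coneSnd f p))
      map_add' := fun p q => by simp only [map_add, coneMk_add]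
      map_smul' := fun r p => by
        obtain ⟨y, x, rfl⟩ := exists_coneMk f p
        simp only [smul_coneMk, coneFst_mk, coneSnd_mk, map_smul, RingHom.id_apply] }
    (fun h => ⟨linearMap_mem b h.1, linearMap_mem a h.2⟩)
    (fun p => by
      obtain ⟨y, x, rfl⟩ := exists_coneMk f p
      change coneMk f' (linearMap b (coneFst f ((cone f).d (coneMk f y x))))
        (linearMap a (coneSnd f ((cone f).d (coneMk f y x)))) =
          (cone f').d (coneMk f' (linearMap b y) (linearMap a x))
      rw [d_coneMk, d_coneMk, coneFst_mk, coneSnd_mk, map_add, linearMap_d, map_neg, linearMap_d,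
        commSq_apply sq])

lemma coneMap_mk {a : X ⟶ X'} {b : Y ⟶ Y'} (sq : CommSq a f f' b) (y : Y.carrier)
    (x : X.carrier) :
    linearMap (coneMap sq) (coneMk f y x) = coneMk f' (linearMap b y) (linearMap a x) := rfl

/-- The closed morphism to the cone of `f : X ⟶ Y` given by a closed morphism `ψ` to `X[1]` and a
null-homotopy `k` of its composition with `f[1]`. -/
def coneLift (k : M.carrier →ₗ[B.carrier] Y.carrier) (hk : IsGradedMap k) (ψ : M ⟶ X.shift 1)
    (h : ∀ x, k (M.d x) = Y.d (k x) + linearMap f ((X.toShift 1).symm (linearMap ψ x))) :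
    M ⟶ cone f :=
  Hom.mk (N := cone f) (k.prod (M₃ := (X.shift 1).carrier) (linearMap ψ))
    (fun hx => ⟨hk _ _ hx, linearMap_mem ψ hx⟩)
    (fun x => by
      change coneMk f (k (M.d x)) ((X.toShift 1).symm (linearMap ψ (M.d x))) =
        (cone f).d (coneMk f (k x) ((X.toShift 1).symm (linearMap ψ x)))
      obtain ⟨y, hy⟩ := (X.toShift 1).surjective (linearMap ψ x)
      rw [d_coneMk, h, linearMap_d, ← hy, d_toShift_one, ← map_neg, AddEquiv.symm_apply_apply,
        AddEquiv.symm_apply_apply])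

lemma coneSnd_lift (k : M.carrier →ₗ[B.carrier] Y.carrier) (hk : IsGradedMap k)
    (ψ : M ⟶ X.shift 1)
    (h : ∀ x, k (M.d x) = Y.d (k x) + linearMap f ((X.toShift 1).symm (linearMap ψ x)))
    (x : M.carrier) :
    coneSnd f (linearMap (coneLift k hk ψ h) x) = (X.toShift 1).symm (linearMap ψ x) := rfl

end Cone

/-- The linear map `X → M`, `y ↦ d (h y) + h (d y)`, for a linear map `h` from `X[1]` to `M`: the
null-homotopic map with null-homotopy `h`. -/
def boundary (h : (X.shift 1).carrier →ₗ[B.carrier] M.carrier) :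
    X.carrier →ₗ[B.carrier] M.carrier where
  toFun y := M.d (h (X.toShift 1 y)) + h (X.toShift 1 (X.d y))
  map_add' y y' := by simp only [map_add]; abel
  map_smul' a y := by
    have hσ (b : B.carrier) (x : X.carrier) : h (X.toShift 1 (B.sign 1 b • x)) =
        b • h (X.toShift 1 x) := by rw [← map_smul, smul_toShift]
    have ha : h (X.toShift 1 (a • y)) = B.sign 1 a • h (X.toShift 1 y) := by
      rw [← hσ, CDGAlgebra.sign_self_sign]
    have hda : h (X.toShift 1 (B.d a • y)) = B.sign 1 (B.d a) • h (X.toShift 1 y) := by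
      rw [← hσ, CDGAlgebra.sign_self_sign]
    rw [ha, M.d_smul_eq, X.d_smul_eq, map_add, map_add, hσ, hda, CDGAlgebra.d_sign_one,
      CDGAlgebra.sign_self_sign, RingHom.id_apply, smul_add, neg_smul]
    abel

lemma boundary_apply (h : (X.shift 1).carrier →ₗ[B.carrier] M.carrier) (y : X.carrier) :
    boundary h y = M.d (h (X.toShift 1 y)) + h (X.toShift 1 (X.d y)) := rfl

/-- The closed morphism from the cone of `𝟙 X` corresponding to a morphism of graded modules from
`X[1]`. -/
def coneIdDesc (h : (X.shift 1).carrier →ₗ[B.carrier] M.carrier) (hh : IsGradedMap h) :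
    cone (𝟙 X) ⟶ M :=
  Hom.mk (M := cone (𝟙 X)) (boundary h ∘ₗ coneFst (𝟙 X) + h ∘ₗ linearMap (coneπ (𝟙 X)))
    (fun {i p} hp => by
      obtain ⟨y, x, rfl⟩ := exists_coneMk (𝟙 X) p
      have hy : h (X.toShift 1 y) ∈ M.grading (i - 1) := hh _ _ <| by
        rw [toShift_mem_iff, sub_add_cancel]
        exact hp.1
      refine add_mem (add_mem ?_ (hh _ _ (X.d_mem hp.1))) (hh _ _ hp.2)
      have hdy := M.d_mem hy
      rw [sub_add_cancel] at hdy
      exact hdy)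
    (fun p => by
      obtain ⟨y, x, rfl⟩ := exists_coneMk (𝟙 X) p
      have hc : B.c • h (X.toShift 1 y) = h (X.toShift 1 (B.c • y)) := by
        rw [← map_smul, smul_toShift, B.sign_c]
      simp only [LinearMap.add_apply, LinearMap.comp_apply, d_coneMk, coneFst_mk, coneπ_mk,
        linearMap_id, boundary_apply, map_add, map_neg, M.d_d, X.d_d, hc]
      abel)

lemma coneIdDesc_mk_zero_left (h : (X.shift 1).carrier →ₗ[B.carrier] M.carrier)
    (hh : IsGradedMap h) (x : X.carrier) :
    linearMap (coneIdDesc h hh) (coneMk (𝟙 X) 0 x) = h (X.toShift 1 x) := by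
  change boundary h 0 + h (X.toShift 1 x) = _
  rw [map_zero, zero_add]

lemma linearMap_coneMk_id (φ : cone (𝟙 X) ⟶ M) (y : X.carrier) :
    linearMap φ (coneMk (𝟙 X) y 0) = M.d (linearMap φ (coneMk (𝟙 X) 0 y)) +
      linearMap φ (coneMk (𝟙 X) 0 (X.d y)) := by
  rw [← linearMap_d, d_coneMk, map_zero, zero_add, linearMap_id, ← map_add, ← coneMk_add,
    add_zero, neg_add_cancel]

lemma coneId_hom_ext {φ φ' : cone (𝟙 X) ⟶ M}
    (h : ∀ x, linearMap φ (coneMk (𝟙 X) 0 x) = linearMap φ' (coneMk (𝟙 X) 0 x)) : φ = φ' := by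
  refine hom_ext fun p => ?_
  obtain ⟨y, x, rfl⟩ := exists_coneMk (𝟙 X) p
  have hyx : coneMk (𝟙 X) y x = coneMk (𝟙 X) y 0 + coneMk (𝟙 X) 0 x := by
    rw [← coneMk_add, add_zero, zero_add]
  rw [hyx, map_add, map_add, linearMap_coneMk_id, linearMap_coneMk_id, h, h, h]

end CDGModule

/-! ### Homology of differential groups -/

section Homology

variable {G H K : Type*} [AddCommGroup G] [AddCommGroup H] [AddCommGroup K]
  {d : G →+ G} {e : H →+ H} {δ : K →+ K}

/-- The homology `Ker d / (Ker d ∩ Im d)` of an abelian group with an endomorphism `d`; it is the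
usual one if `d ∘ d = 0`. -/
abbrev Homology (d : G →+ G) : Type _ := d.ker ⧸ d.range.addSubgroupOf d.ker

/-- The map induced on homology by a map which commutes with the differentials. -/
def homologyMap (f : G →+ H) (hf : ∀ x, f (d x) = e (f x)) : Homology d →+ Homology e :=
  QuotientAddGroup.map _ _
    ((f.comp d.ker.subtype).codRestrict e.ker fun z => by
      rw [AddMonoidHom.mem_ker, AddMonoidHom.comp_apply, AddSubgroup.subtype_apply, ← hf,
        AddMonoidHom.mem_ker.1 z.2, map_zero]) <| by
    rintro _ ⟨x, hx⟩
    exact ⟨f x, (hf x).symm.trans (congrArg f hx)⟩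

lemma homologyMap_comp (f : G →+ H) (hf : ∀ x, f (d x) = e (f x)) (g : H →+ K)
    (hg : ∀ x, g (e x) = δ (g x)) (hgf : ∀ x, g.comp f (d x) = δ (g.comp f x)) :
    ⇑(homologyMap (g.comp f) hgf) = homologyMap g hg ∘ homologyMap f hf := by
  funext x
  obtain ⟨z, rfl⟩ := QuotientAddGroup.mk_surjective x
  rfl

lemma homologyMap_injective_iff {f : G →+ H} (hf : ∀ x, f (d x) = e (f x)) :
    Function.Injective (homologyMap f hf) ↔
      ∀ z y, d z = 0 → f z = e y → ∃ x, d x = z := by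
  rw [injective_iff_map_eq_zero]
  constructor
  · intro h z y hz hzy
    exact (QuotientAddGroup.eq_zero_iff _).1 <| h (⟨z, hz⟩ : d.ker) <|
      (QuotientAddGroup.eq_zero_iff _).2 ⟨y, hzy.symm⟩
  · intro h q hq
    obtain ⟨⟨z, hz⟩, rfl⟩ := QuotientAddGroup.mk_surjective q
    obtain ⟨y, hy⟩ := (QuotientAddGroup.eq_zero_iff _).1 hq
    exact (QuotientAddGroup.eq_zero_iff _).2 (h z y hz hy.symm)

lemma homologyMap_surjective_iff {f : G →+ H} (hf : ∀ x, f (d x) = e (f x)) :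
    Function.Surjective (homologyMap f hf) ↔
      ∀ w, e w = 0 → ∃ z y, d z = 0 ∧ f z + e y = w := by
  constructor
  · intro h w hw
    obtain ⟨q, hq⟩ := h (⟨w, hw⟩ : e.ker)
    obtain ⟨⟨z, hz⟩, rfl⟩ := QuotientAddGroup.mk_surjective q
    obtain ⟨y, hy⟩ := QuotientAddGroup.eq.1 hq
    exact ⟨z, y, hz, by rw [hy]; exact add_neg_cancel_left _ _⟩
  · intro h q
    obtain ⟨⟨w, hw⟩, rfl⟩ := QuotientAddGroup.mk_surjective q
    obtain ⟨z, y, hz, hzy⟩ := h w hw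
    refine ⟨(⟨z, hz⟩ : d.ker), QuotientAddGroup.eq.2 ⟨y, ?_⟩⟩
    rw [← neg_add_eq_iff_eq_add.2 hzy.symm]
    rfl

lemma subsingleton_homology_of_exact (h : Function.Exact d d) : Subsingleton (Homology d) := by
  refine subsingleton_of_forall_eq 0 fun q => ?_
  obtain ⟨⟨z, hz⟩, rfl⟩ := QuotientAddGroup.mk_surjective q
  exact (QuotientAddGroup.eq_zero_iff _).2 ((h z).1 hz)

/-- The differential `(y, x) ↦ (e y + f x, -d x)` of the cone of `f : (G, d) → (H, e)`. -/
def coneDiff (d : G →+ G) (e : H →+ H) (f : G →+ H) : H × G →+ H × G :=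
  (e.coprod f).prod (-d.comp (AddMonoidHom.snd H G))

lemma coneDiff_apply (f : G →+ H) (y : H) (x : G) :
    coneDiff d e f (y, x) = (e y + f x, -d x) := rfl

lemma exact_coneDiff_iff (hd : ∀ x, d (d x) = 0) (he : ∀ y, e (e y) = 0) {f : G →+ H}
    (hf : ∀ x, f (d x) = e (f x)) :
    Function.Exact (coneDiff d e f) (coneDiff d e f) ↔ Function.Bijective (homologyMap f hf) := by
  rw [Function.Bijective, homologyMap_injective_iff, homologyMap_surjective_iff]
  constructor
  · intro h
    constructor
    · intro z y hz hzy
      obtain ⟨⟨b, a⟩, hab⟩ := (h (-y, z)).1 (by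
        rw [coneDiff_apply, map_neg, hzy, neg_add_cancel, hz, neg_zero, Prod.mk_zero_zero])
      exact ⟨-a, by rw [map_neg]; exact congrArg Prod.snd hab⟩
    · intro w hw
      obtain ⟨⟨b, a⟩, hab⟩ := (h (w, 0)).1 (by
        rw [coneDiff_apply, hw, map_zero, map_zero, add_zero, neg_zero, Prod.mk_zero_zero])
      exact ⟨a, b, neg_eq_zero.1 (congrArg Prod.snd hab),
        (add_comm _ _).trans (congrArg Prod.fst hab)⟩
  · rintro ⟨hinj, hsurj⟩ ⟨y, x⟩
    constructor
    · intro hyx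
      have hx : d x = 0 := neg_eq_zero.1 (congrArg Prod.snd hyx)
      have hyx : e y + f x = 0 := congrArg Prod.fst hyx
      obtain ⟨a, rfl⟩ := hinj x (-y) hx (by rw [map_neg, ← add_eq_zero_iff_eq_neg', hyx])
      obtain ⟨z, b, hz, hzb⟩ := hsurj (y + f a) (by rw [map_add, ← hf, hyx])
      refine ⟨(b, z - a), ?_⟩
      rw [coneDiff_apply, map_sub, map_sub, hz, zero_sub, neg_neg, ← add_sub_assoc,
        add_comm (e b), hzb, add_sub_cancel_right]
    · rintro ⟨⟨b, a⟩, hab⟩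
      rw [← hab, coneDiff_apply, coneDiff_apply, map_add, he, map_neg, map_neg, hf, hd, zero_add,
        add_neg_cancel, neg_zero, neg_zero, Prod.mk_zero_zero]

/-- Every cycle `z` of `G` together with a cochain `y` bounding `f z` lifts to an element of `G`:
the lifting property of surjective quasi-isomorphisms. -/
def LiftsCycles (d : G →+ G) (e : H →+ H) (f : G →+ H) : Prop :=
  ∀ z y, d z = 0 → f z = e y → ∃ x, d x = z ∧ f x = y

lemma liftsCycles_iff (hd : ∀ x, d (d x) = 0) (he : ∀ y, e (e y) = 0) {f : G →+ H}
    (hf : ∀ x, f (d x) = e (f x)) :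
    LiftsCycles d e f ↔ Function.Surjective f ∧ Function.Bijective (homologyMap f hf) := by
  rw [Function.Bijective, homologyMap_injective_iff, homologyMap_surjective_iff]
  constructor
  · intro h
    have lift_cycle (w : H) (hw : e w = 0) : ∃ z, d z = 0 ∧ f z = w :=
      h 0 w (map_zero d) (by rw [map_zero, hw])
    refine ⟨fun y => ?_, fun z y hz hzy => ?_, fun w hw => ?_⟩
    · obtain ⟨z, hz, hzy⟩ := lift_cycle (e y) (he y)
      obtain ⟨x, -, hx⟩ := h z y hz hzy
      exact ⟨x, hx⟩
    · obtain ⟨x, hx, -⟩ := h z y hz hzy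
      exact ⟨x, hx⟩
    · obtain ⟨z, hz, rfl⟩ := lift_cycle w hw
      exact ⟨z, 0, hz, by rw [map_zero, add_zero]⟩
  · rintro ⟨hsurj, hinj, hsurjH⟩ z y hz hzy
    obtain ⟨x, rfl⟩ := hinj z y hz hzy
    obtain ⟨z', y', hz', hy'⟩ := hsurjH (y - f x) (by rw [map_sub, ← hzy, hf, sub_self])
    obtain ⟨x', rfl⟩ := hsurj y'
    refine ⟨x + z' + d x', ?_, ?_⟩
    · rw [map_add, map_add, hz', hd, add_zero, add_zero]
    · rw [map_add, map_add, hf, add_assoc, hy', add_sub_cancel]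

end Homology

namespace CDGDeformation

open CDGModule

variable {M N P : CDGModule An.toCDGAlgebra}

/-! ### The action of `t` and `c/t` -/

lemma t_pow_smul_smul (i : ℕ) (a : An.carrier) (x : M.carrier) :
    An.t ^ i • a • x = a • An.t ^ i • x := by
  rw [smul_smul, smul_smul, An.t_pow_comm]

lemma t_smul_smul (a : An.carrier) (x : M.carrier) : An.t • a • x = a • An.t • x := by
  rw [smul_smul, smul_smul, An.t_comm]

lemma t_pow_succ_smul (i : ℕ) (x : M.carrier) : An.t ^ (i + 1) • x = An.t ^ i • An.t • x := by
  rw [smul_smul, pow_succ An.t]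

lemma t_pow_succ_smul' (i : ℕ) (x : M.carrier) : An.t ^ (i + 1) • x = An.t • An.t ^ i • x := by
  rw [smul_smul, pow_succ' An.t]

lemma d_t_pow_smul (i : ℕ) (x : M.carrier) : M.d (An.t ^ i • x) = An.t ^ i • M.d x := by
  rw [M.d_smul x (An.t_pow_mem i), An.d_t_pow, zero_smul, zero_add, Int.negOnePow_zero, one_smul]

lemma d_t_smul (x : M.carrier) : M.d (An.t • x) = An.t • M.d x := by
  simpa only [pow_one An.t] using d_t_pow_smul (An := An) 1 x

lemma d_cDivT_smul (x : M.carrier) :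
    M.d (An.cDivT • x) = An.d An.cDivT • x + An.cDivT • M.d x := by
  rw [M.d_smul x An.cDivT_mem, Int.negOnePow_even _ even_two, one_smul]

lemma d_d_eq_cDivT_smul (x : M.carrier) : M.d (M.d x) = An.cDivT • An.t • x := by
  rw [M.d_d, smul_smul, ← An.t_comm, An.t_mul_cDivT]

lemma d_d_t_pow_smul (i : ℕ) (x : M.carrier) :
    M.d (M.d (An.t ^ i • x)) = An.t ^ (i + 1) • An.cDivT • x := by
  rw [d_d_eq_cDivT_smul, ← t_pow_succ_smul', t_pow_smul_smul]

lemma t_pow_smul_eq_zero_of_le {i j : ℕ} (h : i ≤ j) {x : M.carrier} (hx : An.t ^ i • x = 0) :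
    An.t ^ j • x = 0 := by
  rw [← Nat.sub_add_cancel h, pow_add An.t, mul_smul, hx, smul_zero]

lemma d_cDivT_smul_eq_zero {x : M.carrier} (hx : An.t ^ n • x = 0) :
    An.d An.cDivT • x = 0 := by
  obtain ⟨b, hb⟩ := An.d_cDivT
  rw [← hb, mul_smul, hx, smul_zero]

lemma t_pow_eq_zero : An.t ^ (n + 1) = 0 := by
  have h : (AdjoinRoot.root (Polynomial.X ^ (n + 1) : Polynomial k)) ^ (n + 1) = 0 := by
    rw [← AdjoinRoot.mk_X, ← map_pow, AdjoinRoot.mk_self]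
  rw [t, ← map_pow, h, map_zero]

lemma t_pow_smul_eq_zero {i : ℕ} (hi : n < i) (x : M.carrier) : An.t ^ i • x = 0 :=
  t_pow_smul_eq_zero_of_le hi (by rw [An.t_pow_eq_zero, zero_smul])

/-! ### The complexes `Hom(Γ_i, M)` -/

variable (M) in
/-- The group `Ker t^(i+1) × Ker t^i` underlying the complex of morphisms of graded modules from
`Γ_i` to `M`, without its grading: a pair consists of the images of the two generators of `Γ_i`. -/
def homGroup (i : ℕ) : AddSubgroup (M.carrier × M.carrier) where
  carrier := {z | An.t ^ (i + 1) • z.1 = 0 ∧ An.t ^ i • z.2 = 0}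
  zero_mem' := ⟨smul_zero _, smul_zero _⟩
  add_mem' := fun hx hy => ⟨by rw [Prod.fst_add, smul_add, hx.1, hy.1, add_zero],
    by rw [Prod.snd_add, smul_add, hx.2, hy.2, add_zero]⟩
  neg_mem' := fun hx => ⟨by rw [Prod.fst_neg, smul_neg, hx.1, neg_zero],
    by rw [Prod.snd_neg, smul_neg, hx.2, neg_zero]⟩

variable (M) in
/-- The differential of the complexes `Hom(Γ_i, M)`, extended to all of `M × M`, where it does not
square to zero. -/
def homD : M.carrier × M.carrier →+ M.carrier × M.carrier where
  toFun z := (M.d z.1 - An.cDivT • z.2, An.t • z.1 - M.d z.2)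
  map_zero' := by simp
  map_add' z w := by
    refine Prod.ext ?_ ?_ <;> simp only [Prod.fst_add, Prod.snd_add, map_add, smul_add] <;> abel

lemma homD_apply (x y : M.carrier) :
    homD M (x, y) = (M.d x - An.cDivT • y, An.t • x - M.d y) := rfl

lemma homD_mem {i : ℕ} {z : M.carrier × M.carrier} (hz : z ∈ homGroup M i) :
    homD M z ∈ homGroup M i := by
  obtain ⟨x, y⟩ := z
  obtain ⟨hx, hy⟩ : An.t ^ (i + 1) • x = 0 ∧ An.t ^ i • y = 0 := hz
  constructor
  · change An.t ^ (i + 1) • (M.d x - An.cDivT • y) = 0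
    rw [smul_sub, ← d_t_pow_smul, hx, map_zero, t_pow_smul_smul,
      t_pow_smul_eq_zero_of_le i.le_succ hy, smul_zero, sub_zero]
  · change An.t ^ i • (An.t • x - M.d y) = 0
    rw [smul_sub, ← t_pow_succ_smul, hx, ← d_t_pow_smul, hy, map_zero, sub_zero]

lemma homD_homD {i : ℕ} (hi : i ≤ n) {z : M.carrier × M.carrier} (hz : z ∈ homGroup M i) :
    homD M (homD M z) = 0 := by
  obtain ⟨x, y⟩ := z
  have hy : An.d An.cDivT • y = 0 := d_cDivT_smul_eq_zero (t_pow_smul_eq_zero_of_le hi hz.2)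
  refine Prod.ext ?_ ?_
  · change M.d (M.d x - An.cDivT • y) - An.cDivT • (An.t • x - M.d y) = 0
    rw [map_sub, d_d_eq_cDivT_smul, d_cDivT_smul, hy, smul_sub]
    abel
  · change An.t • (M.d x - An.cDivT • y) - M.d (An.t • x - M.d y) = 0
    rw [map_sub, d_d_eq_cDivT_smul, d_t_smul, smul_sub, t_smul_smul]
    abel

lemma homGroup_le_succ (i : ℕ) : homGroup M i ≤ homGroup M (i + 1) := fun _ hz =>
  ⟨t_pow_smul_eq_zero_of_le (i + 1).le_succ hz.1, t_pow_smul_eq_zero_of_le i.le_succ hz.2⟩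

variable (M) in
/-- The differential of the complex `Hom(Γ_i, M)`. -/
def homDiff (i : ℕ) : homGroup M i →+ homGroup M i :=
  ((homD M).comp (homGroup M i).subtype).codRestrict (homGroup M i) fun z => homD_mem z.2

lemma homDiff_homDiff {i : ℕ} (hi : i ≤ n) (z : homGroup M i) :
    homDiff M i (homDiff M i z) = 0 := Subtype.ext (homD_homD hi z.2)

/-- The map `M × M → N × N` induced by a closed morphism `M ⟶ N`. -/
def prodMap (f : M ⟶ N) : M.carrier × M.carrier →+ N.carrier × N.carrier :=
  (linearMap f).toAddMonoidHom.prodMap (linearMap f).toAddMonoidHom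

lemma prodMap_apply (f : M ⟶ N) (x y : M.carrier) :
    prodMap f (x, y) = (linearMap f x, linearMap f y) := rfl

lemma prodMap_mem (f : M ⟶ N) {i : ℕ} {z : M.carrier × M.carrier} (hz : z ∈ homGroup M i) :
    prodMap f z ∈ homGroup N i :=
  ⟨by rw [prodMap_apply, ← map_smul, hz.1, map_zero],
    by rw [prodMap_apply, ← map_smul, hz.2, map_zero]⟩

lemma prodMap_homD (f : M ⟶ N) (z : M.carrier × M.carrier) :
    prodMap f (homD M z) = homD N (prodMap f z) := by
  obtain ⟨x, y⟩ := z
  simp only [prodMap_apply, homD_apply, map_sub, map_smul, linearMap_d]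

/-- The map `Hom(Γ_i, M) → Hom(Γ_i, N)` induced by a closed morphism `M ⟶ N`. -/
def homMap (f : M ⟶ N) (i : ℕ) : homGroup M i →+ homGroup N i :=
  ((prodMap f).comp (homGroup M i).subtype).codRestrict (homGroup N i) fun z => prodMap_mem f z.2

lemma homMap_homDiff (f : M ⟶ N) (i : ℕ) (z : homGroup M i) :
    homMap f i (homDiff M i z) = homDiff N i (homMap f i z) := Subtype.ext (prodMap_homD f z)

/-! ### `n`-acyclicity in terms of the complexes `Hom(Γ_i, M)` -/

/-- The class of `t^i x` in `t^i M / t^(i+1) M`. -/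
def grMk (i : ℕ) (x : M.carrier) : (An.gr M i).carrier :=
  ((An.tPow M (i + 1)).restrict (An.tPow M i)).toSubmodule.mkQ ⟨An.t ^ i • x, x, rfl⟩

lemma exists_grMk {i : ℕ} (q : (An.gr M i).carrier) : ∃ x, grMk i x = q := by
  obtain ⟨⟨_, x, rfl⟩, rfl⟩ := Submodule.mkQ_surjective _ q
  exact ⟨x, rfl⟩

lemma grMk_eq_iff {i : ℕ} {x y : M.carrier} :
    grMk i x = grMk i y ↔ ∃ w : M.carrier, An.t ^ (i + 1) • w = An.t ^ i • x - An.t ^ i • y :=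
  Submodule.Quotient.eq _

lemma grMk_zero (i : ℕ) : grMk i (0 : M.carrier) = 0 :=
  (Submodule.Quotient.mk_eq_zero _).2 ⟨0, (smul_zero _).trans (smul_zero _).symm⟩

lemma d_grMk (i : ℕ) (x : M.carrier) : (An.gr M i).d (grMk i x) = grMk i (M.d x) :=
  congrArg (Submodule.mkQ _) (Subtype.ext (d_t_pow_smul i x))

variable (An M) in
/-- Acyclicity of the complex `t^i M / t^(i+1) M`. -/
def GrAcyclic (i : ℕ) : Prop :=
  ∀ x w : M.carrier, M.d (An.t ^ i • x) = An.t ^ (i + 1) • w →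
    ∃ y v : M.carrier, An.t ^ i • x = M.d (An.t ^ i • y) + An.t ^ (i + 1) • v

variable (An M) in
/-- Acyclicity of the complex `t^i M ∩ Ker t`. -/
def KerAcyclic (i : ℕ) : Prop :=
  ∀ x : M.carrier, An.t ^ (i + 1) • x = 0 → M.d (An.t ^ i • x) = 0 →
    ∃ y : M.carrier, An.t ^ (i + 1) • y = 0 ∧ M.d (An.t ^ i • y) = An.t ^ i • x

variable (An M) in
/-- Acyclicity of the complex `Hom(Γ_i, M)`. -/
def HomAcyclic (i : ℕ) : Prop :=
  ∀ z ∈ homGroup M i, homD M z = 0 → ∃ w ∈ homGroup M i, homD M w = z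

lemma exact_gr_iff (i : ℕ) :
    Function.Exact (An.gr M i).d (An.gr M i).d ↔ GrAcyclic An M i := by
  constructor
  · intro h x w hxw
    obtain ⟨q, hq⟩ := (h (grMk i x)).1 (by
      rw [d_grMk, ← grMk_zero, grMk_eq_iff]
      exact ⟨w, by rw [smul_zero, sub_zero, ← d_t_pow_smul, hxw]⟩)
    obtain ⟨y, rfl⟩ := exists_grMk q
    rw [d_grMk, eq_comm, grMk_eq_iff] at hq
    obtain ⟨v, hv⟩ := hq
    exact ⟨y, v, by rw [hv, d_t_pow_smul, add_sub_cancel]⟩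
  · intro h q
    obtain ⟨x, rfl⟩ := exists_grMk q
    constructor
    · intro hx
      rw [d_grMk, ← grMk_zero, grMk_eq_iff] at hx
      obtain ⟨w, hw⟩ := hx
      obtain ⟨y, v, hyv⟩ := h x w (by rw [d_t_pow_smul, hw, smul_zero, sub_zero])
      refine ⟨grMk i y, ?_⟩
      rw [d_grMk, eq_comm, grMk_eq_iff]
      exact ⟨v, by rw [hyv, d_t_pow_smul, add_sub_cancel_left]⟩
    · rintro ⟨q, hq⟩
      obtain ⟨y, rfl⟩ := exists_grMk q
      rw [← hq, d_grMk, d_grMk, ← grMk_zero, grMk_eq_iff]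
      exact ⟨An.cDivT • y, by
        rw [smul_zero, sub_zero, ← d_t_pow_smul, ← d_t_pow_smul, d_d_t_pow_smul]⟩

lemma exact_homDiff_iff {i : ℕ} (hi : i ≤ n) :
    Function.Exact (homDiff M i) (homDiff M i) ↔ HomAcyclic An M i := by
  constructor
  · intro h z hz hDz
    obtain ⟨w, hw⟩ := (h ⟨z, hz⟩).1 (Subtype.ext hDz)
    exact ⟨w, w.2, congrArg Subtype.val hw⟩
  · intro h z
    constructor
    · intro hDz
      obtain ⟨w, hw, hwz⟩ := h z z.2 (congrArg Subtype.val hDz)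
      exact ⟨⟨w, hw⟩, Subtype.ext hwz⟩
    · rintro ⟨w, rfl⟩
      exact homDiff_homDiff hi w

lemma grAcyclic_of_lt {i : ℕ} (hi : n < i) : GrAcyclic An M i := fun x _ _ =>
  ⟨0, 0, by rw [t_pow_smul_eq_zero hi, smul_zero, smul_zero, map_zero, add_zero]⟩

lemma kerAcyclic_of_lt {i : ℕ} (hi : n < i) : KerAcyclic An M i := fun x _ _ =>
  ⟨0, smul_zero _, by rw [t_pow_smul_eq_zero hi x, smul_zero, map_zero]⟩

lemma correction_of_boundary {i : ℕ} {x y w : M.carrier}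
    (h : An.t ^ (i + 1) • x = M.d (An.t ^ (i + 1) • y) + An.t ^ (i + 2) • w) :
    An.t ^ (i + 1) • (x - M.d y - An.t • w) = 0 ∧ M.d (An.t ^ i • (x - M.d y - An.t • w)) =
      M.d (An.t ^ i • x) - An.t ^ (i + 1) • (An.cDivT • y + M.d w) := by
  constructor
  · rw [smul_sub, smul_sub, h, d_t_pow_smul, ← t_pow_succ_smul]
    abel
  · rw [smul_sub, smul_sub, map_sub, map_sub, ← d_t_pow_smul, d_d_t_pow_smul, ← t_pow_succ_smul,
      d_t_pow_smul _ w, smul_add]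
    abel

lemma kerAcyclic_of_grAcyclic_succ {i : ℕ} (h₀ : GrAcyclic An M i) (h₁ : GrAcyclic An M (i + 1))
    (h₂ : KerAcyclic An M (i + 1)) : KerAcyclic An M i := by
  intro x hx hdx
  obtain ⟨y, v, hyv⟩ := h₀ x 0 (by rw [hdx, smul_zero])
  have hty : M.d (An.t ^ (i + 1) • y) + An.t ^ (i + 2) • v = 0 := by
    rw [t_pow_succ_smul', d_t_smul, t_pow_succ_smul' (i + 1), ← smul_add, ← hyv,
      ← t_pow_succ_smul', hx]
  obtain ⟨y₁, w₁, h⟩ := h₁ y (-v) (by rw [smul_neg, ← add_eq_zero_iff_eq_neg, hty])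
  obtain ⟨hy₁, hdy₁⟩ := correction_of_boundary h
  set y' := y - M.d y₁ - An.t • w₁
  set v' := v + (An.cDivT • y₁ + M.d w₁) with hv'
  have hxy' : An.t ^ i • x = M.d (An.t ^ i • y') + An.t ^ (i + 1) • v' := by
    rw [hyv, hdy₁, hv', smul_add _ v]
    abel
  have hv' : An.t ^ (i + 2) • v' = 0 := by
    rw [t_pow_succ_smul', eq_sub_of_add_eq' hxy'.symm, smul_sub, ← t_pow_succ_smul', hx,
      ← d_t_smul, ← t_pow_succ_smul', hy₁, map_zero, sub_zero]
  have hdv' : M.d (An.t ^ (i + 1) • v') = 0 := by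
    rw [eq_sub_of_add_eq' hxy'.symm, map_sub, hdx, d_d_t_pow_smul, t_pow_smul_smul, hy₁,
      smul_zero, sub_zero]
  obtain ⟨y₂, hy₂, hdy₂⟩ := h₂ v' hv' hdv'
  refine ⟨y' + An.t • y₂, ?_, ?_⟩
  · rw [smul_add, hy₁, ← t_pow_succ_smul, hy₂, add_zero]
  · rw [smul_add, map_add, ← t_pow_succ_smul, hdy₂, hxy']

lemma grAcyclic_of_kerAcyclic_succ {i : ℕ} (h₀ : KerAcyclic An M i) (h₁ : KerAcyclic An M (i + 1))
    (h₂ : GrAcyclic An M (i + 1)) : GrAcyclic An M i := by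
  intro x w hxw
  obtain ⟨y₁, w₁, h⟩ := h₂ x w (by rw [t_pow_succ_smul', d_t_smul, hxw, ← t_pow_succ_smul'])
  obtain ⟨hx₁, hdx₁⟩ := correction_of_boundary h
  rw [hxw, ← smul_sub] at hdx₁
  set x' := x - M.d y₁ - An.t • w₁ with hx'
  set w' := w - (An.cDivT • y₁ + M.d w₁)
  obtain ⟨x₂, hx₂, hdx₂⟩ := h₁ w'
    (by rw [t_pow_succ_smul', ← hdx₁, ← d_t_smul, ← t_pow_succ_smul', hx₁, map_zero])
    (by rw [← hdx₁, d_d_t_pow_smul, t_pow_smul_smul, hx₁, smul_zero])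
  obtain ⟨y, -, hdy⟩ := h₀ (x' - An.t • x₂)
    (by rw [smul_sub, hx₁, ← t_pow_succ_smul, hx₂, sub_zero])
    (by rw [smul_sub, map_sub, hdx₁, ← t_pow_succ_smul, hdx₂, sub_self])
  refine ⟨y₁ + y, w₁ + x₂, ?_⟩
  rw [smul_add, map_add, hdy, hx', d_t_pow_smul _ y₁, t_pow_succ_smul, smul_add, smul_add, smul_sub,
    smul_sub, smul_sub]
  abel

lemma forall_grAcyclic_iff_forall_kerAcyclic :
    (∀ i, GrAcyclic An M i) ↔ ∀ i, KerAcyclic An M i := by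
  have descend {p : ℕ → Prop} (hp : ∀ i, n < i → p i) (step : ∀ i, p (i + 1) → p i) (i : ℕ) :
      p i := by
    by_cases hi : i ≤ n + 1
    · exact Nat.decreasingInduction (motive := fun i _ => p i) (fun i _ => step i)
        (hp _ n.lt_succ_self) hi
    · exact hp i (by lia)
  exact ⟨fun h => descend (fun _ => kerAcyclic_of_lt) fun i =>
      kerAcyclic_of_grAcyclic_succ (h i) (h (i + 1)),
    fun h => descend (fun _ => grAcyclic_of_lt) fun i =>
      grAcyclic_of_kerAcyclic_succ (h i) (h (i + 1))⟩

lemma mem_homGroup_zero_iff {x y : M.carrier} :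
    (x, y) ∈ homGroup M 0 ↔ An.t • x = 0 ∧ y = 0 := by
  change An.t ^ (0 + 1) • x = 0 ∧ An.t ^ 0 • y = 0 ↔ _
  rw [zero_add, pow_one An.t, pow_zero An.t, one_smul]

lemma homD_mk_zero_right {x : M.carrier} (hx : An.t • x = 0) : homD M (x, 0) = (M.d x, 0) := by
  rw [homD_apply, smul_zero, map_zero, hx, sub_zero, sub_zero]

lemma homAcyclic_zero_iff : HomAcyclic An M 0 ↔ KerAcyclic An M 0 := by
  simp only [KerAcyclic, zero_add, pow_one An.t, pow_zero An.t, one_smul]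
  constructor
  · intro h x hx hdx
    obtain ⟨⟨y, y'⟩, hy, hyx⟩ := h (x, 0) (mem_homGroup_zero_iff.2 ⟨hx, rfl⟩) (by
      rw [homD_mk_zero_right hx, hdx, Prod.mk_zero_zero])
    obtain ⟨hty, rfl⟩ := mem_homGroup_zero_iff.1 hy
    rw [homD_mk_zero_right hty] at hyx
    exact ⟨y, hty, congrArg Prod.fst hyx⟩
  · rintro h ⟨x, x'⟩ hx hDx
    obtain ⟨htx, rfl⟩ := mem_homGroup_zero_iff.1 hx
    rw [homD_mk_zero_right htx] at hDx
    obtain ⟨y, hy, hyx⟩ := h x htx (congrArg Prod.fst hDx)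
    exact ⟨(y, 0), mem_homGroup_zero_iff.2 ⟨hy, rfl⟩, by rw [homD_mk_zero_right hy, hyx]⟩

lemma homAcyclic_succ {i : ℕ} (hi : i + 1 ≤ n) (h : HomAcyclic An M i) (h₀ : KerAcyclic An M i)
    (h₁ : KerAcyclic An M (i + 1)) : HomAcyclic An M (i + 1) := by
  rintro ⟨x, y⟩ ⟨hx, hy⟩ hD
  have hdx : M.d x = An.cDivT • y := sub_eq_zero.1 (congrArg Prod.fst hD)
  have htx : An.t • x = M.d y := sub_eq_zero.1 (congrArg Prod.snd hD)
  dsimp only at hx hy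
  obtain ⟨p, hp, hdp⟩ := h₁ x hx (by rw [d_t_pow_smul, hdx, t_pow_smul_smul, hy, smul_zero])
  obtain ⟨q, hq, hdq⟩ := h₀ (y - An.t • p)
    (by rw [smul_sub, hy, ← t_pow_succ_smul, hp, sub_zero])
    (by rw [smul_sub, map_sub, ← t_pow_succ_smul, hdp, d_t_pow_smul, ← htx, ← t_pow_succ_smul,
      sub_self])
  have hpq : (p, -q) ∈ homGroup M (i + 1) := ⟨hp, by rw [smul_neg, hq, neg_zero]⟩
  have hmem : (x, y) - homD M (p, -q) ∈ homGroup M i := by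
    constructor
    · change An.t ^ (i + 1) • (x - (M.d p - An.cDivT • -q)) = 0
      rw [smul_sub, smul_sub, ← d_t_pow_smul, hdp, t_pow_smul_smul, smul_neg, hq, neg_zero,
        smul_zero, sub_zero, sub_self]
    · change An.t ^ i • (y - (An.t • p - M.d (-q))) = 0
      rw [map_neg, sub_neg_eq_add, ← sub_sub, smul_sub, ← d_t_pow_smul, hdq, sub_self]
  obtain ⟨w, hw, hDw⟩ := h _ hmem (by rw [map_sub, homD_homD hi hpq, hD, sub_zero])
  exact ⟨w + (p, -q), add_mem (homGroup_le_succ i hw) hpq, by rw [map_add, hDw, sub_add_cancel]⟩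

lemma kerAcyclic_succ {i : ℕ} (hi : i + 1 ≤ n) (h : KerAcyclic An M i) (h₀ : HomAcyclic An M i)
    (h₁ : HomAcyclic An M (i + 1)) : KerAcyclic An M (i + 1) := by
  intro x hx hdx
  obtain ⟨y, hy, hdy⟩ := h (An.t • x) (by rw [← t_pow_succ_smul, hx])
    (by rw [← t_pow_succ_smul, hdx])
  have hxy : (x, y) ∈ homGroup M (i + 1) := ⟨hx, hy⟩
  have hmem : homD M (x, y) ∈ homGroup M i := by
    constructor
    · change An.t ^ (i + 1) • (M.d x - An.cDivT • y) = 0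
      rw [smul_sub, ← d_t_pow_smul, hdx, t_pow_smul_smul, hy, smul_zero, sub_zero]
    · change An.t ^ i • (An.t • x - M.d y) = 0
      rw [smul_sub, ← d_t_pow_smul, hdy, ← t_pow_succ_smul, sub_self]
  obtain ⟨⟨a, b⟩, hab, hDab⟩ := h₀ _ hmem (homD_homD hi hxy)
  obtain ⟨⟨p, q⟩, ⟨hp, hq⟩, hDpq⟩ := h₁ ((x, y) - (a, b))
    (sub_mem hxy (homGroup_le_succ i hab)) (by rw [map_sub, hDab, sub_self])
  refine ⟨p, hp, ?_⟩
  have ha : An.t ^ (i + 1) • a = 0 := hab.1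
  have hq : An.t ^ (i + 1) • q = 0 := hq
  have hdp : M.d p - An.cDivT • q = x - a := congrArg Prod.fst hDpq
  rw [d_t_pow_smul, eq_add_of_sub_eq hdp, smul_add, smul_sub, ha, sub_zero, t_pow_smul_smul, hq,
    smul_zero, add_zero]

lemma forall_homAcyclic_iff_forall_kerAcyclic :
    (∀ i ≤ n, HomAcyclic An M i) ↔ ∀ i ≤ n, KerAcyclic An M i := by
  constructor <;> intro h i hi
  · induction i with
    | zero => exact homAcyclic_zero_iff.1 (h 0 hi)
    | succ i ih =>
      have hi' : i ≤ n := i.le_succ.trans hi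
      exact kerAcyclic_succ hi (ih hi') (h i hi') (h (i + 1) hi)
  · induction i with
    | zero => exact homAcyclic_zero_iff.2 (h 0 hi)
    | succ i ih =>
      have hi' : i ≤ n := i.le_succ.trans hi
      exact homAcyclic_succ hi (ih hi') (h i hi') (h (i + 1) hi)

lemma isNAcyclic_iff :
    An.IsNAcyclic M ↔ ∀ i ≤ n, Function.Exact (homDiff M i) (homDiff M i) := by
  have ignore_lt {p : ℕ → Prop} (hp : ∀ i, n < i → p i) : (∀ i ≤ n, p i) ↔ ∀ i, p i :=
    ⟨fun h i => (le_or_gt i n).elim (h i) (hp i), fun h i _ => h i⟩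
  calc An.IsNAcyclic M ↔ ∀ i ≤ n, GrAcyclic An M i := forall₂_congr fun i _ => exact_gr_iff i
    _ ↔ ∀ i ≤ n, KerAcyclic An M i := by
      rw [ignore_lt fun _ => grAcyclic_of_lt, ignore_lt fun _ => kerAcyclic_of_lt,
        forall_grAcyclic_iff_forall_kerAcyclic]
    _ ↔ ∀ i ≤ n, HomAcyclic An M i := forall_homAcyclic_iff_forall_kerAcyclic.symm
    _ ↔ _ := forall₂_congr fun i hi => (exact_homDiff_iff hi).symm

end CDGDeformation

namespace QDGModule

variable (M : QDGModule B)

lemma proj_smul {e : ℤ} {a : B.carrier} (ha : a ∈ B.grading e) (i : ℤ) (x : M.carrier) :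
    M.proj (i + e) (a • x) = a • M.proj i x :=
  proj_map (M := M) (N := M) e (DistribSMul.toAddMonoidHom M.carrier a)
    (fun hm => add_comm e _ ▸ M.smul_mem ha hm) i x

lemma proj_d (i : ℤ) (x : M.carrier) : M.proj (i + 1) (M.d x) = M.d (M.proj i x) :=
  proj_map (M := M) (N := M) 1 M.d M.d_mem i x

lemma exists_sum_proj_eq (e : ℤ) (x : M.carrier) :
    ∃ s : Finset ℤ, ∀ t, s ⊆ t → ∑ j ∈ t, M.proj (j + e) x = x := by
  induction x using M.induction with
  | zero => exact ⟨∅, fun t _ => by simp⟩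
  | add x y hx hy =>
    obtain ⟨s, hs⟩ := hx
    obtain ⟨s', hs'⟩ := hy
    refine ⟨s ∪ s', fun t ht => ?_⟩
    simp only [map_add, Finset.sum_add_distrib]
    rw [hs t (Finset.union_subset_left ht), hs' t (Finset.union_subset_right ht)]
  | homogeneous i x hx =>
    refine ⟨{i - e}, fun t ht => ?_⟩
    rw [Finset.sum_eq_single_of_mem (i - e) (ht (Finset.mem_singleton_self _)), sub_add_cancel,
      M.proj_of_mem hx]
    exact fun j _ hj => M.proj_of_mem_ne (by lia) hx

end QDGModule

namespace CDGDeformation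

open CDGModule

variable {M N P : CDGModule An.toCDGAlgebra}

/-! ### `n`-quasi-isomorphisms -/

section Cone

variable (f : M ⟶ N)

lemma t_pow_smul_coneMk (i : ℕ) (y : N.carrier) (x : M.carrier) :
    An.t ^ i • coneMk f y x = coneMk f (An.t ^ i • y) (An.t ^ i • x) := by
  rw [smul_coneMk, CDGAlgebra.sign_of_mem_even 1 Even.zero (An.t_pow_mem i)]

lemma coneMk_eq_zero_iff {y : N.carrier} {x : M.carrier} :
    coneMk f y x = 0 ↔ y = 0 ∧ x = 0 := Prod.mk_eq_zero

lemma coneMk_mem_homGroup_iff {i : ℕ} {y y' : N.carrier} {x x' : M.carrier} :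
    (coneMk f y x, coneMk f y' x') ∈ homGroup (cone f) i ↔
      (y, y') ∈ homGroup N i ∧ (x, x') ∈ homGroup M i := by
  change An.t ^ (i + 1) • coneMk f y x = 0 ∧ An.t ^ i • coneMk f y' x' = 0 ↔
    (An.t ^ (i + 1) • y = 0 ∧ An.t ^ i • y' = 0) ∧ An.t ^ (i + 1) • x = 0 ∧ An.t ^ i • x' = 0
  rw [t_pow_smul_coneMk, t_pow_smul_coneMk, coneMk_eq_zero_iff, coneMk_eq_zero_iff,
    and_and_and_comm]

lemma neg_snd_mem_homGroup {i : ℕ} {x x' : M.carrier} (h : (x, x') ∈ homGroup M i) :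
    (x, -x') ∈ homGroup M i := ⟨h.1, (smul_neg _ _).trans (neg_eq_zero.2 h.2)⟩

/-- The identification of `Hom(Γ_i, cone f)` with the cone of `Hom(Γ_i, f)`. The sign makes it
compatible with the differentials. -/
def homConeEquiv (i : ℕ) : homGroup N i × homGroup M i ≃+ homGroup (cone f) i where
  toFun p := ⟨(coneMk f p.1.1.1 p.2.1.1, coneMk f p.1.1.2 (-p.2.1.2)),
    (coneMk_mem_homGroup_iff f).2 ⟨p.1.2, neg_snd_mem_homGroup p.2.2⟩⟩
  invFun q := (⟨(coneFst f q.1.1, coneFst f q.1.2), ((coneMk_mem_homGroup_iff f).1 q.2).1⟩,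
    ⟨(coneSnd f q.1.1, -coneSnd f q.1.2),
      neg_snd_mem_homGroup ((coneMk_mem_homGroup_iff f).1 q.2).2⟩)
  left_inv p := Prod.ext rfl (Subtype.ext (Prod.ext rfl (neg_neg p.2.1.2)))
  right_inv q := Subtype.ext (Prod.ext rfl (Prod.ext rfl (neg_neg (coneSnd f q.1.2))))
  map_add' p q := Subtype.ext (Prod.ext rfl (Prod.ext rfl (neg_add p.2.1.2 q.2.1.2)))

lemma homDiff_homConeEquiv (i : ℕ) (p : homGroup N i × homGroup M i) :
    homDiff (cone f) i (homConeEquiv f i p) =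
      homConeEquiv f i (coneDiff (homDiff M i) (homDiff N i) (homMap f i) p) := by
  obtain ⟨⟨⟨y, y'⟩, _⟩, ⟨⟨x, x'⟩, _⟩⟩ := p
  refine Subtype.ext (Prod.ext ?_ ?_)
  · change (cone f).d (coneMk f y x) - An.cDivT • coneMk f y' (-x') =
        coneMk f (N.d y - An.cDivT • y' + linearMap f x) (-(M.d x - An.cDivT • x'))
    rw [d_coneMk, smul_coneMk, CDGAlgebra.sign_of_mem_even 1 even_two An.cDivT_mem, ← coneMk_sub,
      smul_neg, sub_neg_eq_add, neg_sub, neg_add_eq_sub, sub_add_eq_add_sub]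
  · change An.t • coneMk f y x - (cone f).d (coneMk f y' (-x')) =
        coneMk f (An.t • y - N.d y' + linearMap f x') (- -(An.t • x - M.d x'))
    rw [d_coneMk, smul_coneMk, CDGAlgebra.sign_of_mem_even 1 Even.zero An.t_mem, ← coneMk_sub,
      map_neg, map_neg, neg_neg, neg_neg, ← sub_eq_add_neg, sub_sub_eq_add_sub, sub_add_eq_add_sub]

end Cone

lemma isNQuasiIso_iff (f : M ⟶ N) : An.IsNQuasiIso f ↔
    ∀ i ≤ n, Function.Bijective (homologyMap (homMap f i) (homMap_homDiff f i)) := by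
  rw [IsNQuasiIso, isNAcyclic_iff]
  refine forall₂_congr fun i hi => ?_
  rw [← exact_coneDiff_iff (homDiff_homDiff hi) (homDiff_homDiff hi)]
  have ladder : (homDiff (cone f) i).comp (homConeEquiv f i).toAddMonoidHom =
      (homConeEquiv f i).toAddMonoidHom.comp
        (coneDiff (homDiff M i) (homDiff N i) (homMap f i)) :=
    AddMonoidHom.ext (homDiff_homConeEquiv f i)
  exact Function.Exact.iff_of_ladder_addEquiv (homConeEquiv f i) (homConeEquiv f i)
    (homConeEquiv f i) ladder ladder

lemma homologyMap_homMap_comp (f : M ⟶ N) (g : N ⟶ P) (i : ℕ) :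
    ⇑(homologyMap (homMap (f ≫ g) i) (homMap_homDiff (f ≫ g) i)) =
      homologyMap (homMap g i) (homMap_homDiff g i) ∘
        homologyMap (homMap f i) (homMap_homDiff f i) :=
  homologyMap_comp (homMap f i) _ (homMap g i) _ _

variable (An) in
/-- The class of `n`-quasi-isomorphisms. -/
def nQuasiIsos : MorphismProperty (CDGModule An.toCDGAlgebra) := fun _ _ f => An.IsNQuasiIso f

instance : An.nQuasiIsos.HasTwoOutOfThreeProperty where
  comp_mem f g hf hg := (isNQuasiIso_iff _).2 fun i hi => by
    rw [homologyMap_homMap_comp]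
    exact ((isNQuasiIso_iff g).1 hg i hi).comp ((isNQuasiIso_iff f).1 hf i hi)
  of_postcomp f g hg hfg := (isNQuasiIso_iff f).2 fun i hi => by
    have hfg := (isNQuasiIso_iff _).1 hfg i hi
    rwa [homologyMap_homMap_comp, ((isNQuasiIso_iff g).1 hg i hi).of_comp_iff'] at hfg
  of_precomp f g hf hfg := (isNQuasiIso_iff g).2 fun i hi => by
    have hfg := (isNQuasiIso_iff _).1 hfg i hi
    rwa [homologyMap_homMap_comp, Function.Bijective.of_comp_iff _
      ((isNQuasiIso_iff f).1 hf i hi)] at hfg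

lemma isNQuasiIso_of_isNAcyclic (hM : An.IsNAcyclic M) (hN : An.IsNAcyclic N) (f : M ⟶ N) :
    An.IsNQuasiIso f :=
  (isNQuasiIso_iff f).2 fun i hi => by
    have := subsingleton_homology_of_exact (isNAcyclic_iff.1 hM i hi)
    have := subsingleton_homology_of_exact (isNAcyclic_iff.1 hN i hi)
    exact ⟨Function.injective_of_subsingleton _, Function.surjective_to_subsingleton _⟩

lemma isNAcyclic_cone_id (M : CDGModule An.toCDGAlgebra) : An.IsNAcyclic (cone (𝟙 M)) :=
  (isNQuasiIso_iff (𝟙 M)).2 fun i _ =>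
    ⟨(homologyMap_injective_iff _).2 fun _ y _ h => ⟨y, h.symm⟩,
      (homologyMap_surjective_iff _).2 fun w hw => ⟨w, 0, hw, by rw [map_zero, add_zero]; rfl⟩⟩

/-! ### Surjections on the kernels of the powers of `t` -/

variable (An) in
/-- The class of morphisms which induce surjections on the kernels of all powers of `t`. -/
def kerSurjections : MorphismProperty (CDGModule An.toCDGAlgebra) := fun M N f =>
  ∀ i : ℕ, 1 ≤ i → i ≤ n + 1 → Set.SurjOn (linearMap f) (An.kerTPow M i) (An.kerTPow N i)

lemma kerSurjections_iff (f : M ⟶ N) :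
    An.kerSurjections f ↔ ∀ i ≤ n, Function.Surjective (homMap f i) := by
  constructor
  · rintro hf i hi ⟨⟨y, y'⟩, hy, hy'⟩
    obtain ⟨x, hx, rfl⟩ := hf (i + 1) (by lia) (by lia) hy
    obtain ⟨x', hx', rfl⟩ : y' ∈ linearMap f '' An.kerTPow M i := by
      rcases Nat.eq_zero_or_pos i with rfl | hi₀
      · refine ⟨0, smul_zero _, ?_⟩
        rw [map_zero]
        simpa only [pow_zero An.t, one_smul] using hy'.symm
      · exact hf i hi₀ (by lia) hy'
    exact ⟨⟨(x, x'), hx, hx'⟩, rfl⟩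
  · intro h i hi hi' y hy
    obtain ⟨i, rfl⟩ := Nat.exists_eq_add_of_le' hi
    obtain ⟨x, hx⟩ := h i (by lia) ⟨(y, 0), hy, smul_zero _⟩
    exact ⟨x.1.1, x.2.1, congrArg (fun z => z.1.1) hx⟩

lemma kerSurjections_and_isNQuasiIso_iff (f : M ⟶ N) :
    An.kerSurjections f ∧ An.IsNQuasiIso f ↔
      ∀ i ≤ n, LiftsCycles (homDiff M i) (homDiff N i) (homMap f i) := by
  rw [kerSurjections_iff, isNQuasiIso_iff, ← forall₂_and]
  exact forall₂_congr fun i hi => (liftsCycles_iff (homDiff_homDiff hi) (homDiff_homDiff hi)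
    (homMap_homDiff f i)).symm

/-! ### Homogeneous elements of `Hom(Γ_i, M)` -/

variable (M) in
/-- The pairs which are homogeneous of degree `j` as elements of `Hom(Γ_i, M)`; the second
generator of `Γ_i` has degree `-1`. -/
def homDeg (j : ℤ) : AddSubgroup (M.carrier × M.carrier) :=
  (M.grading j).prod (M.grading (j - 1))

variable (M) in
/-- The projection of `Hom(Γ_i, M)` to its component of degree `j`. -/
def homProj (j : ℤ) : M.carrier × M.carrier →+ M.carrier × M.carrier :=
  (M.proj j).prodMap (M.proj (j - 1))

lemma homProj_mem_homDeg (j : ℤ) (z : M.carrier × M.carrier) :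
    homProj M j z ∈ homDeg M j := ⟨M.proj_mem _ _, M.proj_mem _ _⟩

lemma homProj_of_mem {j : ℤ} {z : M.carrier × M.carrier} (hz : z ∈ homDeg M j) :
    homProj M j z = z := Prod.ext (M.proj_of_mem hz.1) (M.proj_of_mem hz.2)

lemma homProj_mem {i : ℕ} (j : ℤ) {z : M.carrier × M.carrier} (hz : z ∈ homGroup M i) :
    homProj M j z ∈ homGroup M i := by
  have proj_t_pow_smul (i : ℕ) (j : ℤ) (x : M.carrier) :
      An.t ^ i • M.proj j x = M.proj j (An.t ^ i • x) := by
    rw [← M.proj_smul (An.t_pow_mem i), add_zero]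
  exact ⟨(proj_t_pow_smul _ _ _).trans ((congrArg _ hz.1).trans (map_zero _)),
    (proj_t_pow_smul _ _ _).trans ((congrArg _ hz.2).trans (map_zero _))⟩

lemma homProj_homD (j : ℤ) (z : M.carrier × M.carrier) :
    homProj M (j + 1) (homD M z) = homD M (homProj M j z) := by
  obtain ⟨x, y⟩ := z
  refine Prod.ext ?_ ?_
  · change M.proj (j + 1) (M.d x - An.cDivT • y) = M.d (M.proj j x) - An.cDivT • M.proj (j - 1) y
    rw [map_sub, M.proj_d, ← M.proj_smul An.cDivT_mem, show j - 1 + 2 = j + 1 by ring]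
  · change M.proj (j + 1 - 1) (An.t • x - M.d y) = An.t • M.proj j x - M.d (M.proj (j - 1) y)
    rw [map_sub, ← M.proj_d, ← M.proj_smul An.t_mem, add_zero, sub_add_cancel,
      add_sub_cancel_right]

lemma homProj_prodMap (f : M ⟶ N) (j : ℤ) (z : M.carrier × M.carrier) :
    homProj N j (prodMap f z) = prodMap f (homProj M j z) :=
  Prod.ext (linearMap_proj f _ _).symm (linearMap_proj f _ _).symm

lemma exists_sum_homProj_eq (e : ℤ) (z : M.carrier × M.carrier) :
    ∃ s : Finset ℤ, ∀ t, s ⊆ t → ∑ j ∈ t, homProj M (j + e) z = z := by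
  obtain ⟨s, hs⟩ := M.exists_sum_proj_eq e z.1
  obtain ⟨s', hs'⟩ := M.exists_sum_proj_eq (e - 1) z.2
  refine ⟨s ∪ s', fun t ht => Prod.ext ?_ ?_⟩
  · rw [Prod.fst_sum]
    exact hs t (Finset.union_subset_left ht)
  · rw [Prod.snd_sum]
    refine Eq.trans (Finset.sum_congr rfl fun j _ => ?_) (hs' t (Finset.union_subset_right ht))
    change M.proj (j + e - 1) z.2 = _
    rw [add_sub_assoc]

lemma surjective_homMap_iff_homogeneous (f : M ⟶ N) (i : ℕ) :
    Function.Surjective (homMap f i) ↔ ∀ j, ∀ y ∈ homGroup N i, y ∈ homDeg N j →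
      ∃ x ∈ homGroup M i, x ∈ homDeg M j ∧ prodMap f x = y := by
  constructor
  · intro h j y hy hyj
    obtain ⟨x, hx⟩ := h ⟨y, hy⟩
    refine ⟨homProj M j x, homProj_mem j x.2, homProj_mem_homDeg j _, ?_⟩
    rw [← homProj_prodMap, show prodMap f x = y from congrArg Subtype.val hx, homProj_of_mem hyj]
  · rintro h ⟨y, hy⟩
    obtain ⟨s, hs⟩ := exists_sum_homProj_eq 0 y
    choose x hx _ hxy using fun j => h j _ (homProj_mem j hy) (homProj_mem_homDeg j y)
    refine ⟨⟨∑ j ∈ s, x j, sum_mem fun j _ => hx j⟩, Subtype.ext ?_⟩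
    change prodMap f (∑ j ∈ s, x j) = y
    rw [map_sum, ← hs s subset_rfl]
    exact Finset.sum_congr rfl fun j _ => by rw [hxy, add_zero]

lemma liftsCycles_homMap_iff_homogeneous (f : M ⟶ N) (i : ℕ) :
    LiftsCycles (homDiff M i) (homDiff N i) (homMap f i) ↔
      ∀ j, ∀ z ∈ homGroup M i, z ∈ homDeg M (j + 1) → homD M z = 0 →
        ∀ y ∈ homGroup N i, y ∈ homDeg N j → prodMap f z = homD N y →
          ∃ x ∈ homGroup M i, x ∈ homDeg M j ∧ homD M x = z ∧ prodMap f x = y := by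
  constructor
  · intro h j z hz hzj hDz y hy hyj hzy
    obtain ⟨⟨x, hx⟩, hDx, hxy⟩ := h ⟨z, hz⟩ ⟨y, hy⟩ (Subtype.ext hDz) (Subtype.ext hzy)
    have hDx : homD M x = z := congrArg Subtype.val hDx
    have hxy : prodMap f x = y := congrArg Subtype.val hxy
    exact ⟨homProj M j x, homProj_mem j hx, homProj_mem_homDeg j x,
      by rw [← homProj_homD, hDx, homProj_of_mem hzj],
      by rw [← homProj_prodMap, hxy, homProj_of_mem hyj]⟩
  · rintro h ⟨z, hz⟩ ⟨y, hy⟩ hDz hzy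
    have hDz : homD M z = 0 := congrArg Subtype.val hDz
    have hzy : prodMap f z = homD N y := congrArg Subtype.val hzy
    obtain ⟨s, hs⟩ := exists_sum_homProj_eq 1 z
    obtain ⟨s', hs'⟩ := exists_sum_homProj_eq 0 y
    choose x hx _ hDx hxy using fun j => h j _ (homProj_mem (j + 1) hz) (homProj_mem_homDeg _ z)
      (by rw [← homProj_homD, hDz, map_zero]) _ (homProj_mem j hy)
      (homProj_mem_homDeg j y) (by rw [← homProj_prodMap, hzy, homProj_homD])
    refine ⟨⟨∑ j ∈ s ∪ s', x j, sum_mem fun j _ => hx j⟩, Subtype.ext ?_, Subtype.ext ?_⟩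
    · change homD M (∑ j ∈ s ∪ s', x j) = z
      rw [map_sum, ← hs (s ∪ s') Finset.subset_union_left]
      exact Finset.sum_congr rfl fun j _ => hDx j
    · change prodMap f (∑ j ∈ s ∪ s', x j) = y
      rw [map_sum, ← hs' (s ∪ s') Finset.subset_union_right]
      exact Finset.sum_congr rfl fun j _ => by rw [hxy, add_zero]

end CDGDeformation

lemma map_units_int_smul {F G H : Type*} [AddCommGroup G] [AddCommGroup H] [FunLike F G H]
    [AddMonoidHomClass F G H] (f : F) (u : ℤˣ) (x : G) : f (u • x) = u • f x := by
  rw [Units.smul_def, map_zsmul, Units.smul_def]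

namespace CDGDeformation

open CDGModule

variable {M N : CDGModule An.toCDGAlgebra}

/-! ### Morphisms from the modules `Γ_i[l]` -/

section Generators

/-- The additive map `A_n / t^m A_n → M`, `a ↦ (-1)^(l|a|) a x`. -/
def truncLift {m : ℕ} (l : ℤ) {x : M.carrier} (hx : An.t ^ m • x = 0) :
    (An.truncation m).carrier →+ M.carrier :=
  QuotientAddGroup.lift (An.tIdeal m).toSubmodule.toAddSubgroup
    (show An.carrier →+ M.carrier from
      (LinearMap.toSpanSingleton An.carrier M.carrier x).toAddMonoidHom.comp
        (An.sign l).toAddMonoidHom) <| by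
    rintro _ ⟨b, rfl⟩
    change An.sign l (b * An.t ^ m) • x = 0
    rw [map_mul, CDGAlgebra.sign_of_mem_even l Even.zero (An.t_pow_mem m), mul_smul, hx, smul_zero]

variable (An) (i : Fin (n + 1)) (l : ℤ)

/-- The element of `Γ_i = A_i ⊕ A_(i-1)[1]` represented by a pair of elements of `A_n`. -/
def gammaMk (a b : An.carrier) : (An.gamma i).carrier :=
  (show (An.truncation (i + 1)).carrier × (An.truncation i).ShiftCarrier 1 from
    (An.toTrunc (i + 1) a, An.toTrunc i b))

lemma exists_gammaMk (x : (An.gamma i).carrier) : ∃ a b, An.gammaMk i a b = x := by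
  obtain ⟨x, y⟩ := x
  obtain ⟨a, rfl⟩ := An.toTrunc_surjective _ x
  obtain ⟨b, hb⟩ := An.toTrunc_surjective _ y
  exact ⟨a, b, Prod.ext rfl hb⟩

lemma exists_gammaMk_of_mem {j : ℤ} {x : (An.gamma i).carrier}
    (hx : x ∈ (An.gamma i).grading j) :
    ∃ a ∈ An.grading j, ∃ b ∈ An.grading (j + 1), An.gammaMk i a b = x := by
  obtain ⟨⟨a, ha, ha'⟩, ⟨b, hb, hb'⟩⟩ := hx
  exact ⟨a, ha, b, hb, Prod.ext ha' hb'⟩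

lemma gammaMk_mem {j : ℤ} {a b : An.carrier} (ha : a ∈ An.grading j)
    (hb : b ∈ An.grading (j + 1)) : An.gammaMk i a b ∈ (An.gamma i).grading j :=
  ⟨An.toTrunc_mem _ ha, An.toTrunc_mem _ hb⟩

lemma gammaMk_add (a b a' b' : An.carrier) :
    An.gammaMk i (a + a') (b + b') = An.gammaMk i a b + An.gammaMk i a' b' := rfl

lemma smul_gammaMk (r a b : An.carrier) :
    r • An.gammaMk i a b = An.gammaMk i (r * a) (An.sign 1 r * b) := rfl

lemma d_gammaMk (a b : An.carrier) : (An.gamma i).d (An.gammaMk i a b) =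
    An.gammaMk i (An.d a + b * An.t) (-An.d b + a * An.cDivT) := by
  refine Prod.ext rfl ?_
  change (1 : ℤ).negOnePow • An.toTrunc i (An.d b) + An.toTrunc i (a * An.cDivT) =
    An.toTrunc i (-An.d b + a * An.cDivT)
  rw [Int.negOnePow_one, Units.neg_smul, one_smul, map_add, map_neg]

/-- The shift `Γ_i[l]`. -/
abbrev gammaShift : CDGModule An.toCDGAlgebra := (An.gamma i).shift l

/-- The generator of `Γ_i[l]` coming from `1 ∈ A_i`. -/
def gammaGen : (An.gammaShift i l).carrier := (An.gamma i).toShift l (An.gammaMk i 1 0)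

/-- The generator of `Γ_i[l]` coming from `1 ∈ A_(i-1)[1]`. -/
def gammaGen' : (An.gammaShift i l).carrier := (An.gamma i).toShift l (An.gammaMk i 0 1)

lemma toShift_gammaMk (a b : An.carrier) : (An.gamma i).toShift l (An.gammaMk i a b) =
    An.sign l a • An.gammaGen i l + An.sign (l + 1) b • An.gammaGen' i l := by
  have hb : An.sign (l + 1 + (l + 1)) b = b := CDGAlgebra.sign_of_even ⟨l + 1, rfl⟩ b
  rw [gammaGen, gammaGen', smul_toShift, smul_toShift, CDGAlgebra.sign_self_sign,
    CDGAlgebra.sign_sign, smul_gammaMk, smul_gammaMk, CDGAlgebra.sign_sign,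
    show 1 + (l + (l + 1)) = l + 1 + (l + 1) by ring, hb, mul_one, mul_zero, mul_zero, mul_one,
    ← map_add, ← gammaMk_add, add_zero, zero_add]

lemma exists_smul_gammaGen_add (w : (An.gammaShift i l).carrier) :
    ∃ a b : An.carrier, a • An.gammaGen i l + b • An.gammaGen' i l = w := by
  obtain ⟨x, rfl⟩ := ((An.gamma i).toShift l).surjective w
  obtain ⟨a, b, rfl⟩ := An.exists_gammaMk i x
  exact ⟨_, _, (An.toShift_gammaMk i l a b).symm⟩

lemma gammaGen_mem : An.gammaGen i l ∈ (An.gammaShift i l).grading (-l) := by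
  rw [gammaGen, toShift_mem_iff, neg_add_cancel]
  exact An.gammaMk_mem i (SetLike.one_mem_graded An.grading) (zero_mem _)

lemma gammaGen'_mem : An.gammaGen' i l ∈ (An.gammaShift i l).grading (-l - 1) := by
  rw [gammaGen', toShift_mem_iff, show -l - 1 + l = -1 by ring]
  exact An.gammaMk_mem i (zero_mem _) (SetLike.one_mem_graded An.grading)

lemma d_gammaGen : (An.gammaShift i l).d (An.gammaGen i l) =
    l.negOnePow • An.cDivT • An.gammaGen' i l := by
  rw [gammaGen, d_toShift, d_gammaMk, toShift_gammaMk, An.d_one, zero_mul, add_zero, map_zero,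
    map_zero, neg_zero, one_mul, zero_add, zero_smul, zero_add,
    CDGAlgebra.sign_of_mem_even _ even_two An.cDivT_mem]

lemma d_gammaGen' : (An.gammaShift i l).d (An.gammaGen' i l) =
    l.negOnePow • An.t • An.gammaGen i l := by
  rw [gammaGen', d_toShift, d_gammaMk, toShift_gammaMk, An.d_one, zero_mul, add_zero, map_zero,
    neg_zero, one_mul, zero_add, map_zero, zero_smul, add_zero,
    CDGAlgebra.sign_of_mem_even _ Even.zero An.t_mem]

lemma t_pow_smul_gammaGen : An.t ^ (i + 1 : ℕ) • An.gammaGen i l = 0 := by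
  rw [gammaGen, smul_toShift_of_mem_even l Even.zero (An.t_pow_mem _), smul_gammaMk, mul_one,
    mul_zero]
  exact Prod.ext (An.toTrunc_eq_zero _ 1 (one_mul _)) (map_zero _)

lemma t_pow_smul_gammaGen' : An.t ^ (i : ℕ) • An.gammaGen' i l = 0 := by
  rw [gammaGen', smul_toShift_of_mem_even l Even.zero (An.t_pow_mem _), smul_gammaMk, mul_zero,
    CDGAlgebra.sign_of_mem_even 1 Even.zero (An.t_pow_mem _), mul_one]
  exact Prod.ext (map_zero _) (An.toTrunc_eq_zero _ 1 (one_mul _))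

/-- The linear map from `Γ_i[l]` with prescribed images of the generators. -/
def gammaLift {x y : M.carrier} (hx : An.t ^ (i + 1 : ℕ) • x = 0)
    (hy : An.t ^ (i : ℕ) • y = 0) :
    (An.gammaShift i l).carrier →ₗ[An.carrier] M.carrier where
  toFun w := truncLift l hx ((An.gamma i).toShift l |>.symm w).1 +
    truncLift (l + 1) hy ((An.gamma i).toShift l |>.symm w).2
  map_add' w w' := by
    refine Eq.trans (congrArg₂ (· + ·) (map_add (truncLift l hx) _ _)
      (map_add (truncLift (l + 1) hy) _ _)) (add_add_add_comm _ _ _ _)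
  map_smul' r w := by
    obtain ⟨w, rfl⟩ := ((An.gamma i).toShift l).surjective w
    obtain ⟨a, b, rfl⟩ := An.exists_gammaMk i w
    change An.sign l (An.sign l r * a) • x + An.sign (l + 1) (An.sign 1 (An.sign l r) * b) • y =
      r • (An.sign l a • x + An.sign (l + 1) b • y)
    have hr : An.sign 1 (An.sign l r) = An.sign (l + 1) r := by
      rw [CDGAlgebra.sign_sign, add_comm 1 l]
    rw [hr, map_mul, map_mul, CDGAlgebra.sign_self_sign, CDGAlgebra.sign_self_sign, smul_add,
      mul_smul, mul_smul]

lemma gammaLift_gen {x y : M.carrier} (hx : An.t ^ (i + 1 : ℕ) • x = 0)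
    (hy : An.t ^ (i : ℕ) • y = 0) : An.gammaLift i l hx hy (An.gammaGen i l) = x := by
  change An.sign l 1 • x + An.sign (l + 1) 0 • y = x
  rw [map_one, one_smul, map_zero, zero_smul, add_zero]

lemma gammaLift_gen' {x y : M.carrier} (hx : An.t ^ (i + 1 : ℕ) • x = 0)
    (hy : An.t ^ (i : ℕ) • y = 0) : An.gammaLift i l hx hy (An.gammaGen' i l) = y := by
  change An.sign l 0 • x + An.sign (l + 1) 1 • y = y
  rw [map_one, one_smul, map_zero, zero_smul, zero_add]

end Generators

section Eval

variable {i : Fin (n + 1)} {l : ℤ}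

/-- The element of `Hom(Γ_i, M)` corresponding to a linear map `Γ_i[l] → M`. The sign makes the
differential of `Hom(Γ_i, M)` independent of `l`. -/
def gammaEval (g : (An.gammaShift i l).carrier →ₗ[An.carrier] M.carrier) :
    M.carrier × M.carrier :=
  (g (An.gammaGen i l), l.negOnePow • g (An.gammaGen' i l))

lemma prodMap_gammaEval (f : M ⟶ N)
    (g : (An.gammaShift i l).carrier →ₗ[An.carrier] M.carrier) :
    prodMap f (gammaEval g) = gammaEval (linearMap f ∘ₗ g) :=
  Prod.ext rfl (map_zsmul (linearMap f) _ _)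

lemma gammaEval_mem_homGroup (g : (An.gammaShift i l).carrier →ₗ[An.carrier] M.carrier) :
    gammaEval g ∈ homGroup M i := by
  constructor
  · change An.t ^ (i + 1 : ℕ) • g _ = 0
    rw [← map_smul, t_pow_smul_gammaGen, map_zero]
  · change An.t ^ (i : ℕ) • l.negOnePow • g _ = 0
    rw [smul_comm, ← map_smul, t_pow_smul_gammaGen', map_zero, smul_zero]

lemma gammaEval_injective : Function.Injective
    (gammaEval : ((An.gammaShift i l).carrier →ₗ[An.carrier] M.carrier) → _) := by
  intro g g' h
  have h₁ : g (An.gammaGen i l) = g' (An.gammaGen i l) := congrArg Prod.fst h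
  have h₂ : g (An.gammaGen' i l) = g' (An.gammaGen' i l) :=
    smul_left_cancel l.negOnePow (congrArg Prod.snd h)
  ext w
  obtain ⟨a, b, rfl⟩ := An.exists_smul_gammaGen_add i l w
  simp only [map_add, map_smul, h₁, h₂]

lemma exists_gammaEval_eq {z : M.carrier × M.carrier} (hz : z ∈ homGroup M i) :
    ∃ g : (An.gammaShift i l).carrier →ₗ[An.carrier] M.carrier, gammaEval g = z := by
  have hz₂ : An.t ^ (i : ℕ) • l.negOnePow • z.2 = 0 := by rw [smul_comm, hz.2, smul_zero]
  refine ⟨An.gammaLift i l hz.1 hz₂, Prod.ext (An.gammaLift_gen i l _ _) ?_⟩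
  rw [gammaEval, gammaLift_gen', smul_smul, Int.units_mul_self, one_smul]

lemma isGradedMap_iff_gammaEval_mem
    (g : (An.gammaShift i l).carrier →ₗ[An.carrier] M.carrier) :
    IsGradedMap g ↔ gammaEval g ∈ homDeg M (-l) := by
  constructor
  · intro hg
    exact ⟨hg _ _ (An.gammaGen_mem i l), zsmul_mem (hg _ _ (An.gammaGen'_mem i l)) _⟩
  · rintro ⟨h₁, h₂⟩ j w hw
    have h₂' : g (An.gammaGen' i l) ∈ M.grading (-l - 1) := by
      rw [← one_smul ℤˣ (g _), ← Int.units_mul_self l.negOnePow, mul_smul]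
      exact zsmul_mem (S := AddSubgroup M.carrier) h₂ _
    obtain ⟨w, rfl⟩ := ((An.gamma i).toShift l).surjective w
    obtain ⟨a, ha, b, hb, rfl⟩ := An.exists_gammaMk_of_mem i (toShift_mem_iff.1 hw)
    rw [toShift_gammaMk, map_add, map_smul, map_smul]
    have hx := M.smul_mem (An.sign_mem l ha) h₁
    have hy := M.smul_mem (An.sign_mem (l + 1) hb) h₂'
    rw [add_neg_cancel_right] at hx
    rw [show j + l + 1 + (-l - 1) = j by ring] at hy
    exact add_mem hx hy

lemma forall_apply_d_eq_iff_homD_gammaEval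
    (g : (An.gammaShift i l).carrier →ₗ[An.carrier] M.carrier) :
    (∀ w, g ((An.gammaShift i l).d w) = M.d (g w)) ↔ homD M (gammaEval g) = 0 := by
  have hgen : homD M (gammaEval g) = 0 ↔
      g ((An.gammaShift i l).d (An.gammaGen i l)) = M.d (g (An.gammaGen i l)) ∧
        g ((An.gammaShift i l).d (An.gammaGen' i l)) = M.d (g (An.gammaGen' i l)) := by
    rw [d_gammaGen, d_gammaGen', gammaEval, homD_apply, Prod.mk_eq_zero, sub_eq_zero, sub_eq_zero,
      map_units_int_smul, map_units_int_smul, map_units_int_smul, map_smul, map_smul,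
      eq_comm (a := M.d _), smul_comm An.cDivT]
    refine and_congr Iff.rfl ?_
    rw [← smul_left_cancel_iff l.negOnePow, smul_smul _ _ (M.d _), Int.units_mul_self, one_smul]
  rw [hgen]
  refine ⟨fun h => ⟨h _, h _⟩, fun ⟨h₁, h₂⟩ w => ?_⟩
  obtain ⟨a, b, rfl⟩ := An.exists_smul_gammaGen_add i l w
  simp only [map_add, QDGModule.d_smul_eq, map_smul, h₁, h₂]

lemma exists_gammaEval_linearMap_eq {z : M.carrier × M.carrier} (hz : z ∈ homGroup M i)
    (hzl : z ∈ homDeg M (-l)) (hDz : homD M z = 0) :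
    ∃ φ : An.gammaShift i l ⟶ M, gammaEval (linearMap φ) = z := by
  obtain ⟨g, rfl⟩ := exists_gammaEval_eq hz (l := l)
  exact ⟨Hom.mk (M := An.gammaShift i l) g (fun h => (isGradedMap_iff_gammaEval_mem g).2 hzl _ _ h)
    ((forall_apply_d_eq_iff_homD_gammaEval g).2 hDz), rfl⟩

end Eval

/-! ### Morphisms from the cones of the identities of the modules `Γ_i[l]` -/

section Cone

variable (An) in
/-- The cone of the identity of `Γ_i[l]`. -/
abbrev gammaCone (i : Fin (n + 1)) (l : ℤ) : CDGModule An.toCDGAlgebra :=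
  cone (𝟙 (An.gammaShift i l))

variable (An) in
/-- The inclusion of `Γ_i[l]` into the cone of its identity. -/
abbrev gammaIncl (i : Fin (n + 1)) (l : ℤ) : An.gammaShift i l ⟶ An.gammaCone i l := coneInl _

variable {i : Fin (n + 1)} {l : ℤ}

/-- The linear map from `Γ_i[l+1] = Γ_i[l][1]` obtained by restricting a morphism from the cone of
the identity of `Γ_i[l]`. -/
def gammaConeRestrict (φ : An.gammaCone i l ⟶ M) :
    (An.gammaShift i (l + 1)).carrier →ₗ[An.carrier] M.carrier :=
  linearMap φ ∘ₗ coneInr (𝟙 (An.gammaShift i l)) ∘ₗ linearMap ((An.gamma i).shiftShiftIso rfl).inv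

lemma gammaConeRestrict_apply (φ : An.gammaCone i l ⟶ M) (x : (An.gamma i).carrier) :
    gammaConeRestrict φ ((An.gamma i).toShift (l + 1) x) =
      linearMap φ (coneMk (𝟙 (An.gammaShift i l)) 0 ((An.gamma i).toShift l x)) := by
  rw [gammaConeRestrict, LinearMap.comp_apply, LinearMap.comp_apply, shiftShiftIso_inv_apply,
    coneInr_toShift]

lemma isGradedMap_gammaConeRestrict (φ : An.gammaCone i l ⟶ M) :
    IsGradedMap (gammaConeRestrict φ) := fun _ _ hx =>
  linearMap_mem φ ⟨zero_mem _, linearMap_mem ((An.gamma i).shiftShiftIso rfl).inv hx⟩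

lemma gammaConeRestrict_comp (φ : An.gammaCone i l ⟶ M) (f : M ⟶ N) :
    gammaConeRestrict (φ ≫ f) = linearMap f ∘ₗ gammaConeRestrict φ := rfl

lemma gammaConeRestrict_injective : Function.Injective
    (gammaConeRestrict : (An.gammaCone i l ⟶ M) → _) := fun φ φ' h =>
  coneId_hom_ext fun x => by
    obtain ⟨x, rfl⟩ := ((An.gamma i).toShift l).surjective x
    rw [← gammaConeRestrict_apply, ← gammaConeRestrict_apply, h]

lemma exists_gammaConeRestrict_eq {g : (An.gammaShift i (l + 1)).carrier →ₗ[An.carrier] M.carrier}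
    (hg : IsGradedMap g) : ∃ φ : An.gammaCone i l ⟶ M, gammaConeRestrict φ = g := by
  let h := g ∘ₗ linearMap ((An.gamma i).shiftShiftIso rfl).hom
  have hh : IsGradedMap (M := (An.gammaShift i l).shift 1) h := fun _ _ hx =>
    hg _ _ (linearMap_mem ((An.gamma i).shiftShiftIso rfl).hom hx)
  refine ⟨coneIdDesc h hh, LinearMap.ext fun x => ?_⟩
  obtain ⟨x, rfl⟩ := ((An.gamma i).toShift (l + 1)).surjective x
  rw [gammaConeRestrict_apply, coneIdDesc_mk_zero_left, LinearMap.comp_apply,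
    shiftShiftIso_hom_apply]

lemma homD_gammaEval_gammaConeRestrict (φ : An.gammaCone i l ⟶ M) :
    homD M (gammaEval (gammaConeRestrict φ)) = gammaEval (linearMap (An.gammaIncl i l ≫ φ)) := by
  have hgen : gammaConeRestrict φ (An.gammaGen i (l + 1)) =
      linearMap φ (coneMk (𝟙 (An.gammaShift i l)) 0 (An.gammaGen i l)) :=
    gammaConeRestrict_apply φ _
  have hgen' : gammaConeRestrict φ (An.gammaGen' i (l + 1)) =
      linearMap φ (coneMk (𝟙 (An.gammaShift i l)) 0 (An.gammaGen' i l)) :=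
    gammaConeRestrict_apply φ _
  have smul_mk {j : ℤ} (hj : Even j) {a : An.carrier} (ha : a ∈ An.grading j)
      (x : (An.gammaShift i l).carrier) :
      linearMap φ (coneMk (𝟙 (An.gammaShift i l)) 0 (l.negOnePow • a • x)) =
        l.negOnePow • a • linearMap φ (coneMk (𝟙 (An.gammaShift i l)) 0 x) := by
    simp only [← coneInr_toShift]
    rw [map_units_int_smul, map_units_int_smul, map_units_int_smul,
      ← smul_toShift_of_mem_even 1 hj ha, map_smul, map_smul]
  rw [gammaEval, homD_apply, hgen, hgen']
  refine Prod.ext ?_ ?_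
  · change _ = linearMap φ (coneMk (𝟙 (An.gammaShift i l)) (An.gammaGen i l) 0)
    rw [linearMap_coneMk_id, d_gammaGen, smul_mk even_two An.cDivT_mem, Int.negOnePow_succ,
      Units.neg_smul, smul_neg, sub_neg_eq_add, smul_comm]
  · change _ = l.negOnePow • linearMap φ (coneMk (𝟙 (An.gammaShift i l)) (An.gammaGen' i l) 0)
    rw [linearMap_coneMk_id, d_gammaGen', smul_mk Even.zero An.t_mem, Int.negOnePow_succ,
      Units.neg_smul, map_neg, sub_neg_eq_add, smul_add, smul_smul, Int.units_mul_self, one_smul,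
      map_units_int_smul]
    exact add_comm _ _

end Cone

section Lifting

variable {i : Fin (n + 1)} {l : ℤ}

lemma gammaEval_linearMap_injective :
    Function.Injective fun φ : An.gammaShift i l ⟶ M => gammaEval (linearMap φ) := fun _ _ h =>
  hom_ext fun x => LinearMap.congr_fun (gammaEval_injective h) x

lemma exists_gammaEval_gammaConeRestrict_eq {z : M.carrier × M.carrier} (hz : z ∈ homGroup M i)
    (hzl : z ∈ homDeg M (-(l + 1))) :
    ∃ φ : An.gammaCone i l ⟶ M, gammaEval (gammaConeRestrict φ) = z := by
  obtain ⟨g, rfl⟩ := exists_gammaEval_eq (l := l + 1) hz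
  obtain ⟨φ, rfl⟩ := exists_gammaConeRestrict_eq ((isGradedMap_iff_gammaEval_mem g).2 hzl)
  exact ⟨φ, rfl⟩

lemma gammaEval_gammaConeRestrict_mem_homDeg (φ : An.gammaCone i l ⟶ M) :
    gammaEval (gammaConeRestrict φ) ∈ homDeg M (-(l + 1)) :=
  (isGradedMap_iff_gammaEval_mem _).1 (isGradedMap_gammaConeRestrict φ)

lemma gammaEval_gammaConeRestrict_comp (φ : An.gammaCone i l ⟶ M) (f : M ⟶ N) :
    gammaEval (gammaConeRestrict (φ ≫ f)) = prodMap f (gammaEval (gammaConeRestrict φ)) := by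
  rw [gammaConeRestrict_comp, prodMap_gammaEval]

lemma gammaEval_linearMap_comp (φ : An.gammaShift i l ⟶ M) (f : M ⟶ N) :
    gammaEval (linearMap (φ ≫ f)) = prodMap f (gammaEval (linearMap φ)) :=
  (prodMap_gammaEval f (linearMap φ)).symm

lemma hasLiftingProperty_initial_to_gammaCone_iff (f : M ⟶ N) :
    HasLiftingProperty (initial.to (An.gammaCone i l)) f ↔
      ∀ y ∈ homGroup N i, y ∈ homDeg N (-(l + 1)) →
        ∃ x ∈ homGroup M i, x ∈ homDeg M (-(l + 1)) ∧ prodMap f x = y := by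
  constructor
  · intro _ y hy hyl
    obtain ⟨ψ, rfl⟩ := exists_gammaEval_gammaConeRestrict_eq hy hyl
    have sq : CommSq (initial.to M) (initial.to (An.gammaCone i l)) f ψ :=
      ⟨initial.hom_ext _ _⟩
    refine ⟨_, gammaEval_mem_homGroup _, gammaEval_gammaConeRestrict_mem_homDeg sq.lift, ?_⟩
    rw [← gammaEval_gammaConeRestrict_comp, sq.fac_right]
  · refine fun H => ⟨fun {u ψ} _ => ?_⟩
    obtain ⟨x, hx, hxl, hxy⟩ :=
      H _ (gammaEval_mem_homGroup _) (gammaEval_gammaConeRestrict_mem_homDeg ψ)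
    obtain ⟨φ, rfl⟩ := exists_gammaEval_gammaConeRestrict_eq hx hxl
    refine ⟨⟨⟨φ, initial.hom_ext _ _, gammaConeRestrict_injective (gammaEval_injective ?_)⟩⟩⟩
    rw [gammaEval_gammaConeRestrict_comp, hxy]

lemma hasLiftingProperty_gammaIncl_iff (f : M ⟶ N) :
    HasLiftingProperty (An.gammaIncl i l) f ↔
      ∀ z ∈ homGroup M i, z ∈ homDeg M (-l) → homD M z = 0 →
        ∀ y ∈ homGroup N i, y ∈ homDeg N (-(l + 1)) → prodMap f z = homD N y →
          ∃ x ∈ homGroup M i, x ∈ homDeg M (-(l + 1)) ∧ homD M x = z ∧ prodMap f x = y := by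
  constructor
  · intro _ z hz hzl hDz y hy hyl hzy
    obtain ⟨ψ, rfl⟩ := exists_gammaEval_gammaConeRestrict_eq hy hyl
    obtain ⟨φ, rfl⟩ := exists_gammaEval_linearMap_eq hz hzl hDz
    have sq : CommSq φ (An.gammaIncl i l) f ψ := ⟨gammaEval_linearMap_injective <| by
      dsimp only
      rw [gammaEval_linearMap_comp, hzy, homD_gammaEval_gammaConeRestrict]⟩
    refine ⟨_, gammaEval_mem_homGroup _, gammaEval_gammaConeRestrict_mem_homDeg sq.lift, ?_, ?_⟩
    · rw [homD_gammaEval_gammaConeRestrict, sq.fac_left]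
    · rw [← gammaEval_gammaConeRestrict_comp, sq.fac_right]
  · refine fun H => ⟨fun {φ ψ} sq => ?_⟩
    have hDφ : homD M (gammaEval (linearMap φ)) = 0 :=
      (forall_apply_d_eq_iff_homD_gammaEval _).1 (linearMap_d φ)
    have hφψ : prodMap f (gammaEval (linearMap φ)) =
        homD N (gammaEval (gammaConeRestrict ψ)) := by
      rw [← gammaEval_linearMap_comp, sq.w, homD_gammaEval_gammaConeRestrict]
    obtain ⟨x, hx, hxl, hDx, hxy⟩ := H _ (gammaEval_mem_homGroup _)
      ((isGradedMap_iff_gammaEval_mem _).1 fun _ _ => linearMap_mem φ) hDφ _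
      (gammaEval_mem_homGroup _) (gammaEval_gammaConeRestrict_mem_homDeg ψ) hφψ
    obtain ⟨χ, rfl⟩ := exists_gammaEval_gammaConeRestrict_eq hx hxl
    rw [homD_gammaEval_gammaConeRestrict] at hDx
    rw [← gammaEval_gammaConeRestrict_comp] at hxy
    exact ⟨⟨⟨χ, gammaEval_linearMap_injective hDx,
      gammaConeRestrict_injective (gammaEval_injective hxy)⟩⟩⟩

end Lifting

/-! ### The generating cofibrations and the generating trivial cofibrations -/

variable (An) in
/-- The generating cofibrations: the inclusions of the modules `Γ_i[l]` into the cones of their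
identities. -/
def generatingCofibrations : MorphismProperty (CDGModule An.toCDGAlgebra) :=
  MorphismProperty.ofHoms fun p : Fin (n + 1) × ℤ => An.gammaIncl p.1 p.2

variable (An) in
/-- The generating trivial cofibrations: the inclusions of zero into the cones of the identities of
the modules `Γ_i[l]`. -/
def generatingTrivialCofibrations : MorphismProperty (CDGModule An.toCDGAlgebra) :=
  MorphismProperty.ofHoms fun p : Fin (n + 1) × ℤ => initial.to (An.gammaCone p.1 p.2)

lemma generatingTrivialCofibrations_rlp_iff (f : M ⟶ N) :
    An.generatingTrivialCofibrations.rlp f ↔ An.kerSurjections f := by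
  simp only [kerSurjections_iff, surjective_homMap_iff_homogeneous]
  constructor
  · intro H i hi j
    obtain ⟨l, rfl⟩ : ∃ l, j = -(l + 1) := ⟨-j - 1, by ring⟩
    exact (hasLiftingProperty_initial_to_gammaCone_iff f).1
      (H _ (MorphismProperty.ofHoms.mk (⟨i, Nat.lt_succ_iff.2 hi⟩, l)))
  · rintro H _ _ _ ⟨i, l⟩
    exact (hasLiftingProperty_initial_to_gammaCone_iff f).2 (H i (Nat.lt_succ_iff.1 i.2) _)

lemma generatingCofibrations_rlp_iff (f : M ⟶ N) :
    An.generatingCofibrations.rlp f ↔ An.kerSurjections f ∧ An.IsNQuasiIso f := by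
  simp only [kerSurjections_and_isNQuasiIso_iff, liftsCycles_homMap_iff_homogeneous]
  have hl (l : ℤ) : -(l + 1) + 1 = -l := by ring
  constructor
  · intro H i hi j
    obtain ⟨l, rfl⟩ : ∃ l, j = -(l + 1) := ⟨-j - 1, by ring⟩
    rw [hl]
    exact (hasLiftingProperty_gammaIncl_iff f).1
      (H _ (MorphismProperty.ofHoms.mk (⟨i, Nat.lt_succ_iff.2 hi⟩, l)))
  · rintro H _ _ _ ⟨i, l⟩
    have := H i (Nat.lt_succ_iff.1 i.2) (-(l + 1))
    rw [hl] at this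
    exact (hasLiftingProperty_gammaIncl_iff f).2 this

/-! ### Smallness of the sources -/

section Small

variable {J : Type u} [Preorder J] [IsDirectedOrder J]
  {F : J ⥤ CDGModule An.toCDGAlgebra} {c : Cocone F}

lemma exists_prodMap_app_eq_of_isColimit [Nonempty J] (hc : IsColimit c) {l : ℤ}
    {z : c.pt.carrier × c.pt.carrier} (hz : z ∈ homDeg c.pt l) :
    ∃ j, ∃ w ∈ homDeg (F.obj j) l, prodMap (N := c.pt) (c.ι.app j) w = z := by
  obtain ⟨j₁, x₁, hx₁, h₁⟩ := exists_homogeneous_app_eq_of_isColimit hc hz.1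
  obtain ⟨j₂, x₂, hx₂, h₂⟩ := exists_homogeneous_app_eq_of_isColimit hc hz.2
  obtain ⟨j, hj₁, hj₂⟩ := exists_ge_ge j₁ j₂
  exact ⟨j, (linearMap (F.map (homOfLE hj₁)) x₁, linearMap (F.map (homOfLE hj₂)) x₂),
    ⟨linearMap_mem _ hx₁, linearMap_mem _ hx₂⟩,
    Prod.ext ((cocone_map_apply c hj₁ x₁).trans h₁) ((cocone_map_apply c hj₂ x₂).trans h₂)⟩

lemma exists_prodMap_map_eq_zero_of_isColimit (hc : IsColimit c) {j : J}
    {w : (F.obj j).carrier × (F.obj j).carrier}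
    (hw : prodMap (M := F.obj j) (N := c.pt) (c.ι.app j) w = 0) :
    ∃ j₁, ∃ h₁ : j ≤ j₁, ∀ j₂ (h₂ : j₁ ≤ j₂),
      prodMap (F.map (homOfLE (h₁.trans h₂))) w = 0 := by
  obtain ⟨x, y⟩ := w
  obtain ⟨jx, hx, hx₀⟩ := exists_map_eq_zero_of_isColimit (x := x) hc (congrArg Prod.fst hw)
  obtain ⟨jy, hy, hy₀⟩ := exists_map_eq_zero_of_isColimit (x := y) hc (congrArg Prod.snd hw)
  obtain ⟨j₁, h₁x, h₁y⟩ := exists_ge_ge jx jy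
  refine ⟨j₁, hx.trans h₁x, fun j₂ h₂ => Prod.ext ?_ ?_⟩
  · change linearMap (F.map (homOfLE (hx.trans (h₁x.trans h₂)))) x = 0
    rw [← map_map_apply hx (h₁x.trans h₂), hx₀, map_zero]
  · change linearMap (F.map (homOfLE (hy.trans (h₁y.trans h₂)))) y = 0
    rw [← map_map_apply hy (h₁y.trans h₂), hy₀, map_zero]

lemma exists_cycle_prodMap_app_eq_of_isColimit [Nonempty J] (hc : IsColimit c) {i : ℕ} {l : ℤ}
    {z : c.pt.carrier × c.pt.carrier} (hz : z ∈ homGroup c.pt i) (hzl : z ∈ homDeg c.pt l)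
    (hDz : homD c.pt z = 0) :
    ∃ j, ∃ w ∈ homGroup (F.obj j) i, w ∈ homDeg (F.obj j) l ∧ homD (F.obj j) w = 0 ∧
      prodMap (N := c.pt) (c.ι.app j) w = z := by
  obtain ⟨j, w, hwl, rfl⟩ := exists_prodMap_app_eq_of_isColimit hc hzl
  obtain ⟨x, y⟩ := w
  have hw : prodMap (N := c.pt) (c.ι.app j) (An.t ^ (i + 1) • x, An.t ^ i • y) = 0 := by
    rw [prodMap_apply, map_smul, map_smul]
    exact Prod.ext hz.1 hz.2
  have hDw : prodMap (N := c.pt) (c.ι.app j) (homD (F.obj j) (x, y)) = 0 := by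
    rw [prodMap_homD, hDz]
  obtain ⟨j₁, h₁, hw₁⟩ := exists_prodMap_map_eq_zero_of_isColimit hc hw
  obtain ⟨j₂, h₂, hw₂⟩ := exists_prodMap_map_eq_zero_of_isColimit hc hDw
  obtain ⟨j', h₁', h₂'⟩ := exists_ge_ge j₁ j₂
  have hw' := hw₁ j' h₁'
  rw [prodMap_apply, map_smul, map_smul] at hw'
  refine ⟨j', prodMap (F.map (homOfLE (h₁.trans h₁'))) (x, y), Prod.mk_eq_zero.1 hw',
    ⟨linearMap_mem _ hwl.1, linearMap_mem _ hwl.2⟩, ?_, ?_⟩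
  · rw [← prodMap_homD, hw₂ j' h₂']
  · exact Prod.ext (cocone_map_apply c _ x) (cocone_map_apply c _ y)

variable (F) [Nonempty J]

lemma preservesColimit_gammaShift (i : Fin (n + 1)) (l : ℤ) :
    PreservesColimit F (coyoneda.obj (Opposite.op (An.gammaShift i l))) := by
  refine ⟨fun {c} hc => ⟨Types.FilteredColimit.isColimitOf' _ _ ?_ ?_⟩⟩
  · intro (φ : An.gammaShift i l ⟶ c.pt)
    obtain ⟨j, w, hw, hwl, hDw, hwφ⟩ := exists_cycle_prodMap_app_eq_of_isColimit hc
      (gammaEval_mem_homGroup (linearMap φ))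
      ((isGradedMap_iff_gammaEval_mem _).1 fun _ _ => linearMap_mem φ)
      ((forall_apply_d_eq_iff_homD_gammaEval _).1 (linearMap_d φ))
    obtain ⟨ψ, rfl⟩ := exists_gammaEval_linearMap_eq hw hwl hDw
    refine ⟨j, ψ, gammaEval_linearMap_injective ?_⟩
    exact hwφ.symm.trans (gammaEval_linearMap_comp ψ (c.ι.app j)).symm
  · intro j (φ : An.gammaShift i l ⟶ F.obj j) (ψ : An.gammaShift i l ⟶ F.obj j)
      (h : φ ≫ c.ι.app j = ψ ≫ c.ι.app j)
    have h₀ : prodMap (c.ι.app j) (gammaEval (linearMap φ) - gammaEval (linearMap ψ)) = 0 := by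
      rw [map_sub, ← gammaEval_linearMap_comp, ← gammaEval_linearMap_comp, h, sub_self]
    obtain ⟨j', hj, h'⟩ := exists_prodMap_map_eq_zero_of_isColimit hc h₀
    refine ⟨j', homOfLE hj, gammaEval_linearMap_injective ?_⟩
    refine (gammaEval_linearMap_comp φ _).trans (Eq.trans ?_ (gammaEval_linearMap_comp ψ _).symm)
    rw [← sub_eq_zero, ← map_sub]
    exact h' j' le_rfl

lemma preservesColimit_initial :
    PreservesColimit F (coyoneda.obj (Opposite.op (⊥_ (CDGModule An.toCDGAlgebra)))) :=
  ⟨fun {c} _ => ⟨Types.FilteredColimit.isColimitOf' _ _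
    (fun _ => ⟨Classical.arbitrary J, initial.to _, initial.hom_ext (P := c.pt) _ _⟩)
    fun j _ _ _ => ⟨j, 𝟙 j, initial.hom_ext (P := F.obj j) _ _⟩⟩⟩

end Small

section SmallObjectArgument

variable (An)

attribute [local instance] Cardinal.fact_isRegular_aleph0 Cardinal.orderBotAleph0OrdToType

instance : MorphismProperty.IsSmall.{u} An.generatingCofibrations := by
  have : Small.{u} (Fin (n + 1) × ℤ) := Countable.toSmall _
  unfold generatingCofibrations
  infer_instance

instance : MorphismProperty.IsSmall.{u} An.generatingTrivialCofibrations := by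
  have : Small.{u} (Fin (n + 1) × ℤ) := Countable.toSmall _
  unfold generatingTrivialCofibrations
  infer_instance

instance : An.generatingCofibrations.IsCardinalForSmallObjectArgument Cardinal.aleph0.{u} where
  preservesColimit := by
    rintro _ _ _ _ _ ⟨i, l⟩ _ _
    exact preservesColimit_gammaShift _ i l

instance :
    An.generatingTrivialCofibrations.IsCardinalForSmallObjectArgument Cardinal.aleph0.{u} where
  preservesColimit := by
    rintro _ _ _ _ _ ⟨_⟩ _ _
    exact preservesColimit_initial _

instance : MorphismProperty.HasSmallObjectArgument.{u} An.generatingCofibrations where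
  exists_cardinal := ⟨Cardinal.aleph0, inferInstance, inferInstance, inferInstance⟩

instance : MorphismProperty.HasSmallObjectArgument.{u} An.generatingTrivialCofibrations where
  exists_cardinal := ⟨Cardinal.aleph0, inferInstance, inferInstance, inferInstance⟩

end SmallObjectArgument

end CDGDeformation

/-! ### Lifting against graded split injections -/

lemma llp_initial_iff {C : Type*} [Category* C] [HasInitial C] (W : MorphismProperty C) (Q : C) :
    W.llp (initial.to Q) ↔
      ∀ {X Y : C} (p : X ⟶ Y), W p → ∀ g : Q ⟶ Y, ∃ h : Q ⟶ X, h ≫ p = g := by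
  constructor
  · intro H X Y p hp g
    have := H p hp
    have sq : CommSq (initial.to X) (initial.to Q) p g := ⟨initial.hom_ext _ _⟩
    exact ⟨sq.lift, sq.fac_right⟩
  · intro H X Y p hp
    refine ⟨fun {u g} _ => ?_⟩
    obtain ⟨h, hh⟩ := H p hp g
    exact ⟨⟨⟨h, initial.hom_ext _ _, hh⟩⟩⟩

namespace CDGModule

variable {M N Q X Y : CDGModule B}

/-- The differential `d ρ - ρ d` of a morphism of graded modules `ρ`: the obstruction to `ρ` being
closed. -/
def differential (ρ : M.carrier →ₗ[B.carrier] N.carrier) (hρ : IsGradedMap ρ) : M ⟶ N.shift 1 :=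
  Hom.mk (N := N.shift 1)
    { toFun := fun x => N.toShift 1 (N.d (ρ x) - ρ (M.d x))
      map_add' := fun x y => by
        rw [← map_add]
        congr 1
        simp only [map_add]
        abel
      map_smul' := fun a x => by
        rw [RingHom.id_apply, smul_toShift, map_smul, N.d_smul_eq, M.d_smul_eq, map_add, map_smul,
          map_smul, smul_sub]
        congr 1
        abel }
    (fun hx => sub_mem (N.d_mem (hρ _ _ hx)) (hρ _ _ (M.d_mem hx)))
    (fun x => by
      change N.toShift 1 (N.d (ρ (M.d x)) - ρ (M.d (M.d x))) =
        (N.shift 1).d (N.toShift 1 (N.d (ρ x) - ρ (M.d x)))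
      rw [d_toShift_one, ← map_neg, map_sub N.d, N.d_d, M.d_d, map_smul, neg_sub])

lemma differential_apply (ρ : M.carrier →ₗ[B.carrier] N.carrier) (hρ : IsGradedMap ρ)
    (x : M.carrier) :
    linearMap (differential ρ hρ) x = N.toShift 1 (N.d (ρ x) - ρ (M.d x)) := rfl

section Lift

variable {f : M ⟶ N} {π : N ⟶ Q} {u : M ⟶ X} {w : N ⟶ Y} {p : X ⟶ Y}
  {ρ : N.carrier →ₗ[B.carrier] X.carrier}

lemma exists_hom_cone_of_commSq (sq : CommSq u f p w) (hπ : Function.Surjective (linearMap π))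
    (hfπ : Function.Exact (linearMap f) (linearMap π)) (hρ : IsGradedMap ρ)
    (hρf : ∀ x, ρ (linearMap f x) = linearMap u x) :
    ∃ σ : Q ⟶ cone p, ∀ y, linearMap σ (linearMap π y) =
      coneMk p (linearMap w y - linearMap p (ρ y)) (X.d (ρ y) - ρ (N.d y)) := by
  obtain ⟨ψ, hψ⟩ := exists_desc_of_comp_eq_zero hπ hfπ (differential ρ hρ) <| hom_ext fun x => by
    rw [linearMap_comp, differential_apply, ← linearMap_d, hρf, hρf, linearMap_d, sub_self,
      map_zero, linearMap_zero]
  have hψ (y : N.carrier) : linearMap ψ (linearMap π y) = X.toShift 1 (X.d (ρ y) - ρ (N.d y)) :=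
    fac_apply hψ y
  obtain ⟨k, hk, hkπ⟩ := exists_isGradedMap_desc π hπ (N := Y) (f := linearMap w - linearMap p ∘ₗ ρ)
    (fun i x hx => sub_mem (linearMap_mem w hx) (linearMap_mem p (hρ i x hx))) fun y hy => by
      obtain ⟨x, rfl⟩ := (hfπ y).1 hy
      change linearMap w (linearMap f x) - linearMap p (ρ (linearMap f x)) = 0
      rw [hρf, commSq_apply sq, sub_self]
  have hkπ (y : N.carrier) : k (linearMap π y) = linearMap w y - linearMap p (ρ y) :=
    LinearMap.congr_fun hkπ y
  refine ⟨coneLift k hk ψ (hπ.forall.2 fun y => ?_), fun y => cone_ext (hkπ y) ?_⟩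
  · rw [← linearMap_d, hkπ, hkπ, hψ, AddEquiv.symm_apply_apply, map_sub, map_sub, linearMap_d w,
      linearMap_d p]
    abel
  · rw [coneSnd_lift, hψ, AddEquiv.symm_apply_apply, coneSnd_mk]

lemma hasLift_of_hom_cone_id (sq : CommSq u f p w) (hfπ : f ≫ π = 0) (hρ : IsGradedMap ρ)
    (hρf : ∀ x, ρ (linearMap f x) = linearMap u x) (sq_id : CommSq (𝟙 X) (𝟙 X) p p)
    (τ : Q ⟶ cone (𝟙 X))
    (hτ : ∀ y, linearMap (coneMap sq_id) (linearMap τ (linearMap π y)) =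
      coneMk p (linearMap w y - linearMap p (ρ y)) (X.d (ρ y) - ρ (N.d y))) :
    sq.HasLift := by
  have hτ₁ (y : N.carrier) : linearMap p (coneFst (𝟙 X) (linearMap τ (linearMap π y))) =
      linearMap w y - linearMap p (ρ y) := congrArg (coneFst p) (hτ y)
  have hτ₂ (y : N.carrier) : coneSnd (𝟙 X) (linearMap τ (linearMap π y)) =
      X.d (ρ y) - ρ (N.d y) := congrArg (coneSnd p) (hτ y)
  let h : N ⟶ X :=
    { toLinearMap := ρ + coneFst (𝟙 X) ∘ₗ linearMap (π ≫ τ)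
      map_mem := fun {i x} hx => add_mem (hρ i x hx)
        (isGradedMap_coneFst (𝟙 X) i _ (linearMap_mem (π ≫ τ) hx))
      map_d := fun x => by
        change ρ (N.d x) + coneFst (𝟙 X) (linearMap τ (linearMap π (N.d x))) =
          X.d (ρ x + coneFst (𝟙 X) (linearMap τ (linearMap π x)))
        rw [linearMap_d π, linearMap_d τ, coneFst_d, hτ₂, linearMap_id, map_add]
        abel }
  refine ⟨⟨h, hom_ext fun x => ?_, hom_ext fun y => ?_⟩⟩
  · change ρ (linearMap f x) + coneFst (𝟙 X) (linearMap τ (linearMap π (linearMap f x))) = _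
    rw [fac_apply hfπ, linearMap_zero, map_zero, map_zero, add_zero, hρf]
  · change linearMap p (ρ y + coneFst (𝟙 X) (linearMap τ (linearMap π y))) = _
    rw [map_add, hτ₁, add_sub_cancel]

end Lift

lemma llp_initial_of_llp {W : MorphismProperty (CDGModule B)} {f : M ⟶ N} (hf : W.llp f)
    {π : N ⟶ Q} (hπ : Function.Surjective (linearMap π))
    (hfπ : Function.Exact (linearMap f) (linearMap π)) : W.llp (initial.to Q) := by
  rw [llp_initial_iff]
  intro X Y p hp g
  have := hf p hp
  have := epi_of_surjective π hπ
  have hf₀ : f ≫ π = 0 := hom_ext hfπ.apply_apply_eq_zero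
  have sq : CommSq (0 : M ⟶ X) f p (π ≫ g) := ⟨by rw [← Category.assoc, hf₀, zero_comp, zero_comp]⟩
  obtain ⟨h, hh⟩ := exists_desc_of_comp_eq_zero hπ hfπ sq.lift sq.fac_left
  exact ⟨h, by rw [← cancel_epi π, ← Category.assoc, hh, sq.fac_right]⟩

end CDGModule

namespace CDGDeformation

open CDGModule

variable {M N X Y Q : CDGModule An.toCDGAlgebra}

/-! ### Cofibrations and trivial cofibrations -/

lemma initial_eq_zero (x : (⊥_ (CDGModule An.toCDGAlgebra)).carrier) : x = 0 :=
  eq_zero_of_isInitial (M := ⊥_ (CDGModule An.toCDGAlgebra)) initialIsInitial x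

lemma isNAcyclic_initial : An.IsNAcyclic (⊥_ (CDGModule An.toCDGAlgebra)) :=
  isNAcyclic_iff.2 fun _ _ =>
    have (z : homGroup (⊥_ (CDGModule An.toCDGAlgebra)) _) : z = 0 :=
      Subtype.ext (Prod.ext (initial_eq_zero _) (initial_eq_zero _))
    fun z => ⟨fun _ => ⟨0, (map_zero _).trans (this z).symm⟩, fun _ => this _⟩

lemma kerSurjections_zero_initial (M : CDGModule An.toCDGAlgebra) :
    An.kerSurjections (0 : M ⟶ ⊥_ (CDGModule An.toCDGAlgebra)) := fun _ _ _ y _ =>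
  ⟨0, smul_zero _, by rw [initial_eq_zero y, map_zero]⟩

lemma generatingCofibrations_rlp_cone_id_zero (M : CDGModule An.toCDGAlgebra) :
    An.generatingCofibrations.rlp (0 : cone (𝟙 M) ⟶ ⊥_ (CDGModule An.toCDGAlgebra)) :=
  (generatingCofibrations_rlp_iff _).2 ⟨kerSurjections_zero_initial _,
    isNQuasiIso_of_isNAcyclic (isNAcyclic_cone_id M) isNAcyclic_initial _⟩

lemma generatingCofibrations_rlp_coneMap_id {p : X ⟶ Y} (hp : An.generatingCofibrations.rlp p)
    (sq : CommSq (𝟙 X) (𝟙 X) p p) : An.generatingCofibrations.rlp (coneMap sq) := by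
  obtain ⟨hp₁, hp₂⟩ := (generatingCofibrations_rlp_iff p).1 hp
  refine (generatingCofibrations_rlp_iff _).2
    ⟨fun i hi hi' q hq => ?_, isNQuasiIso_of_isNAcyclic (isNAcyclic_cone_id X) hp₂ _⟩
  obtain ⟨y, x, rfl⟩ := exists_coneMk p q
  change An.t ^ i • coneMk p y x = 0 at hq
  rw [t_pow_smul_coneMk, coneMk_eq_zero_iff] at hq
  obtain ⟨y', hy', rfl⟩ := hp₁ i hi hi' hq.1
  refine ⟨coneMk (𝟙 X) y' x, ?_, coneMap_mk sq y' x⟩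
  change An.t ^ i • coneMk (𝟙 X) y' x = 0
  rw [t_pow_smul_coneMk, coneMk_eq_zero_iff]
  exact ⟨hy', hq.2⟩

lemma isGradedSplitInjection_of_llp {f : M ⟶ N} (hf : An.generatingCofibrations.rlp.llp f) :
    IsGradedSplitInjection f := by
  have := hf _ (generatingCofibrations_rlp_cone_id_zero M)
  have sq : CommSq (coneInl (𝟙 M)) f
    (0 : cone (𝟙 M) ⟶ ⊥_ (CDGModule An.toCDGAlgebra)) 0 := ⟨by rw [comp_zero, comp_zero]⟩
  exact ⟨coneFst (𝟙 M) ∘ₗ linearMap sq.lift,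
    fun i _ hy => isGradedMap_coneFst (𝟙 M) i _ (linearMap_mem sq.lift hy),
    fun x => congrArg (coneFst (𝟙 M)) (fac_apply sq.fac_left x)⟩

lemma llp_of_isGradedSplitInjection {f : M ⟶ N} (hf : IsGradedSplitInjection f)
    {π : N ⟶ Q} (hπ : Function.Surjective (linearMap π))
    (hfπ : Function.Exact (linearMap f) (linearMap π))
    (hQ : An.generatingCofibrations.rlp.llp (initial.to Q)) :
    An.generatingCofibrations.rlp.llp f := by
  intro X Y p hp
  refine ⟨fun {u w} sq => ?_⟩
  obtain ⟨r, hr, hrf⟩ := hf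
  let ρ : N.carrier →ₗ[An.carrier] X.carrier := linearMap u ∘ₗ r
  have hρ : IsGradedMap ρ := fun i y hy => linearMap_mem u (hr i y hy)
  have hρf (x : M.carrier) : ρ (linearMap f x) = linearMap u x := congrArg (linearMap u) (hrf x)
  obtain ⟨σ, hσ⟩ := exists_hom_cone_of_commSq sq hπ hfπ hρ hρf
  obtain ⟨τ, hτ⟩ := (llp_initial_iff _ Q).1 hQ _
    (generatingCofibrations_rlp_coneMap_id hp ⟨rfl⟩) σ
  exact hasLift_of_hom_cone_id sq (hom_ext hfπ.apply_apply_eq_zero) hρ hρf ⟨rfl⟩ τ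
    fun y => (fac_apply hτ _).trans (hσ y)

lemma generatingCofibrations_llp_iff (f : M ⟶ N) : An.generatingCofibrations.rlp.llp f ↔
    IsGradedSplitInjection f ∧ An.generatingCofibrations.rlp.llp (initial.to (coker f)) :=
  have hπ : Function.Surjective (linearMap (quotientπ (range f))) := quotientπ_surjective _
  ⟨fun hf => ⟨isGradedSplitInjection_of_llp hf,
      llp_initial_of_llp (Q := coker f) hf hπ (exact_quotientπ_range f)⟩,
    fun ⟨hf, hQ⟩ => llp_of_isGradedSplitInjection hf hπ (exact_quotientπ_range f) hQ⟩

variable (N) in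
/-- The surjection `cone (𝟙 N[-1]) ⟶ N[-1][1] ≅ N` from an `n`-acyclic module. -/
def pathFibration : cone (𝟙 (N.shift (-1))) ⟶ N :=
  coneπ _ ≫ (N.shiftShiftIso (neg_add_cancel 1)).hom ≫ N.shiftZeroIso.hom

lemma kerSurjections_pathFibration : An.kerSurjections (pathFibration N) := by
  intro i _ _ y hy
  refine ⟨coneMk _ 0 (N.toShift (-1) y), ?_, rfl⟩
  change An.t ^ i • coneMk _ 0 (N.toShift (-1) y) = 0
  have hy : An.t ^ i • y = 0 := hy
  rw [t_pow_smul_coneMk, smul_zero, smul_toShift_of_mem_even _ Even.zero (An.t_pow_mem i), hy,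
    map_zero, coneMk_zero]

lemma isNQuasiIso_of_llp_kerSurjections {f : M ⟶ N} (hf : An.kerSurjections.llp f) :
    An.IsNQuasiIso f := by
  have := hf _ (kerSurjections_zero_initial M)
  have retraction : CommSq (𝟙 M) f (0 : M ⟶ ⊥_ (CDGModule An.toCDGAlgebra)) 0 :=
    ⟨by rw [comp_zero, comp_zero]⟩
  let ρ : N ⟶ M := retraction.lift
  have := hf _ (kerSurjections_pathFibration (N := N))
  have homotopy : CommSq 0 f (pathFibration N) (𝟙 N - ρ ≫ f) := ⟨by
    rw [zero_comp, Preadditive.comp_sub, ← Category.assoc, retraction.fac_left, Category.id_comp,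
      Category.comp_id, sub_self]⟩
  have hρf {i : ℕ} (z : homGroup M i) : homMap ρ i (homMap f i z) = z :=
    Subtype.ext (Prod.ext (fac_apply retraction.fac_left z.1.1)
      (fac_apply retraction.fac_left z.1.2))
  have hfρ {i : ℕ} (w : homGroup N i) : homMap f i (homMap ρ i w) +
      homMap (pathFibration N) i (homMap homotopy.lift i w) = w := by
    have h (x : N.carrier) : linearMap f (linearMap ρ x) +
        linearMap (pathFibration N) (linearMap homotopy.lift x) = x := by
      rw [fac_apply homotopy.fac_right, linearMap_sub, linearMap_comp, linearMap_id,
        add_sub_cancel]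
    exact Subtype.ext (Prod.ext (h w.1.1) (h w.1.2))
  refine (isNQuasiIso_iff f).2 fun i hi => ⟨(homologyMap_injective_iff _).2 fun z y _ hzy =>
    ⟨homMap ρ i y, ?_⟩, (homologyMap_surjective_iff _).2 fun w hw => ?_⟩
  · rw [← homMap_homDiff, ← hzy, hρf]
  · obtain ⟨v, hv⟩ := (isNAcyclic_iff.1 (isNAcyclic_cone_id (N.shift (-1))) i hi
      (homMap homotopy.lift i w)).1 (by rw [← homMap_homDiff, hw, map_zero])
    refine ⟨homMap ρ i w, homMap (pathFibration N) i v, by rw [← homMap_homDiff, hw, map_zero], ?_⟩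
    rw [← homMap_homDiff, hv, hfρ]

variable (An)

lemma generatingTrivialCofibrations_rlp :
    An.generatingTrivialCofibrations.rlp = An.kerSurjections := by
  ext M N f
  exact generatingTrivialCofibrations_rlp_iff f

lemma generatingCofibrations_rlp :
    An.generatingCofibrations.rlp = An.kerSurjections ⊓ An.nQuasiIsos := by
  ext M N f
  exact generatingCofibrations_rlp_iff f

lemma generatingTrivialCofibrations_rlp_llp :
    An.generatingTrivialCofibrations.rlp.llp =
      An.generatingCofibrations.rlp.llp ⊓ An.nQuasiIsos := by
  have isNQuasiIso : An.generatingTrivialCofibrations.rlp.llp ≤ An.nQuasiIsos := by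
    rw [generatingTrivialCofibrations_rlp]
    exact fun _ _ _ => isNQuasiIso_of_llp_kerSurjections
  apply le_antisymm
  · refine le_inf (MorphismProperty.antitone_llp ?_) isNQuasiIso
    rw [generatingTrivialCofibrations_rlp, generatingCofibrations_rlp]
    exact inf_le_left
  · rintro M N f ⟨hf, hf'⟩
    let fac := MorphismProperty.factorizationData An.generatingTrivialCofibrations.rlp.llp
      An.generatingTrivialCofibrations.rlp f
    have hp : An.generatingCofibrations.rlp fac.p := by
      rw [generatingCofibrations_rlp]
      exact ⟨(generatingTrivialCofibrations_rlp_iff _).1 fac.hp,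
        An.nQuasiIsos.of_precomp fac.i fac.p (isNQuasiIso _ fac.hi) (by rwa [fac.fac])⟩
    have := hf _ hp
    exact MorphismProperty.of_retract (RetractArrow.ofLeftLiftingProperty fac.fac) fac.hi

end CDGDeformation

/-! ### Cokernels -/

section Cokernel

variable {C : Type*} [Category* C] [Preadditive C] {X Y Q : C} {f : X ⟶ Y} {π : Y ⟶ Q}

/-- The morphism `π` is a cokernel of `f`; uniqueness of the factorizations is expressed by
`Epi π`. -/
structure IsCokernel (f : X ⟶ Y) (π : Y ⟶ Q) : Prop where
  comp_eq_zero : f ≫ π = 0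
  epi : Epi π
  exists_desc : ∀ {Z : C} (h : Y ⟶ Z), f ≫ h = 0 → ∃ h', π ≫ h' = h

namespace IsCokernel

lemma of_isPushout (h : IsCokernel f π) {X' Y' : C} {a : X ⟶ X'} {f' : X' ⟶ Y'} {b : Y ⟶ Y'}
    (sq : IsPushout a f f' b) : ∃ π' : Y' ⟶ Q, IsCokernel f' π' := by
  have := h.epi
  have w : a ≫ 0 = f ≫ π := by rw [h.comp_eq_zero, comp_zero]
  have h₁ := sq.inl_desc 0 π w
  have h₂ := sq.inr_desc 0 π w
  refine ⟨sq.desc 0 π w, h₁, ⟨fun x y hxy => ?_⟩, fun {Z} g hg => ?_⟩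
  · rw [← cancel_epi π, ← h₂, Category.assoc, Category.assoc, hxy]
  · obtain ⟨h', hh'⟩ := h.exists_desc (b ≫ g) (by
      rw [← Category.assoc, ← sq.w, Category.assoc, hg, comp_zero])
    refine ⟨h', sq.hom_ext ?_ ?_⟩
    · rw [← Category.assoc, h₁, zero_comp, hg]
    · rw [← Category.assoc, h₂, hh']

lemma comp_iso (h : IsCokernel f π) {Q' : C} (e : Q ≅ Q') : IsCokernel f (π ≫ e.hom) where
  comp_eq_zero := by rw [← Category.assoc, h.comp_eq_zero, zero_comp]
  epi :=
    have := h.epi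
    inferInstance
  exists_desc g hg :=
    have ⟨h', hh'⟩ := h.exists_desc g hg
    ⟨e.inv ≫ h', by rw [Category.assoc, Iso.hom_inv_id_assoc, hh']⟩

lemma nonempty_iso (h : IsCokernel f π) {Q' : C} {π' : Y ⟶ Q'} (h' : IsCokernel f π') :
    Nonempty (Q ≅ Q') := by
  have := h.epi
  have := h'.epi
  obtain ⟨g, hg⟩ := h.exists_desc π' h'.comp_eq_zero
  obtain ⟨g', hg'⟩ := h'.exists_desc π h.comp_eq_zero
  exact ⟨g, g', by rw [← cancel_epi π, ← Category.assoc, hg, hg', Category.comp_id],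
    by rw [← cancel_epi π', ← Category.assoc, hg', hg, Category.comp_id]⟩

end IsCokernel

end Cokernel

section CokernelCDGModule

open CDGModule

variable {X Y Q : CDGModule B}
  {f : X ⟶ Y} {π : Y ⟶ Q}

lemma IsCokernel.surjective (h : IsCokernel f π) : Function.Surjective (linearMap π) := fun q => by
  have := h.epi
  have h₀ : quotientπ (range π) = 0 := by
    rw [← cancel_epi π, comp_quotientπ_range, comp_zero]
  exact (quotientπ_eq_zero_iff (range π) q).1 (congr_linearMap h₀ q)

lemma IsCokernel.exact (h : IsCokernel f π) :
    Function.Exact (linearMap f) (linearMap π) := fun y => by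
  refine ⟨fun hy => ?_, fun ⟨x, hx⟩ => hx ▸ fac_apply h.comp_eq_zero x⟩
  obtain ⟨g, hg⟩ := h.exists_desc _ (comp_quotientπ_range f)
  refine (exact_quotientπ_range f y).1 ?_
  rw [← fac_apply hg, hy, map_zero]

lemma isCokernel_of_surjective (hπ : Function.Surjective (linearMap π))
    (hfπ : Function.Exact (linearMap f) (linearMap π)) : IsCokernel f π where
  comp_eq_zero := hom_ext hfπ.apply_apply_eq_zero
  epi := epi_of_surjective π hπ
  exists_desc := exists_desc_of_comp_eq_zero hπ hfπ

lemma isCokernel_coneπ (f : X ⟶ Y) : IsCokernel (coneInl f) (coneπ f) :=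
  isCokernel_of_surjective (fun x => ⟨coneMk f 0 x, rfl⟩) fun p => by
    obtain ⟨y, x, rfl⟩ := exists_coneMk f p
    exact ⟨fun (hx : x = 0) => ⟨y, hx ▸ rfl⟩, fun ⟨z, hz⟩ => (congrArg (coneSnd f) hz).symm⟩

lemma exists_isCokernel_of_coproducts {ι : Type u} {X₁ X₂ : Discrete ι ⥤ CDGModule B}
    {c₁ : Cocone X₁} {c₂ : Cocone X₂} (h₁ : IsColimit c₁) (h₂ : IsColimit c₂) (f : X₁ ⟶ X₂)
    {Q : ι → CDGModule B} {π : ∀ j, X₂.obj ⟨j⟩ ⟶ Q j}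
    (hπ : ∀ j, IsCokernel (f.app ⟨j⟩) (π j)) :
    ∃ p : c₂.pt ⟶ directSum Q, IsCokernel (h₁.desc (Cocone.mk _ (f ≫ c₂.ι))) p := by
  let s : Cocone X₂ := ⟨directSum Q, Discrete.natTrans fun ⟨j⟩ => π j ≫ directSumι Q j⟩
  have hs (j : ι) : c₂.ι.app ⟨j⟩ ≫ h₂.desc s = π j ≫ directSumι Q j := h₂.fac s ⟨j⟩
  have hf (j : ι) : c₁.ι.app ⟨j⟩ ≫ h₁.desc (Cocone.mk _ (f ≫ c₂.ι)) =
      f.app ⟨j⟩ ≫ c₂.ι.app ⟨j⟩ := h₁.fac (Cocone.mk _ (f ≫ c₂.ι)) ⟨j⟩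
  refine ⟨h₂.desc s, h₁.hom_ext fun ⟨j⟩ => ?_, ⟨fun x y hxy => ?_⟩, fun {Z} g hg => ?_⟩
  · rw [← Category.assoc, hf, Category.assoc, hs, ← Category.assoc, (hπ j).comp_eq_zero,
      zero_comp, comp_zero]
  · refine directSum_hom_ext fun j => ?_
    have := (hπ j).epi
    rw [← cancel_epi (π j), ← Category.assoc, ← Category.assoc, ← hs, Category.assoc,
      Category.assoc, hxy]
  · choose h' hh' using fun j => (hπ j).exists_desc (c₂.ι.app ⟨j⟩ ≫ g) (by
      rw [← Category.assoc, ← hf, Category.assoc, hg, comp_zero])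
    refine ⟨directSumDesc h', h₂.hom_ext fun ⟨j⟩ => ?_⟩
    rw [← Category.assoc, hs, Category.assoc, directSumι_desc, hh']

end CokernelCDGModule

/-! ### Semifree modules are cofibrant -/

lemma llp_initial_of_retract {C : Type*} [Category* C] [HasInitial C] {W : MorphismProperty C}
    {P Q : C} (hP : W.llp (initial.to P)) (r : Retract Q P) : W.llp (initial.to Q) := by
  rw [llp_initial_iff] at hP ⊢
  intro X Y p hp g
  obtain ⟨h, hh⟩ := hP p hp (r.r ≫ g)
  exact ⟨r.i ≫ h, by rw [Category.assoc, hh, Retract.retract_assoc]⟩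

namespace CDGModule

variable {M N P X Y Q : CDGModule B}
  {W : MorphismProperty (CDGModule B)}

lemma llp_initial_directSum {ι : Type u} {F : ι → CDGModule B}
    (hF : ∀ j, W.llp (initial.to (F j))) : W.llp (initial.to (directSum F)) := by
  simp only [llp_initial_iff] at hF ⊢
  intro X Y p hp g
  choose φ hφ using fun j => hF j p hp (directSumι F j ≫ g)
  refine ⟨directSumDesc φ, directSum_hom_ext fun j => ?_⟩
  rw [← Category.assoc, directSumι_desc, hφ]

lemma nonempty_isColimit_of_injective {J : Type} [Preorder J] [IsDirectedOrder J] [Nonempty J]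
    {G : J ⥤ CDGModule B} (c : Cocone G)
    (hc : ∀ x : c.pt.carrier, ∃ j y, linearMap (c.ι.app j) y = x)
    (hc' : ∀ j, Function.Injective (linearMap (c.ι.app j))) : Nonempty (IsColimit c) := by
  have : HasColimitsOfSize.{0, 0} (CDGModule B) := hasColimitsOfSizeShrink.{0, 0, u, u} _
  let h := colimit.isColimit G
  have desc_apply (j : J) (y : (G.obj j).carrier) : linearMap (h.desc c)
      (linearMap ((colimit.cocone G).ι.app j) y) = linearMap (c.ι.app j) y :=
    fac_apply (h.fac c j) y
  have : IsIso (h.desc c) := by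
    refine isIso_of_bijective _ ⟨(injective_iff_map_eq_zero _).2 fun x hx => ?_, fun x => ?_⟩
    · obtain ⟨j, y, rfl⟩ := exists_app_eq_of_isColimit h x
      rw [desc_apply] at hx
      rw [hc' j (hx.trans (map_zero _).symm), map_zero]
    · obtain ⟨j, y, rfl⟩ := hc x
      exact ⟨_, desc_apply j y⟩
  exact ⟨h.ofPointIso⟩

lemma llp_initial_of_filtration {F : ℕ → QDGSubmodule P.toQDGModule}
    (hF₀ : (F 0).toSubmodule = ⊥) (hF : ∀ x : P.carrier, ∃ i, x ∈ (F i).toSubmodule)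
    (hle : ∀ i, (F i).toSubmodule ≤ (F (i + 1)).toSubmodule) (hW : ∀ i, W.llp (subMap (hle i))) :
    W.llp (initial.to P) := by
  let G : ℕ ⥤ CDGModule B := Functor.ofSequence fun i => subMap (hle i)
  let c : Cocone G := ⟨P, NatTrans.ofSequence (fun i => subι (F i)) fun i => by
    rw [Functor.ofSequence_map_homOfLE_succ]
    rfl⟩
  obtain ⟨hc⟩ := nonempty_isColimit_of_injective c
    (fun x => have ⟨i, hi⟩ := hF x; ⟨i, ⟨x, hi⟩, rfl⟩) fun i => Subtype.val_injective
  rw [llp_initial_iff]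
  intro X Y p hp g
  have : HasLiftingProperty (subι (F 0)) p :=
    HasLiftingProperty.transfiniteComposition.hasLiftingProperty_ι_app_bot (hc := hc) fun i _ => by
      have := hW i p hp
      rwa [← Functor.ofSequence_map_homOfLE_succ (fun i => subMap (hle i)) i] at this
  have sq : CommSq 0 (subι (F 0)) p g := ⟨hom_ext fun x => by
    have hx : x = 0 := Subtype.ext ((Submodule.mem_bot _).1 (hF₀.le x.2))
    rw [hx, map_zero, map_zero]⟩
  exact ⟨sq.lift, sq.fac_right⟩

/-- The projection from `T` to `T / S`. -/
def subquotientπ (T S : QDGSubmodule M.toQDGModule) : sub T ⟶ subquotient T S :=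
  quotientπ (M := sub T) (S.restrict T)

lemma isCokernel_subquotientπ {T S : QDGSubmodule M.toQDGModule}
    (h : S.toSubmodule ≤ T.toSubmodule) : IsCokernel (subMap h) (subquotientπ T S) :=
  isCokernel_of_surjective (quotientπ_surjective (M := sub T) (S.restrict T)) fun y =>
    (quotientπ_eq_zero_iff (M := sub T) (S.restrict T) y).trans
      ⟨fun hy => ⟨⟨_, hy⟩, rfl⟩, fun ⟨x, hx⟩ => hx ▸ x.2⟩

/-! ### Relative cell complexes are semifree -/

lemma IsGradedSplitInjection.injective {f : M ⟶ N} (hf : IsGradedSplitInjection f) :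
    Function.Injective (linearMap f) :=
  have ⟨_, _, hr⟩ := hf
  Function.LeftInverse.injective hr

lemma inclusionGradedSplits_range {u : X ⟶ Y} {f : X ⟶ P} {g : Y ⟶ P} (w : u ≫ g = f)
    (hf : IsGradedSplitInjection f) : InclusionGradedSplits (range f) (range g) := by
  have hle : (range f).toSubmodule ≤ (range g).toSubmodule := by
    rintro _ ⟨x, rfl⟩
    exact ⟨linearMap u x, fac_apply w x⟩
  obtain ⟨r, hr, hrf⟩ := hf
  refine ⟨hle, (linearMap f).rangeRestrict ∘ₗ r ∘ₗ (range g).toSubmodule.subtype,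
    fun i y hy => linearMap_mem f (hr i _ hy), ?_⟩
  rintro ⟨_, x, rfl⟩
  exact Subtype.ext (congrArg (linearMap f) (hrf x))

lemma nonempty_subquotient_range_iso {u : X ⟶ Y} {f : X ⟶ P} {g : Y ⟶ P} (w : u ≫ g = f)
    (hg : Function.Injective (linearMap g)) {π : Y ⟶ Q} (hπ : IsCokernel u π) :
    Nonempty (subquotient (range g) (range f) ≅ Q) := by
  let rangeπ : Y ⟶ sub (range g) := subLift (range g) g fun y => ⟨y, rfl⟩
  refine IsCokernel.nonempty_iso (π := rangeπ ≫ subquotientπ (range g) (range f))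
    (isCokernel_of_surjective (fun q => ?_) fun y => ?_) hπ
  · obtain ⟨⟨_, y, rfl⟩, rfl⟩ := quotientπ_surjective (M := sub (range g)) _ q
    exact ⟨y, rfl⟩
  · refine (quotientπ_eq_zero_iff (M := sub (range g)) _ _).trans ⟨?_, ?_⟩
    · rintro ⟨x, hx⟩
      exact ⟨x, hg ((fac_apply w x).trans hx)⟩
    · rintro ⟨x, rfl⟩
      exact ⟨x, (fac_apply w x).symm⟩

end CDGModule

namespace CDGDeformation

open CDGModule

variable {M N P Q : CDGModule An.toCDGAlgebra}

lemma exists_isCokernel_gammaIncl (i : Fin (n + 1)) (l : ℤ) :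
    ∃ π : An.gammaCone i l ⟶ An.gammaShift i (l + 1), IsCokernel (An.gammaIncl i l) π :=
  ⟨_, (isCokernel_coneπ (𝟙 (An.gammaShift i l))).comp_iso ((An.gamma i).shiftShiftIso rfl)⟩

lemma llp_initial_gammaShift (i : Fin (n + 1)) (l : ℤ) :
    An.generatingCofibrations.rlp.llp (initial.to (An.gammaShift i l)) := by
  obtain ⟨l, rfl⟩ : ∃ m, l = m + 1 := ⟨l - 1, by ring⟩
  obtain ⟨π, hπ⟩ := exists_isCokernel_gammaIncl (An := An) i l
  exact llp_initial_of_llp (An.generatingCofibrations.le_llp_rlp _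
    (MorphismProperty.ofHoms.mk ((i, l) : Fin (n + 1) × ℤ))) hπ.surjective hπ.exact

lemma llp_initial_of_isNSemifree (hP : An.IsNSemifree P) :
    An.generatingCofibrations.rlp.llp (initial.to P) := by
  obtain ⟨F, hF₀, hF, hF'⟩ := hP
  refine llp_initial_of_filtration hF₀ hF (fun i => (hF' i).1.choose) fun i => ?_
  obtain ⟨⟨h, hs⟩, ι, s, l, ⟨e⟩⟩ := hF' i
  have hπ := isCokernel_subquotientπ h
  exact llp_of_isGradedSplitInjection hs hπ.surjective hπ.exact <| llp_initial_of_retract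
    (llp_initial_directSum fun j => llp_initial_gammaShift (s j) (l j)) e.retract

lemma exists_isCokernel_of_pushouts_coproducts {f : M ⟶ N}
    (hf : (MorphismProperty.coproducts.{u} An.generatingCofibrations).pushouts f) :
    ∃ (ι : Type u) (s : ι → Fin (n + 1)) (l : ι → ℤ)
      (π : N ⟶ directSum fun j => (An.gamma (s j)).shift (l j)), IsCokernel f π := by
  obtain ⟨X, Y, g, a, b, hg, sq⟩ := hf
  rw [MorphismProperty.coproducts_iff] at hg
  obtain ⟨ι, X₁, X₂, c₁, c₂, h₁, h₂, φ, hφ⟩ := hg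
  have exists_isCokernel {X Y : CDGModule An.toCDGAlgebra} {f : X ⟶ Y}
      (hf : An.generatingCofibrations f) :
      ∃ (i : Fin (n + 1)) (l : ℤ) (π : Y ⟶ An.gammaShift i l), IsCokernel f π := by
    obtain ⟨i, l⟩ := hf
    exact ⟨i, l + 1, exists_isCokernel_gammaIncl i l⟩
  choose s l π hπ using fun j : ι => exists_isCokernel (hφ ⟨j⟩)
  obtain ⟨p, hp⟩ := exists_isCokernel_of_coproducts h₁ h₂ φ hπ
  exact ⟨ι, s, l, hp.of_isPushout sq⟩

lemma llp_rlp_incl_app {C : Type*} [Category* C] {I : MorphismProperty C} {J : Type*}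
    [LinearOrder J] [SuccOrder J] [OrderBot J] [WellFoundedLT J] {X Y : C} {f : X ⟶ Y}
    (c : (MorphismProperty.coproducts.{u} I).pushouts.TransfiniteCompositionOfShape J f) (j : J) :
    I.rlp.llp (c.incl.app j) :=
  I.transfiniteCompositionsOfShape_pushouts_coproducts_le_llp_rlp _ _ ⟨c.ici j⟩

lemma isNSemifree_of_transfiniteComposition {f : M ⟶ P} (hM : ∀ x : M.carrier, x = 0)
    (c : (MorphismProperty.coproducts.{u}
      An.generatingCofibrations).pushouts.TransfiniteCompositionOfShape ℕ f) :
    An.IsNSemifree P := by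
  let ι (i : ℕ) : c.F.obj i ⟶ P := c.incl.app i
  have hι (i : ℕ) : c.F.map (homOfLE (Nat.le_succ i)) ≫ ι (i + 1) = ι i :=
    (Cocone.mk P c.incl).w (homOfLE (Nat.le_succ i))
  have hsplit (i : ℕ) : IsGradedSplitInjection (ι i) :=
    isGradedSplitInjection_of_llp (llp_rlp_incl_app c i)
  refine ⟨fun i => range (ι i), ?_, exists_app_eq_of_isColimit c.isColimit, fun i =>
    ⟨inclusionGradedSplits_range (hι i) (hsplit i), ?_⟩⟩
  · refine eq_bot_iff.2 ?_
    rintro _ ⟨x, rfl⟩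
    have hx : x = 0 := by
      have h := fac_apply c.isoBot.hom_inv_id x
      rw [hM (linearMap c.isoBot.hom x), map_zero] at h
      exact h.symm
    exact (congrArg (linearMap (ι 0)) hx).trans (map_zero _)
  · obtain ⟨κ, s, l, π, hπ⟩ := exists_isCokernel_of_pushouts_coproducts
      (c.map_mem i (not_isMax i))
    exact ⟨κ, s, l, nonempty_subquotient_range_iso (hι i) (hsplit (i + 1)).injective hπ⟩

attribute [local instance] Cardinal.fact_isRegular_aleph0 Cardinal.orderBotAleph0OrdToType

lemma llp_initial_iff_exists_retract (Q : CDGModule An.toCDGAlgebra) :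
    An.generatingCofibrations.rlp.llp (initial.to Q) ↔
      ∃ P : CDGModule An.toCDGAlgebra, An.IsNSemifree P ∧ Nonempty (Retract Q P) := by
  refine ⟨fun hQ => ?_, fun ⟨P, hP, ⟨r⟩⟩ =>
    llp_initial_of_retract (llp_initial_of_isNSemifree hP) r⟩
  obtain ⟨h, hh⟩ := (llp_initial_iff _ Q).1 hQ _
    (SmallObject.rlp_πObj An.generatingCofibrations Cardinal.aleph0.{u} (initial.to Q)) (𝟙 Q)
  refine ⟨_, ?_, ⟨⟨h, _, hh⟩⟩⟩
  let e : ℕ ≃o Cardinal.aleph0.{u}.ord.ToType :=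
    ULift.orderIso.{u}.symm.trans
      (OrderIso.ofRelIsoLT (Nonempty.some (by simp [← Ordinal.type_eq])))
  have hι := SmallObject.transfiniteCompositionsOfShape_ιObj An.generatingCofibrations
    Cardinal.aleph0.{u} (initial.to Q)
  rw [← MorphismProperty.transfiniteCompositionsOfShape_eq_of_orderIso _ e] at hι
  exact isNSemifree_of_transfiniteComposition initial_eq_zero hι.some

end CDGDeformation

lemma isWeakFactorizationSystem_llp_rlp {C : Type (u + 1)} [Category.{u} C]
    (I : MorphismProperty C) [MorphismProperty.HasSmallObjectArgument.{u} I] :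
    MorphismProperty.IsWeakFactorizationSystem I.rlp.llp I.rlp :=
  MorphismProperty.IsWeakFactorizationSystem.mk' _ _ fun _ p hi hp => hi p hp

namespace CDGDeformation

variable (An)

/-! ### The model structure -/

/-- The model structure on the category of cdg modules over a deformation whose weak equivalences
are the `n`-quasi-isomorphisms. -/
@[reducible]
def modelCategory : ModelCategory (CDGModule An.toCDGAlgebra) :=
  letI : CategoryWithFibrations (CDGModule An.toCDGAlgebra) := ⟨An.kerSurjections⟩
  letI : CategoryWithCofibrations (CDGModule An.toCDGAlgebra) :=
    ⟨An.generatingCofibrations.rlp.llp⟩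
  letI : CategoryWithWeakEquivalences (CDGModule An.toCDGAlgebra) := ⟨An.nQuasiIsos⟩
  haveI : (weakEquivalences (CDGModule An.toCDGAlgebra)).HasTwoOutOfThreeProperty :=
    inferInstanceAs An.nQuasiIsos.HasTwoOutOfThreeProperty
  haveI : MorphismProperty.IsWeakFactorizationSystem (cofibrations (CDGModule An.toCDGAlgebra))
      (trivialFibrations (CDGModule An.toCDGAlgebra)) := by
    change MorphismProperty.IsWeakFactorizationSystem An.generatingCofibrations.rlp.llp
      (An.kerSurjections ⊓ An.nQuasiIsos)
    rw [← generatingCofibrations_rlp]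
    exact isWeakFactorizationSystem_llp_rlp _
  haveI : MorphismProperty.IsWeakFactorizationSystem
      (trivialCofibrations (CDGModule An.toCDGAlgebra))
      (fibrations (CDGModule An.toCDGAlgebra)) := by
    change MorphismProperty.IsWeakFactorizationSystem
      (An.generatingCofibrations.rlp.llp ⊓ An.nQuasiIsos) An.kerSurjections
    rw [← generatingTrivialCofibrations_rlp_llp, ← generatingTrivialCofibrations_rlp]
    exact isWeakFactorizationSystem_llp_rlp _
  ModelCategory.mk' _

end CDGDeformation

end Curved

end

theorem mainTheorem11 {k : Type v} [CommRing k] (A : Curved.DGAlgebra.{v, u} k) (n : ℕ)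
    (An : Curved.CDGDeformation A n) :
    ∃ _ : HomotopicalAlgebra.ModelCategory (Curved.CDGModule An.toCDGAlgebra),
      Curved.IsCofibrantlyGenerated (Curved.CDGModule An.toCDGAlgebra) ∧
      (∀ {M N : Curved.CDGModule An.toCDGAlgebra} (f : M ⟶ N),
        HomotopicalAlgebra.WeakEquivalence f ↔ An.IsNQuasiIso f) ∧
      (∀ {M N : Curved.CDGModule An.toCDGAlgebra} (f : M ⟶ N),
        HomotopicalAlgebra.Fibration f ↔ ∀ i : ℕ, 1 ≤ i → i ≤ n + 1 →
          Set.SurjOn (Curved.CDGModule.linearMap f) (An.kerTPow M i) (An.kerTPow N i)) ∧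
      (∀ Q : Curved.CDGModule An.toCDGAlgebra,
        HomotopicalAlgebra.IsCofibrant Q ↔
          ∃ P : Curved.CDGModule An.toCDGAlgebra,
            An.IsNSemifree P ∧ Nonempty (CategoryTheory.Retract Q P)) ∧
      (∀ {M N : Curved.CDGModule An.toCDGAlgebra} (f : M ⟶ N),
        HomotopicalAlgebra.Cofibration f ↔
          Curved.CDGModule.IsGradedSplitInjection f ∧
            HomotopicalAlgebra.IsCofibrant (Curved.CDGModule.coker f)) := by
  let := An.modelCategory
  refine ⟨An.modelCategory, ?_, fun f => HomotopicalAlgebra.weakEquivalence_iff f,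
    fun f => HomotopicalAlgebra.fibration_iff f, fun Q => ?_, fun f => ?_⟩
  · exact ⟨An.generatingCofibrations, An.generatingTrivialCofibrations, inferInstance,
      inferInstance, An.generatingCofibrations_rlp.symm, An.generatingTrivialCofibrations_rlp.symm⟩
  · rw [HomotopicalAlgebra.isCofibrant_iff, HomotopicalAlgebra.cofibration_iff]
    exact Curved.CDGDeformation.llp_initial_iff_exists_retract Q
  · rw [HomotopicalAlgebra.isCofibrant_iff, HomotopicalAlgebra.cofibration_iff,
      HomotopicalAlgebra.cofibration_iff]
    exact Curved.CDGDeformation.generatingCofibrations_llp_iff f
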